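/- Let $S$ be a Riemann surface (for instance a disc), $E\to S$ a holomorphic vector bundle of rank $r=n+1$, $f:\mathcal X=\mathbb P(E^*)\to S$ the bundle of lines in the dual spaces, with fibers $X_s\cong\mathbb P^n$, and $\mathcal O_E(k)$ the $k$-th power of the dual of the tautological bundle. Let $s$ be a local holomorphic coordinate on $S$ and $z=(z^\alpha)$ affine fiber coordinates given by a local holomorphic frame $(e_i)$ of $E$. For a smooth hermitian metric $e^{-\varphi}$ on $\mathcal O_E(k)$ that is positive along the fibers put $g_{\alpha\bar\beta}=\partial_\alpha\partial_{\bar\beta}\varphi$, $\omega_s=\sqrt{-1}\,g_{\alpha\bar\beta}\,dz^\alpha\wedge dz^{\bar\beta}$, $a^\alpha=-g^{\bar\beta\alpha}\partial_s\partial_{\bar\beta}\varphi$, and let $v=\partial_s+a^\alpha\partial_\alpha$ be the horizontal lift of $\partial_s$. The geodesic curvature is the function $c(\varphi)=\langle v,v\rangle_{\sqrt{-1}\partial\bar\partial\varphi}$; the Kodaira–Spencer form is $A^\varphi_s=\bar\partial v|_{X_s}=\partial_{\bar\beta}a^\alpha\,dz^{\bar\beta}\otimes\partial_\alpha$, with pointwise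 norm $|A^\varphi_s|^2$ with respect to $\omega_s$; and $\Box_{\omega_s}=-g^{\bar\beta\alpha}\partial_\alpha\partial_{\bar\beta}$. Let $u$ be a local holomorphic frame of $\det E\cong f_*(K_{\mathcal X/S}\otimes\mathcal O_E(r))$. For a metric $e^{-\varphi}$ on $\mathcal O_E(r)$ let $\|u_s\|^2_\varphi=\int_{X_s}|u_s|^2e^{-\varphi}$. Let $\mu_\varphi$ be the probability measure $|u_s|^2e^{-\varphi}/\|u_s\|_\varphi^2$ on $X_s$ (independent of $u$) and $\mathrm{MA}(\varphi)=\omega_s^n/\int_{X_s}\omega_s^n$. Let $J\subset\mathbb R$ be a nondegenerate interval (for instance $[0,\infty)$) and let $(e^{-\varphi_t})_{t\in J}$ be a smooth family of metrics on $\mathcal O_E(r)$, positive along the fibers, which solves the relative Kähler–Ricci flow $$\dot\varphi_t=\log\frac{\mathrm{MA}(\varphi_t)}{\mu_{\varphi_t}}.$$ **(Evolution equation.)** On each fiber $X_s$ and for each $t\in J$, with $\omega_t$ the form on $X_s$ defined by $\varphi_t$, $$\frac{\partial c(\varphi_t)}{\partial t}=-\Box_{\omega_t}c(\varphi_t)+c(\varphi_t)+|A_s^{\varphi_t}|^2_{\omega_t}+\partial_s\partial_{\bar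 s}\log\int_{X_s}|u_s|^2e^{-\varphi_t}.$$ Equivalently, for the metric $e^{-\varphi_t/r}$ on $\mathcal O_E(1)$ and its fiber form $\omega_t'=\omega_t/r$, $$\frac{\partial c(\varphi_t)}{\partial t}=-\Box_{\omega_t'}c(\varphi_t/r)+r\,c(\varphi_t/r)+|A_s^{\varphi_t/r}|^2_{\omega_t'}+\partial_s\partial_{\bar s}\log\int_{X_s}|u_s|^2e^{-\varphi_t}.$$ **(Limit.)** Suppose that $J$ is unbounded above and that $e^{-\varphi_\infty}$ is a smooth metric on $\mathcal O_E(r)$ such that $\varphi_t\to\varphi_\infty$ in $C^\infty(X_s)$ on every fiber as $t\to\infty$. Then $e^{-\varphi_\infty}$ is positive along the fibers, and there is a constant $\kappa>0$ such that, with the metric $h=e^{-\varphi}$, $\varphi=\varphi_\infty/r$, on $\mathcal O_E(1)$, its fiber forms $\omega_s=\sqrt{-1}\,g_{\alpha\bar\beta}\,dz^\alpha\wedge dz^{\bar\beta}$, and the metric $G(u,u)=\kappa\int_{X_s}|u_s|^2e^{-\varphi_\infty}$ on $\det E$, the canonical isomorphism $K_{\mathcal X/S}^{-1}\cong\mathcal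 O_E(r)\otimes f^*\det(E)^{-1}$ is an isometry for $\det(g_{\alpha\bar\beta})$ and $h^r\otimes f^*G^{-1}$, and $$(\Box_{\omega_s}-r)\,c(\varphi)=|A_s^{\varphi}|^2-R_G^{\det E},\qquad R_G^{\det E}=-\partial_s\partial_{\bar s}\log G(u,u).$$ -/

import Mathlib

open scoped Manifold ContDiff Topology ComplexOrder
open Set Filter MeasureTheory

noncomputable section

namespace RelKRF

/-! ### Calculus on a domain with coordinates `(s, z)` -/

section Wirtinger

variable {V : Type*} [NormedAddCommGroup V] [NormedSpace ℝ V] [Module ℂ V]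

/-- The `(1,0)`-derivative `∂_ξ f` in the constant direction `ξ` (complex linear in `ξ`). -/
def dW (ξ : V) (f : V → ℂ) (x : V) : ℂ :=
  (fderiv ℝ f x ξ - Complex.I * fderiv ℝ f x (Complex.I • ξ)) / 2

/-- The `(0,1)`-derivative of `f` in the constant direction `ξ` (antilinear in `ξ`). -/
def dWbar (ξ : V) (f : V → ℂ) (x : V) : ℂ :=
  (fderiv ℝ f x ξ + Complex.I * fderiv ℝ f x (Complex.I • ξ)) / 2

/-- The Levi form `∂∂̄Φ(ξ, η̄) = ∑ Φ_{A B̄} ξ^A conj(η^B)`. -/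
def levi (Φ : V → ℝ) (x : V) (ξ η : V) : ℂ :=
  dW ξ (dWbar η (fun y => (Φ y : ℂ))) x

end Wirtinger

variable {n : ℕ}

/-- Local coordinates on the total space: one base coordinate `s` and `n` fiber coordinates `z`. -/
abbrev Loc (n : ℕ) : Type := ℂ × (Fin n → ℂ)

/-- The base coordinate direction `∂_s`. -/
def eBase : Loc n := (1, 0)

/-- The fiber coordinate direction `∂_α`. -/
def eFib (α : Fin n) : Loc n := (0, Pi.single α 1)

/-- The matrix `g_{α β̄} = ∂_α ∂_β̄ Φ` of the fiber form `ω_s = √-1 g_{α β̄} dz^α ∧ dz̄^β`. -/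
def fiberMetric (Φ : Loc n → ℝ) (p : Loc n) : Matrix (Fin n) (Fin n) ℂ :=
  fun α β => levi Φ p (eFib α) (eFib β)

/-- The coefficients `a^α = - g^{β̄ α} Φ_{s β̄}` of the horizontal lift. -/
def liftCoeff (Φ : Loc n → ℝ) (p : Loc n) (α : Fin n) : ℂ :=
  -∑ β, (fiberMetric Φ p)⁻¹ β α * levi Φ p eBase (eFib β)

/-- The horizontal lift `v = ∂_s + a^α ∂_α` of `∂_s`. -/
def horizontalLift (Φ : Loc n → ℝ) (p : Loc n) : Loc n := (1, liftCoeff Φ p)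

/-- The geodesic curvature `c(Φ) = ⟨v, v⟩`, the pairing being given by `√-1 ∂∂̄Φ`. -/
def geodesicCurvature (Φ : Loc n → ℝ) (p : Loc n) : ℂ :=
  levi Φ p (horizontalLift Φ p) (horizontalLift Φ p)

/-- The coefficients `A^α_β̄ = ∂_β̄ a^α` of the Kodaira-Spencer form `A_s = ∂̄(v)|_{X_s}`. -/
def kodairaSpencer (Φ : Loc n → ℝ) (p : Loc n) (α β : Fin n) : ℂ :=
  dWbar (eFib β) (fun q => liftCoeff Φ q α) p

/-- The pointwise squared norm
`|A_s|² = A^α_β̄ conj(A^γ_δ̄) g_{α γ̄} g^{β̄ δ}` with respect to the fiber metric. -/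
def kodairaSpencerNormSq (Φ : Loc n → ℝ) (p : Loc n) : ℂ :=
  ∑ α, ∑ β, ∑ γ, ∑ δ, kodairaSpencer Φ p α β * star (kodairaSpencer Φ p γ δ) *
    fiberMetric Φ p α γ * (fiberMetric Φ p)⁻¹ β δ

/-- The (nonnegative) `∂̄`-Laplacian of the fiber metric, `□ f = - g^{β̄ α} ∂_α ∂_β̄ f`. -/
def box (Φ : Loc n → ℝ) (f : Loc n → ℂ) (p : Loc n) : ℂ :=
  -∑ α, ∑ β, (fiberMetric Φ p)⁻¹ β α * dW (eFib α) (dWbar (eFib β) f) p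

/-- The density of `(√-1 ∂∂̄Φ|_{X_s})^n` with respect to Lebesgue measure in the coordinates `z`. -/
def formDensity (Φ : Loc n → ℝ) (p : Loc n) : ℝ :=
  (n.factorial : ℝ) * 2 ^ n * (fiberMetric Φ p).det.re

/-- The density of the Monge-Ampère measure `V⁻¹ (√-1 ∂∂̄Φ)^n`, `V = ∫_{X_s} (√-1 ∂∂̄Φ)^n`.
The affine chart `ℂⁿ` of the fiber `X_s ≅ ℙⁿ` has full measure. -/
def maDensity (Φ : Loc n → ℝ) (p : Loc n) : ℝ :=
  formDensity Φ p / ∫ z : Fin n → ℂ, formDensity Φ (p.1, z)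

/-- The density of the volume form `|u_s|² e^{-Φ}`, for `u = f(s) e_0 ∧ ⋯ ∧ e_n`: in the affine
coordinates of a frame `e` of `E` one has `u = f · dz ⊗ W_i^{n+1}` up to sign, and
`c_n dz ∧ dz̄` is `2 ^ n` times Lebesgue measure. -/
def sectionDensity (Φ : Loc n → ℝ) (f : ℂ → ℂ) (p : Loc n) : ℝ :=
  ‖f p.1‖ ^ 2 * (2 ^ n * Real.exp (-Φ p))

/-- The `L²`-norm `‖u_s‖² = ∫_{X_s} |u_s|² e^{-Φ}`. -/
def sectionNormSq (Φ : Loc n → ℝ) (f : ℂ → ℂ) (s : ℂ) : ℝ :=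
  ∫ z : Fin n → ℂ, sectionDensity Φ f (s, z)

/-- The density of the canonical probability measure `μ`; it does not depend on the section `u`,
so the frame section `e_0 ∧ ⋯ ∧ e_n` is used. -/
def muDensity (Φ : Loc n → ℝ) (p : Loc n) : ℝ :=
  sectionDensity Φ 1 p / sectionNormSq Φ 1 p.1

/-- `∂_s ∂_s̄ log F`. -/
def ddbarLog (F : ℂ → ℝ) (s : ℂ) : ℂ := levi (fun σ => Real.log (F σ)) s 1 1

/-- The curvature `R = - ∂_s ∂_s̄ log G` of a hermitian metric on a holomorphic line bundle over the
base, `G(s) = G(u_s, u_s)` being the squared norm of a holomorphic frame `u`. -/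
def lineCurvature (G : ℂ → ℝ) (s : ℂ) : ℂ := -ddbarLog G s

/-! ### The bundle `𝒪_E(k)` on `ℙ(E^*)` and its hermitian metrics -/

section Bundle

variable {S : Type*} [TopologicalSpace S] [ChartedSpace ℂ S]
  {E : S → Type*} [TopologicalSpace (Bundle.TotalSpace (Fin (n + 1) → ℂ) E)]
  [∀ s, AddCommGroup (E s)] [∀ s, Module ℂ (E s)] [∀ s, TopologicalSpace (E s)]
  [FiberBundle (Fin (n + 1) → ℂ) E] [VectorBundle ℂ (Fin (n + 1) → ℂ) E]

variable (n E) in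
/-- A holomorphic coordinate on an open subset of `S` with a local frame of `E`
(a trivialization in the atlas of `E`). -/
structure FrameChart where
  coord : OpenPartialHomeomorph S ℂ
  coord_mem : coord ∈ IsManifold.maximalAtlas 𝓘(ℂ) ω S
  triv : Bundle.Trivialization (Fin (n + 1) → ℂ)
    (Bundle.TotalSpace.proj : Bundle.TotalSpace (Fin (n + 1) → ℂ) E → S)
  triv_mem : MemTrivializationAtlas triv

/-- The coordinate domain over which both the coordinate and the frame are defined. -/
def FrameChart.domain (C : FrameChart n E) : Set ℂ :=
  {s | s ∈ C.coord.target ∧ C.coord.symm s ∈ C.triv.baseSet}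

/-- The covector `∑ W_i e_i^* ∈ E_s^*` with homogeneous coordinates `W`, for the frame `(e_i)`. -/
def FrameChart.coframe (C : FrameChart n E) (s : S) (W : Fin (n + 1) → ℂ) :
    Module.Dual ℂ (E s) :=
  haveI := C.triv_mem
  (∑ i, W i • (LinearMap.proj i : (Fin (n + 1) → ℂ) →ₗ[ℂ] ℂ)) ∘ₗ C.triv.linearMapAt ℂ s

/-- A function on `E^*` in homogeneous coordinates `(s, W)`. -/
def FrameChart.pull (C : FrameChart n E) (w : ∀ s, Module.Dual ℂ (E s) → ℝ)
    (q : ℂ × (Fin (n + 1) → ℂ)) : ℝ :=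
  w (C.coord.symm q.1) (C.coframe (C.coord.symm q.1) q.2)

variable (n E) in
/-- A smooth hermitian metric on `𝒪_E(k)`. A point `ℓ ≠ 0` of `E_s^*` spans the fiber of the
tautological bundle `𝒪_E(-1)` at `[ℓ] ∈ ℙ(E_s^*)`, and a metric on `𝒪_E(k)` is given by the
squared norm `|ℓ^{⊗ k}|² = exp (weight s ℓ)` of the dual metric on `𝒪_E(-k)`; the squared norm of a
local section `σ` of `𝒪_E(k)`, a `k`-homogeneous function, is `|σ(ℓ)|² exp (- weight s ℓ)`.
The values at `ℓ = 0` play no role. -/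
structure MetricO (k : ℕ) where
  weight : ∀ s, Module.Dual ℂ (E s) → ℝ
  weight_smul : ∀ (s : S) (a : ℂ) (l : Module.Dual ℂ (E s)), a ≠ 0 → l ≠ 0 →
    weight s (a • l) = weight s l + k * Real.log (‖a‖ ^ 2)
  smooth : ∀ C : FrameChart n E,
    ContDiffOn ℝ ∞ (C.pull weight) (C.domain ×ˢ {0}ᶜ)

/-- The local weight in the affine coordinates `z` given by `W_i = 1`: the function `Φ(s, z)`
such that `e^{-Φ}` is the squared norm of the local section `W_i^k` of `𝒪_E(k)`. -/
def MetricO.loc {k : ℕ} (h : MetricO n E k) (C : FrameChart n E) (i : Fin (n + 1))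
    (p : Loc n) : ℝ :=
  C.pull h.weight (p.1, i.insertNth 1 p.2)

/-- Positivity of the curvature form along the fibers. -/
def MetricO.FiberPos {k : ℕ} (h : MetricO n E k) : Prop :=
  ∀ (C : FrameChart n E) (i : Fin (n + 1)) (p : Loc n), p.1 ∈ C.domain →
    (fiberMetric (h.loc C i) p).PosDef

/-- The metric on `𝒪_E(1)` whose `r`-th power is the given metric on `𝒪_E(r)`, `r = n + 1`. -/
def MetricO.root (h : MetricO n E (n + 1)) : MetricO n E 1 where
  weight s l := h.weight s l / (n + 1)
  weight_smul s a l ha hl := by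
    have hn : (n : ℝ) + 1 ≠ 0 := by positivity
    rw [h.weight_smul s a l ha hl]
    push_cast
    field_simp
  smooth C := (h.smooth C).div_const _

/-- A smooth solution, on the time interval `J`, of the relative Kähler-Ricci flow
`∂φ_t/∂t = log (MA(φ_t) / μ_{φ_t})` on `𝒪_E(r)`, `r = n + 1`, through metrics which are positive
along the fibers. -/
structure IsFlow (J : Set ℝ) (φ : ℝ → MetricO n E (n + 1)) : Prop where
  smooth : ∀ C : FrameChart n E,
    ContDiffOn ℝ ∞ (fun q : ℝ × ℂ × (Fin (n + 1) → ℂ) => C.pull (φ q.1).weight q.2)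
      (J ×ˢ C.domain ×ˢ {0}ᶜ)
  pos : ∀ t ∈ J, (φ t).FiberPos
  flow : ∀ t ∈ J, ∀ (C : FrameChart n E) (i : Fin (n + 1)) (p : Loc n), p.1 ∈ C.domain →
    HasDerivWithinAt (fun τ => (φ τ).loc C i p)
      (Real.log (maDensity ((φ t).loc C i) p / muDensity ((φ t).loc C i) p)) J t

/-- Convergence `φ_t → φ_∞` in `C^∞(X_s)` on every fiber `X_s`, as `t → ∞`: in all affine charts of
the fiber, all derivatives along the fiber converge locally uniformly. -/
def ConvergesOnFibers (φ : ℝ → MetricO n E (n + 1)) (φlim : MetricO n E (n + 1)) : Prop :=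
  ∀ (C : FrameChart n E) (i : Fin (n + 1)), ∀ s ∈ C.domain, ∀ m : ℕ,
    TendstoLocallyUniformly
      (fun t z => iteratedFDeriv ℝ m (fun z' : Fin n → ℂ => (φ t).loc C i (s, z')) z)
      (iteratedFDeriv ℝ m (fun z' : Fin n → ℂ => φlim.loc C i (s, z'))) atTop

end Bundle

end RelKRF

end

/-!
# Geodesic curvature along the relative Kähler-Ricci flow

Write `Φ` for the local weight of `φ_t`, `g` for its fiber metric, `□` for the Laplacian of `g` and
`v` for the horizontal lift of `∂_s`. The theorem rests on three facts.

*First variation.* For each vector `(1, a)`, the value of the Levi form of `Φ` exceeds `c(φ)` by an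
expression quadratic in the distance of `(1, a)` from `v` (`geodesicCurvature_eq`). The variation
of `v` therefore does not contribute to first order, and `∂c/∂t` is the Levi form of `∂Φ/∂t` at
`(v, v̄)` (`hasDerivWithinAt_geodesicCurvature`).

*The right hand side of the flow.* Up to a constant, the logarithm of `MA(φ) / μ_φ` is
`log det g + Φ + log ‖u‖²` (`MetricO.log_density_ratio`). The Levi form at `(v, v̄)` of `Φ` is
`c(φ)`, that of `log ‖u‖²` is `∂_s ∂_s̄ log ‖u‖²`, and that of `log det g` is `-□c + |A|²`
(`levi_log_det_horizontalLift`). For the last identity, let `v₀` be the value of `v` at the point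
considered. Again `c` is the Levi form of `Φ` on the constant vector `v₀` minus a quadratic
expression in `v - v₀`, so the second derivatives of `c` involve only the first derivatives of `v`:
those of type `(0,1)` are the Kodaira-Spencer form, and those of type `(1,0)` are determined by the
derivatives of `g` in the direction `v₀`, because `∂∂̄Φ(v, ∂_β̄) = 0`.

*The constant.* It is the logarithm of the volume of the fibers, which must not depend on the base
point. In homogeneous coordinates `W` the weight is `(n + 1) log N` for a function `N` on
`ℂ^{n+1} ∖ 0` with `N(aW) = |a|² N(W)`, and the volume of the fiber is, up to a universal factor, the
integral of `χ(N) det (∂_a ∂_b̄ N)` for a bump function `χ` (`det_fullMetric`,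
`lintegral_volDensity`). The variation of this integrand under a change of `N` is the divergence of
a field with compact support away from the origin (`divergence_variationField`): the cofactors of
`∂∂̄N` are divergence free, as in the Piola identity, and Euler's relations for the homogeneity of
`N` take care of `χ`. Hence the volume is the same for all metrics (`exists_volume`).

For the limit, convergence of `φ_t` forces the right hand side of the flow equation, whose
exponential converges too, to have limit `0` (`IsFlow.limit_stationary`). So `det g · e^Φ · ‖u‖²` is
constant; this is the isometry statement, it upgrades the semipositivity of the limit of the fiber
metrics to positivity, and, by the second fact, its Levi form at `(v, v̄)` is the equation for `c`.
-/

noncomputable section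

namespace RelKRF

/-! ### Wirtinger calculus -/

section Smoothness

variable {V : Type*} [NormedAddCommGroup V] [NormedSpace ℝ V] {x : V} {U : Set V}

theorem contDiffOn_ofReal {Φ : V → ℝ} {n : WithTop ℕ∞} (h : ContDiffOn ℝ n Φ U) :
    ContDiffOn ℝ n (fun y => (Φ y : ℂ)) U :=
  Complex.ofRealCLM.contDiff.comp_contDiffOn h

theorem contDiffOn_star {n : WithTop ℕ∞} {f : V → ℂ} (h : ContDiffOn ℝ n f U) :
    ContDiffOn ℝ n (fun y => star (f y)) U :=
  Complex.conjCLE.contDiff.comp_contDiffOn h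

theorem _root_.ContDiffOn.differentiableAt_of_isOpen {F : Type*} [NormedAddCommGroup F]
    [NormedSpace ℝ F] {f : V → F} (h : ContDiffOn ℝ ∞ f U) (hU : IsOpen U) (hx : x ∈ U) :
    DifferentiableAt ℝ f x :=
  (h.contDiffAt (hU.mem_nhds hx)).differentiableAt (by norm_num)

theorem fderiv_fderiv_comm {f : V → ℂ} (hU : IsOpen U) (hf : ContDiffOn ℝ ∞ f U)
    (hx : x ∈ U) (v w : V) :
    fderiv ℝ (fun y => fderiv ℝ f y v) x w = fderiv ℝ (fun y => fderiv ℝ f y w) x v := by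
  have h : ContDiffOn ℝ ∞ (fderiv ℝ f) U := hf.fderiv_of_isOpen hU (by norm_num)
  have hd : DifferentiableAt ℝ (fderiv ℝ f) x :=
    (h.contDiffAt (hU.mem_nhds hx)).differentiableAt (by norm_num)
  have hs := ((hf.contDiffAt (hU.mem_nhds hx)).isSymmSndFDerivAt
    (by rw [minSmoothness_of_isRCLikeNormedField]; exact WithTop.coe_le_coe.2 le_top)).eq v w
  have e : ∀ v w : V, fderiv ℝ (fun y => fderiv ℝ f y v) x w = fderiv ℝ (fderiv ℝ f) x w v := by
    intro v w
    rw [fderiv_clm_apply hd (differentiableAt_const v)]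
    simp
  rw [e, e, hs]

end Smoothness

section Calculus

variable {V : Type*} [NormedAddCommGroup V] [NormedSpace ℝ V] [Module ℂ V]

/-- The complexified constant vector field `(ξ + ε • Iξ) / 2`, acting on functions; `ε = -I` gives
`∂_ξ` and `ε = I` gives `∂_ξ̄`, so that both are treated at once. -/
def wirt (ε : ℂ) (ξ : V) (f : V → ℂ) (x : V) : ℂ :=
  (fderiv ℝ f x ξ + ε * fderiv ℝ f x (Complex.I • ξ)) / 2

theorem dW_eq_wirt (ξ : V) : dW ξ = wirt (-Complex.I) ξ := by
  funext f x; simp only [dW, wirt]; ring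

theorem dWbar_eq_wirt (ξ : V) : dWbar ξ = wirt Complex.I ξ := by
  funext f x; simp only [dWbar, wirt]

variable {ε : ℂ} {ξ : V} {f g : V → ℂ} {x : V}

theorem wirt_congr (h : f =ᶠ[𝓝 x] g) : wirt ε ξ f x = wirt ε ξ g x := by
  simp only [wirt, h.fderiv_eq]

theorem wirt_congr_on {U : Set V} (hU : IsOpen U) (hx : x ∈ U) (h : ∀ y ∈ U, f y = g y) :
    wirt ε ξ f x = wirt ε ξ g x :=
  wirt_congr (Filter.eventuallyEq_of_mem (hU.mem_nhds hx) h)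

theorem wirt_const (c : ℂ) : wirt ε ξ (fun _ => c) x = 0 := by
  simp [wirt]

theorem wirt_add (hf : DifferentiableAt ℝ f x) (hg : DifferentiableAt ℝ g x) :
    wirt ε ξ (fun y => f y + g y) x = wirt ε ξ f x + wirt ε ξ g x := by
  simp only [wirt]
  rw [fderiv_fun_add hf hg]
  simp only [_root_.add_apply]
  ring

theorem wirt_sub (hf : DifferentiableAt ℝ f x) (hg : DifferentiableAt ℝ g x) :
    wirt ε ξ (fun y => f y - g y) x = wirt ε ξ f x - wirt ε ξ g x := by
  simp only [wirt]
  rw [fderiv_fun_sub hf hg]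
  simp only [_root_.sub_apply]
  ring

theorem wirt_neg : wirt ε ξ (fun y => -f y) x = -wirt ε ξ f x := by
  simp only [wirt]
  rw [fderiv_fun_neg]
  simp only [_root_.neg_apply]
  ring

theorem wirt_mul (hf : DifferentiableAt ℝ f x) (hg : DifferentiableAt ℝ g x) :
    wirt ε ξ (fun y => f y * g y) x = wirt ε ξ f x * g x + f x * wirt ε ξ g x := by
  simp only [wirt]
  rw [fderiv_fun_mul hf hg]
  simp only [_root_.add_apply, FunLike.coe_smul, Pi.smul_apply, smul_eq_mul]
  ring

theorem wirt_const_mul (c : ℂ) (hf : DifferentiableAt ℝ f x) :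
    wirt ε ξ (fun y => c * f y) x = c * wirt ε ξ f x := by
  rw [wirt_mul (differentiableAt_const c) hf, wirt_const]; ring

theorem wirt_sum {ι : Type*} {s : Finset ι} {F : ι → V → ℂ}
    (hF : ∀ i ∈ s, DifferentiableAt ℝ (F i) x) :
    wirt ε ξ (fun y => ∑ i ∈ s, F i y) x = ∑ i ∈ s, wirt ε ξ (F i) x := by
  simp only [wirt]
  rw [fderiv_fun_sum hF]
  simp only [_root_.sum_apply]
  rw [Finset.mul_sum, ← Finset.sum_add_distrib, Finset.sum_div]

theorem wirt_star : wirt ε ξ (fun y => star (f y)) x = star (wirt (star ε) ξ f x) := by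
  have h : fderiv ℝ (fun y => star (f y)) x
      = (Complex.conjCLE : ℂ →L[ℝ] ℂ).comp (fderiv ℝ f x) :=
    Complex.conjCLE.comp_fderiv (f := f)
  simp only [wirt]
  rw [h]
  simp

theorem wirt_comp_hasDerivAt {F : ℂ → ℂ} {F' : ℂ} (hF : HasDerivAt F F' (f x))
    (hf : DifferentiableAt ℝ f x) :
    wirt ε ξ (fun y => F (f y)) x = F' * wirt ε ξ f x := by
  have h : HasFDerivAt (fun y => F (f y)) (F' • fderiv ℝ f x) x := by
    have := HasFDerivAt.comp x (hF.hasFDerivAt.restrictScalars ℝ) hf.hasFDerivAt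
    refine this.congr_fderiv ?_
    ext v
    simp [mul_comm]
  simp only [wirt, h.fderiv]
  simp only [FunLike.coe_smul, Pi.smul_apply, smul_eq_mul]
  ring

theorem wirt_contDiffOn {U : Set V} (hU : IsOpen U) (hf : ContDiffOn ℝ ∞ f U) :
    ContDiffOn ℝ ∞ (wirt ε ξ f) U := by
  have h : ContDiffOn ℝ ∞ (fderiv ℝ f) U := hf.fderiv_of_isOpen hU (by norm_num)
  have h1 : ∀ v : V, ContDiffOn ℝ ∞ (fun y => fderiv ℝ f y v) U := fun v =>
    h.clm_apply contDiffOn_const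
  exact ((h1 ξ).add (contDiffOn_const.mul (h1 _))).div_const 2

theorem wirt_comm {U : Set V} (hU : IsOpen U) (hf : ContDiffOn ℝ ∞ f U) (hx : x ∈ U)
    (ε ε' : ℂ) (ξ ξ' : V) :
    wirt ε ξ (wirt ε' ξ' f) x = wirt ε' ξ' (wirt ε ξ f) x := by
  have h : ContDiffOn ℝ ∞ (fderiv ℝ f) U := hf.fderiv_of_isOpen hU (by norm_num)
  have h1 : ∀ v : V, DifferentiableAt ℝ (fun y => fderiv ℝ f y v) x := fun v =>
    ((h.clm_apply contDiffOn_const).contDiffAt (hU.mem_nhds hx)).differentiableAt (by norm_num)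
  have e : ∀ (ε' : ℂ) (ξ' v : V), fderiv ℝ (wirt ε' ξ' f) x v
      = (fderiv ℝ (fun y => fderiv ℝ f y ξ') x v
        + ε' * fderiv ℝ (fun y => fderiv ℝ f y (Complex.I • ξ')) x v) / 2 := by
    intro ε' ξ' v
    have : HasFDerivAt (wirt ε' ξ' f) ((2:ℂ)⁻¹ • (fderiv ℝ (fun y => fderiv ℝ f y ξ') x
        + ε' • fderiv ℝ (fun y => fderiv ℝ f y (Complex.I • ξ')) x)) x := by
      have := (((h1 ξ').hasFDerivAt).add (((h1 (Complex.I • ξ')).hasFDerivAt).const_mul ε')).const_mul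
        ((2:ℂ)⁻¹)
      refine this.congr_of_eventuallyEq (Eventually.of_forall fun y => ?_)
      simp only [wirt, Pi.add_apply]; ring
    rw [this.fderiv]
    simp; ring
  have c := fun v w => fderiv_fderiv_comm hU hf hx v w
  rw [wirt, wirt, e, e, e, e, c ξ' ξ, c (Complex.I • ξ') ξ, c ξ' (Complex.I • ξ),
    c (Complex.I • ξ') (Complex.I • ξ)]
  ring

theorem wirt_add_dir (ε : ℂ) (ξ η : V) : wirt ε (ξ + η) f x = wirt ε ξ f x + wirt ε η f x := by
  simp only [wirt, smul_add, map_add]; ring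

theorem wirt_sum_dir {ι : Type*} (s : Finset ι) (ε : ℂ) (ξ : ι → V) :
    wirt ε (∑ i ∈ s, ξ i) f x = ∑ i ∈ s, wirt ε (ξ i) f x := by
  simp only [wirt, Finset.smul_sum, map_sum]
  rw [Finset.mul_sum, ← Finset.sum_add_distrib, Finset.sum_div]

end Calculus

theorem I_smul_I_smul {V : Type*} [AddCommGroup V] [Module ℂ V] (ξ : V) :
    Complex.I • (Complex.I • ξ) = -ξ := by
  rw [smul_smul, Complex.I_mul_I, neg_one_smul]

section Direction

variable {V : Type*} [NormedAddCommGroup V] [NormedSpace ℝ V] [Module ℂ V] [IsScalarTower ℝ ℂ V]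
  {f : V → ℂ} {x : V}

theorem complex_smul_eq (a : ℂ) (ξ : V) : a • ξ = a.re • ξ + a.im • (Complex.I • ξ) := by
  conv_lhs => rw [← Complex.re_add_im a]
  rw [add_smul, mul_smul, ← IsScalarTower.algebraMap_smul ℂ a.re ξ,
    ← IsScalarTower.algebraMap_smul ℂ a.im (Complex.I • ξ)]
  rfl

theorem dW_smul (a : ℂ) (ξ : V) : dW (a • ξ) f x = a * dW ξ f x := by
  have h : Complex.I • (a • ξ) = a.re • (Complex.I • ξ) - a.im • ξ := by
    rw [smul_comm, complex_smul_eq a (Complex.I • ξ), I_smul_I_smul, smul_neg, sub_eq_add_neg]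
  have e : a = a.re + a.im * Complex.I := (Complex.re_add_im a).symm
  simp only [dW]
  rw [h, complex_smul_eq a ξ]
  simp only [map_add, map_sub, map_smul, Complex.real_smul]
  conv_rhs => rw [e]
  linear_combination ((a.im:ℂ) * fderiv ℝ f x (Complex.I • ξ) / 2) * Complex.I_mul_I

theorem dWbar_smul (a : ℂ) (ξ : V) : dWbar (a • ξ) f x = star a * dWbar ξ f x := by
  have h : Complex.I • (a • ξ) = a.re • (Complex.I • ξ) - a.im • ξ := by
    rw [smul_comm, complex_smul_eq a (Complex.I • ξ), I_smul_I_smul, smul_neg, sub_eq_add_neg]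
  have e : star a = a.re - a.im * Complex.I := by
    apply Complex.ext <;> simp
  simp only [dWbar]
  rw [h, complex_smul_eq a ξ, e]
  simp only [map_add, map_sub, map_smul, Complex.real_smul]
  linear_combination ((a.im:ℂ) * fderiv ℝ f x (Complex.I • ξ) / 2) * Complex.I_mul_I

end Direction

/-! ### The Levi form -/

section Levi

variable {V : Type*} [NormedAddCommGroup V] [NormedSpace ℝ V] [Module ℂ V]
  {Φ Ψ : V → ℝ} {x : V} {U : Set V}

theorem levi_eq_wirt (Φ : V → ℝ) (x ξ η : V) :
    levi Φ x ξ η = wirt (-Complex.I) ξ (wirt Complex.I η (fun y => (Φ y : ℂ))) x := by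
  rw [levi, dW_eq_wirt, dWbar_eq_wirt]

theorem levi_contDiffOn (hU : IsOpen U) (hΦ : ContDiffOn ℝ ∞ Φ U) (ξ η : V) :
    ContDiffOn ℝ ∞ (fun y => levi Φ y ξ η) U := by
  simp only [levi_eq_wirt]
  exact wirt_contDiffOn hU (wirt_contDiffOn hU (contDiffOn_ofReal hΦ))

theorem levi_congr (hU : IsOpen U) (hx : x ∈ U) (h : ∀ y ∈ U, Φ y = Ψ y) (ξ η : V) :
    levi Φ x ξ η = levi Ψ x ξ η := by
  rw [levi_eq_wirt, levi_eq_wirt]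
  refine wirt_congr_on hU hx fun y hy => wirt_congr_on hU hy fun z hz => ?_
  rw [h z hz]

theorem levi_add (hU : IsOpen U) (hx : x ∈ U) (hΦ : ContDiffOn ℝ ∞ Φ U) (hΨ : ContDiffOn ℝ ∞ Ψ U)
    (ξ η : V) :
    levi (fun y => Φ y + Ψ y) x ξ η = levi Φ x ξ η + levi Ψ x ξ η := by
  have h1 := contDiffOn_ofReal hΦ
  have h2 := contDiffOn_ofReal hΨ
  simp only [levi_eq_wirt, Complex.ofReal_add]
  rw [wirt_congr_on hU hx fun y hy => wirt_add (h1.differentiableAt_of_isOpen hU hy)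
    (h2.differentiableAt_of_isOpen hU hy)]
  exact wirt_add ((wirt_contDiffOn hU h1).differentiableAt_of_isOpen hU hx)
    ((wirt_contDiffOn hU h2).differentiableAt_of_isOpen hU hx)

theorem levi_const (c : ℝ) (ξ η : V) : levi (fun _ => c) x ξ η = 0 := by
  have h : wirt Complex.I η (fun _ : V => (c : ℂ)) = fun _ => 0 := by
    funext y; exact wirt_const _
  rw [levi_eq_wirt, h, wirt_const]

theorem levi_const_mul (hU : IsOpen U) (hx : x ∈ U) (hΦ : ContDiffOn ℝ ∞ Φ U) (c : ℝ) (ξ η : V) :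
    levi (fun y => c * Φ y) x ξ η = c * levi Φ x ξ η := by
  have h1 := contDiffOn_ofReal hΦ
  simp only [levi_eq_wirt, Complex.ofReal_mul]
  rw [wirt_congr_on hU hx fun y hy => wirt_const_mul (c : ℂ) (h1.differentiableAt_of_isOpen hU hy)]
  exact wirt_const_mul _ ((wirt_contDiffOn hU h1).differentiableAt_of_isOpen hU hx)

/-- The Levi form of a real function is hermitian. -/
theorem levi_star (hU : IsOpen U) (hx : x ∈ U) (hΦ : ContDiffOn ℝ ∞ Φ U) (ξ η : V) :
    star (levi Φ x ξ η) = levi Φ x η ξ := by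
  have h1 := contDiffOn_ofReal hΦ
  have hI : star (-Complex.I) = Complex.I := by simp
  have hI' : star Complex.I = -Complex.I := by simp
  have e : ∀ (ε : ℂ) (ζ : V) (f : V → ℂ), star (wirt ε ζ f x)
      = wirt (star ε) ζ (fun y => star (f y)) x := by
    intro ε ζ f
    rw [wirt_star, star_star]
  have e' : (fun y => star (wirt Complex.I η (fun y => (Φ y : ℂ)) y))
      = wirt (-Complex.I) η (fun y => (Φ y : ℂ)) := by
    funext y
    rw [← hI', ← star_star (wirt (star Complex.I) η _ y), ← wirt_star]
    congr 2
    funext z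
    exact (Complex.conj_ofReal _).symm
  rw [levi_eq_wirt, levi_eq_wirt, e, hI, e', wirt_comm hU h1 hx]

theorem levi_smul_left [IsScalarTower ℝ ℂ V] (a : ℂ) (ξ η : V) :
    levi Φ x (a • ξ) η = a * levi Φ x ξ η :=
  dW_smul a ξ

theorem levi_add_left (ξ ξ' η : V) : levi Φ x (ξ + ξ') η = levi Φ x ξ η + levi Φ x ξ' η := by
  simp only [levi_eq_wirt, wirt_add_dir]

theorem levi_sum_left {ι : Type*} (s : Finset ι) (ξ : ι → V) (η : V) :
    levi Φ x (∑ i ∈ s, ξ i) η = ∑ i ∈ s, levi Φ x (ξ i) η := by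
  simp only [levi_eq_wirt, wirt_sum_dir]

theorem levi_smul_right [IsScalarTower ℝ ℂ V] (hU : IsOpen U) (hx : x ∈ U)
    (hΦ : ContDiffOn ℝ ∞ Φ U) (a : ℂ) (ξ η : V) :
    levi Φ x ξ (a • η) = star a * levi Φ x ξ η := by
  rw [← levi_star hU hx hΦ, levi_smul_left, star_mul', levi_star hU hx hΦ]

theorem levi_add_right (hU : IsOpen U) (hx : x ∈ U) (hΦ : ContDiffOn ℝ ∞ Φ U) (ξ η η' : V) :
    levi Φ x ξ (η + η') = levi Φ x ξ η + levi Φ x ξ η' := by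
  rw [← levi_star hU hx hΦ, levi_add_left, star_add, levi_star hU hx hΦ, levi_star hU hx hΦ]

theorem levi_sum_right (hU : IsOpen U) (hx : x ∈ U) (hΦ : ContDiffOn ℝ ∞ Φ U) {ι : Type*}
    (s : Finset ι) (ξ : V) (η : ι → V) :
    levi Φ x ξ (∑ i ∈ s, η i) = ∑ i ∈ s, levi Φ x ξ (η i) := by
  rw [← levi_star hU hx hΦ, levi_sum_left, star_sum]
  exact Finset.sum_congr rfl fun i _ => levi_star hU hx hΦ _ _

end Levi

/-! ### Derivatives of determinants and inverse matrices -/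

section MatrixMul

variable {V : Type*} [NormedAddCommGroup V] [NormedSpace ℝ V] [Module ℂ V]

theorem wirt_matrix_mul {ι κ : Type*} [Fintype κ] {A : V → Matrix ι κ ℂ} {B : V → Matrix κ ι ℂ}
    {ε : ℂ} {ξ x : V}
    (hA : ∀ i j, DifferentiableAt ℝ (fun y => A y i j) x)
    (hB : ∀ i j, DifferentiableAt ℝ (fun y => B y i j) x) (i j : ι) :
    wirt ε ξ (fun y => (A y * B y) i j) x
      = ((Matrix.of fun i j => wirt ε ξ (fun y => A y i j) x) * B x
        + A x * Matrix.of fun i j => wirt ε ξ (fun y => B y i j) x) i j := by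
  simp only [Matrix.mul_apply, Matrix.add_apply, Matrix.of_apply]
  rw [wirt_sum fun k _ => (hA i k).fun_mul (hB k j), ← Finset.sum_add_distrib]
  exact Finset.sum_congr rfl fun k _ => wirt_mul (hA i k) (hB k j)

end MatrixMul

section MatrixCalculus

variable {V : Type*} [NormedAddCommGroup V] [NormedSpace ℝ V]
  {ι : Type*} [Fintype ι] [DecidableEq ι] {ε : ℂ} {ξ : V} {x : V} {U : Set V}
  {G : V → Matrix ι ι ℂ}

theorem differentiableAt_det (hG : ∀ i j, DifferentiableAt ℝ (fun y => G y i j) x) :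
    DifferentiableAt ℝ (fun y => (G y).det) x := by
  simp only [Matrix.det_apply']
  refine DifferentiableAt.fun_sum fun σ _ => DifferentiableAt.const_mul ?_ _
  exact (HasFDerivAt.finsetProd (g := fun i y => G y (σ i) i)
    fun i _ => (hG _ _).hasFDerivAt).differentiableAt

theorem contDiffOn_det {n : WithTop ℕ∞} (hG : ∀ i j, ContDiffOn ℝ n (fun y => G y i j) U) :
    ContDiffOn ℝ n (fun y => (G y).det) U := by
  simp only [Matrix.det_apply']
  exact ContDiffOn.sum fun σ _ => contDiffOn_const.mul (contDiffOn_prod fun i _ => hG _ _)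

theorem contDiffOn_adjugate {n : WithTop ℕ∞} (hG : ∀ i j, ContDiffOn ℝ n (fun y => G y i j) U)
    (i j : ι) : ContDiffOn ℝ n (fun y => (G y).adjugate i j) U := by
  simp only [Matrix.adjugate_apply]
  refine contDiffOn_det fun k l => ?_
  simp only [Matrix.updateRow_apply]
  split_ifs
  · exact contDiffOn_const
  · exact hG _ _

theorem contDiffOn_inv {n : WithTop ℕ∞} (hG : ∀ i j, ContDiffOn ℝ n (fun y => G y i j) U)
    (h0 : ∀ y ∈ U, (G y).det ≠ 0) (i j : ι) : ContDiffOn ℝ n (fun y => (G y)⁻¹ i j) U := by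
  simp only [Matrix.inv_def, Ring.inverse_eq_inv', Matrix.smul_apply, smul_eq_mul]
  exact ((contDiffOn_det hG).inv h0).mul (contDiffOn_adjugate hG i j)

/-- Jacobi's formula. -/
theorem fderiv_det (hG : ∀ i j, DifferentiableAt ℝ (fun y => G y i j) x) (v : V) :
    fderiv ℝ (fun y => (G y).det) x v
      = ∑ i, ∑ j, (G x).adjugate i j * fderiv ℝ (fun y => G y j i) x v := by
  have key : ∀ i, ∑ j, (G x).adjugate i j * fderiv ℝ (fun y => G y j i) x v
      = ∑ σ : Equiv.Perm ι, ((σ.sign : ℤ) : ℂ) * (fderiv ℝ (fun y => G y (σ i) i) x v *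
        ∏ j ∈ Finset.univ.erase i, G x (σ j) j) := by
    intro i
    have h1 := congrFun (Matrix.cramer_eq_adjugate_mulVec (G x)
      (fun j => fderiv ℝ (fun y => G y j i) x v)) i
    rw [Matrix.cramer_apply] at h1
    simp only [Matrix.mulVec, dotProduct] at h1
    rw [← h1, Matrix.det_apply']
    refine Finset.sum_congr rfl fun σ _ => ?_
    rw [← Finset.mul_prod_erase _ _ (Finset.mem_univ i)]
    congr 2
    · simp
    · refine Finset.prod_congr rfl fun j hj => ?_
      rw [Matrix.updateCol_ne (Finset.ne_of_mem_erase hj)]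
  have hp : ∀ σ : Equiv.Perm ι, HasFDerivAt (fun y => ∏ i, G y (σ i) i)
      (∑ i, (∏ j ∈ Finset.univ.erase i, G x (σ j) j) • fderiv ℝ (fun y => G y (σ i) i) x) x :=
    fun σ => HasFDerivAt.finsetProd (g := fun i y => G y (σ i) i) fun i _ => (hG _ _).hasFDerivAt
  simp only [key, Matrix.det_apply']
  rw [(HasFDerivAt.fun_sum fun (σ : Equiv.Perm ι) _ =>
    (hp σ).const_mul ((σ.sign : ℤ) : ℂ)).fderiv, Finset.sum_comm]
  simp only [_root_.sum_apply, FunLike.coe_smul, Pi.smul_apply, smul_eq_mul]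
  refine Finset.sum_congr rfl fun σ _ => ?_
  rw [Finset.mul_sum]
  exact Finset.sum_congr rfl fun i _ => by ring

variable [Module ℂ V]

theorem wirt_det (hG : ∀ i j, DifferentiableAt ℝ (fun y => G y i j) x) :
    wirt ε ξ (fun y => (G y).det) x
      = ∑ i, ∑ j, (G x).adjugate i j * wirt ε ξ (fun y => G y j i) x := by
  simp only [wirt, fderiv_det hG, Finset.mul_sum, ← Finset.sum_add_distrib, Finset.sum_div]
  exact Finset.sum_congr rfl fun i _ => Finset.sum_congr rfl fun j _ => by ring

theorem wirt_inv (hU : IsOpen U) (hx : x ∈ U) (hG : ∀ i j, ContDiffOn ℝ ∞ (fun y => G y i j) U)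
    (h0 : ∀ y ∈ U, (G y).det ≠ 0) :
    (Matrix.of fun i j => wirt ε ξ (fun y => (G y)⁻¹ i j) x)
      = -((G x)⁻¹ * (Matrix.of fun i j => wirt ε ξ (fun y => G y i j) x) * (G x)⁻¹) := by
  have hu : IsUnit (G x).det := (h0 x hx).isUnit
  have h : (Matrix.of fun i j => wirt ε ξ (fun y => (G y)⁻¹ i j) x) * G x
      + (G x)⁻¹ * (Matrix.of fun i j => wirt ε ξ (fun y => G y i j) x) = 0 := by
    ext i j
    rw [← wirt_matrix_mul (fun i j => (contDiffOn_inv hG h0 i j).differentiableAt_of_isOpen hU hx)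
      (fun i j => (hG i j).differentiableAt_of_isOpen hU hx)]
    rw [wirt_congr_on (g := fun _ => (1 : Matrix ι ι ℂ) i j) hU hx fun y hy => by
      rw [Matrix.nonsing_inv_mul _ (h0 y hy).isUnit], wirt_const]
    rfl
  have h2 := congrArg (· * (G x)⁻¹) (eq_neg_of_add_eq_zero_left h)
  simp only [Matrix.mul_assoc, Matrix.mul_nonsing_inv _ hu, Matrix.mul_one, Matrix.neg_mul] at h2
  rw [h2, Matrix.mul_assoc]

end MatrixCalculus

/-! ### The horizontal lift and the geodesic curvature -/

section Curvature

variable {n : ℕ} {Φ : Loc n → ℝ} {U : Set (Loc n)} {p : Loc n}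

theorem horizontal_eq_sum (a : Fin n → ℂ) :
    ((1, a) : Loc n) = eBase + ∑ α, a α • eFib α := by
  have h : ∑ α, a α • (eFib α : Loc n) = (0, a) := by
    apply Prod.ext
    · simp [eFib, Prod.fst_sum]
    · rw [Prod.snd_sum]
      funext j
      simp [eFib, Finset.sum_apply, Pi.single_apply]
  rw [h, eBase, Prod.mk_add_mk, add_zero, zero_add]

theorem fiberMetric_contDiffOn (hU : IsOpen U) (hΦ : ContDiffOn ℝ ∞ Φ U) (α β : Fin n) :
    ContDiffOn ℝ ∞ (fun q => fiberMetric Φ q α β) U :=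
  levi_contDiffOn hU hΦ _ _

theorem fiberMetric_isHermitian (hU : IsOpen U) (hΦ : ContDiffOn ℝ ∞ Φ U) (hp : p ∈ U) :
    (fiberMetric Φ p).IsHermitian := by
  ext α β
  rw [Matrix.conjTranspose_apply]
  exact levi_star hU hp hΦ _ _

theorem liftCoeff_contDiffOn (hU : IsOpen U) (hΦ : ContDiffOn ℝ ∞ Φ U)
    (hdet : ∀ q ∈ U, (fiberMetric Φ q).det ≠ 0) (α : Fin n) :
    ContDiffOn ℝ ∞ (fun q => liftCoeff Φ q α) U := by
  refine ContDiffOn.neg (ContDiffOn.sum fun β _ => ContDiffOn.mul ?_ (levi_contDiffOn hU hΦ _ _))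
  exact contDiffOn_inv (fun i j => fiberMetric_contDiffOn hU hΦ i j) hdet β α

theorem sum_liftCoeff_mul (hdet : (fiberMetric Φ p).det ≠ 0) (δ : Fin n) :
    ∑ γ, liftCoeff Φ p γ * fiberMetric Φ p γ δ = -levi Φ p eBase (eFib δ) := by
  have h : liftCoeff Φ p = -Matrix.vecMul (fun β => levi Φ p eBase (eFib β)) (fiberMetric Φ p)⁻¹ := by
    funext α
    simp only [liftCoeff, Pi.neg_apply, Matrix.vecMul, dotProduct]
    rw [neg_inj]
    exact Finset.sum_congr rfl fun β _ => mul_comm _ _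
  have h2 : Matrix.vecMul (liftCoeff Φ p) (fiberMetric Φ p)
      = -fun β => levi Φ p eBase (eFib β) := by
    rw [h, Matrix.neg_vecMul, Matrix.vecMul_vecMul, Matrix.nonsing_inv_mul _ hdet.isUnit,
      Matrix.vecMul_one]
  exact congrFun h2 δ

/-- Pairing a vector `(1, a)` with a fiber direction measures how far `a` is from the horizontal
lift. -/
theorem levi_eFib_of_base_one (hdet : (fiberMetric Φ p).det ≠ 0) (a : Fin n → ℂ) (δ : Fin n) :
    levi Φ p (1, a) (eFib δ) = -∑ γ, (liftCoeff Φ p γ - a γ) * fiberMetric Φ p γ δ := by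
  simp only [sub_mul, Finset.sum_sub_distrib, sum_liftCoeff_mul hdet]
  rw [horizontal_eq_sum, levi_add_left, levi_sum_left]
  simp only [levi_smul_left]
  simp only [fiberMetric]
  ring

/-- The geodesic curvature is the Schur complement of the fiber metric in the Levi form: it is the
value on any vector `(1, a)` up to a term which is quadratic in the distance of `a` from the
horizontal lift. -/
theorem geodesicCurvature_eq (hU : IsOpen U) (hΦ : ContDiffOn ℝ ∞ Φ U) (hp : p ∈ U)
    (hdet : (fiberMetric Φ p).det ≠ 0) (a : Fin n → ℂ) :
    geodesicCurvature Φ p = levi Φ p (1, a) (1, a)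
      - ∑ γ, ∑ δ, fiberMetric Φ p γ δ * (liftCoeff Φ p γ - a γ) * star (liftCoeff Φ p δ - a δ) := by
  have hv : (horizontalLift Φ p : Loc n)
      = (1, a) + ∑ γ, (liftCoeff Φ p γ - a γ) • eFib γ := by
    rw [horizontalLift, horizontal_eq_sum, horizontal_eq_sum a]
    simp only [sub_smul, Finset.sum_sub_distrib]
    abel
  have h0 : ∀ δ, levi Φ p (horizontalLift Φ p) (eFib δ) = 0 := by
    intro δ
    rw [horizontalLift, levi_eFib_of_base_one hdet]
    simp
  have h1 : geodesicCurvature Φ p = levi Φ p (horizontalLift Φ p) (1, a) := by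
    conv_lhs => rw [geodesicCurvature]
    conv_lhs => arg 4; rw [hv]
    rw [levi_add_right hU hp hΦ, levi_sum_right hU hp hΦ]
    simp only [levi_smul_right hU hp hΦ, h0, mul_zero, Finset.sum_const_zero, add_zero]
  rw [h1, hv, levi_add_left, levi_sum_left, sub_eq_add_neg, ← Finset.sum_neg_distrib]
  congr 1
  refine Finset.sum_congr rfl fun γ _ => ?_
  rw [levi_smul_left, ← levi_star hU hp hΦ, levi_eFib_of_base_one hdet, star_neg, star_sum, mul_neg,
    Finset.mul_sum]
  congr 1
  refine Finset.sum_congr rfl fun δ _ => ?_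
  have := (fiberMetric_isHermitian hU hΦ hp).apply γ δ
  rw [star_mul', this]
  ring

theorem geodesicCurvature_contDiffOn (hU : IsOpen U) (hΦ : ContDiffOn ℝ ∞ Φ U)
    (hdet : ∀ q ∈ U, (fiberMetric Φ q).det ≠ 0) :
    ContDiffOn ℝ ∞ (geodesicCurvature Φ) U := by
  have h := fun q (hq : q ∈ U) => geodesicCurvature_eq hU hΦ hq (hdet q hq) 0
  refine ContDiffOn.congr (f := fun q => levi Φ q (1, 0) (1, 0) - ∑ γ, ∑ δ, fiberMetric Φ q γ δ *
    (liftCoeff Φ q γ - (0 : Fin n → ℂ) γ) * star (liftCoeff Φ q δ - (0 : Fin n → ℂ) δ)) ?_ h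
  refine (levi_contDiffOn hU hΦ _ _).sub (ContDiffOn.sum fun γ _ => ContDiffOn.sum fun δ _ => ?_)
  exact ((fiberMetric_contDiffOn hU hΦ γ δ).mul
    ((liftCoeff_contDiffOn hU hΦ hdet γ).sub contDiffOn_const)).mul
    (contDiffOn_star ((liftCoeff_contDiffOn hU hΦ hdet δ).sub contDiffOn_const))

end Curvature

/-! ### The horizontal Hessian of the logarithm of the fiber volume -/

section LogDet

variable {V : Type*} [NormedAddCommGroup V] [NormedSpace ℝ V] [Module ℂ V] {U : Set V} {p : V}

/-- Only the products of first derivatives survive in the second derivative of a product with two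
vanishing factors. -/
theorem wirt_wirt_mul_of_eq_zero {f h k : V → ℂ} (hU : IsOpen U) (hp : p ∈ U)
    (hf : ContDiffOn ℝ ∞ f U) (hh : ContDiffOn ℝ ∞ h U) (hk : ContDiffOn ℝ ∞ k U)
    (h0 : h p = 0) (k0 : k p = 0) (ε ε' : ℂ) (ξ ξ' : V) :
    wirt ε ξ (wirt ε' ξ' (fun q => f q * h q * k q)) p
      = f p * (wirt ε' ξ' h p * wirt ε ξ k p + wirt ε ξ h p * wirt ε' ξ' k p) := by
  have df := fun q (hq : q ∈ U) => hf.differentiableAt_of_isOpen hU hq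
  have dh := fun q (hq : q ∈ U) => hh.differentiableAt_of_isOpen hU hq
  have dk := fun q (hq : q ∈ U) => hk.differentiableAt_of_isOpen hU hq
  have df' := (wirt_contDiffOn (ε := ε') (ξ := ξ') hU hf).differentiableAt_of_isOpen hU hp
  have dh' := (wirt_contDiffOn (ε := ε') (ξ := ξ') hU hh).differentiableAt_of_isOpen hU hp
  have dk' := (wirt_contDiffOn (ε := ε') (ξ := ξ') hU hk).differentiableAt_of_isOpen hU hp
  rw [wirt_congr_on (g := fun q => (wirt ε' ξ' f q * h q + f q * wirt ε' ξ' h q) * k q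
    + f q * h q * wirt ε' ξ' k q) hU hp fun q hq => by
      rw [wirt_mul ((df q hq).fun_mul (dh q hq)) (dk q hq), wirt_mul (df q hq) (dh q hq)]]
  have d1 := df p hp
  have d2 := dh p hp
  have d3 := dk p hp
  rw [wirt_add (((df'.fun_mul d2).fun_add (d1.fun_mul dh')).fun_mul d3) ((d1.fun_mul d2).fun_mul dk'),
    wirt_mul ((df'.fun_mul d2).fun_add (d1.fun_mul dh')) d3, wirt_mul (d1.fun_mul d2) dk',
    wirt_mul d1 d2, h0, k0]
  ring

variable {ι : Type*} [Fintype ι] [DecidableEq ι] {G : V → Matrix ι ι ℂ}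

/-- The second derivatives of `log det G`. -/
theorem wirt_wirt_log_det (hU : IsOpen U) (hp : p ∈ U)
    (hG : ∀ i j, ContDiffOn ℝ ∞ (fun y => G y i j) U)
    (hpos : ∀ y ∈ U, 0 < (G y).det) (ε ε' : ℂ) (ξ ξ' : V) :
    wirt ε ξ (wirt ε' ξ' (fun y => ((Real.log (G y).det.re : ℝ) : ℂ))) p
      = ∑ i, ∑ j, (G p)⁻¹ i j * wirt ε ξ (wirt ε' ξ' (fun y => G y j i)) p
        - ((G p)⁻¹ * (Matrix.of fun i j => wirt ε ξ (fun y => G y i j) p) * (G p)⁻¹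
          * Matrix.of fun i j => wirt ε' ξ' (fun y => G y i j) p).trace := by
  have h0 : ∀ y ∈ U, (G y).det ≠ 0 := fun y hy => (hpos y hy).ne'
  have dG := fun q (hq : q ∈ U) i j => (hG i j).differentiableAt_of_isOpen hU hq
  have e1 : ∀ q ∈ U, wirt ε' ξ' (fun y => ((Real.log (G y).det.re : ℝ) : ℂ)) q
      = ∑ i, ∑ j, (G q)⁻¹ i j * wirt ε' ξ' (fun y => G y j i) q := by
    intro q hq
    have hre : ∀ y ∈ U, 0 < (G y).det.re ∧ ((G y).det.re : ℂ) = (G y).det := by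
      intro y hy
      have := Complex.pos_iff.1 (hpos y hy)
      exact ⟨this.1, Complex.ext rfl (by simp [← this.2])⟩
    rw [wirt_congr_on (g := fun y => Complex.log (G y).det) hU hq fun y hy => by
      rw [Complex.ofReal_log (hre y hy).1.le, (hre y hy).2]]
    rw [wirt_comp_hasDerivAt (f := fun y => (G y).det) (Complex.hasDerivAt_log (Or.inl (hre q hq).1))
      (differentiableAt_det (dG q hq)), wirt_det (dG q hq), Finset.mul_sum]
    refine Finset.sum_congr rfl fun i _ => ?_
    rw [Finset.mul_sum]
    refine Finset.sum_congr rfl fun j _ => ?_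
    rw [Matrix.inv_def, Ring.inverse_eq_inv', Matrix.smul_apply, smul_eq_mul, mul_assoc]
  have dI := fun i j => (contDiffOn_inv hG h0 i j).differentiableAt_of_isOpen hU hp
  have dW' := fun i j =>
    (wirt_contDiffOn (ε := ε') (ξ := ξ') hU (hG i j)).differentiableAt_of_isOpen hU hp
  rw [wirt_congr_on hU hp e1, wirt_sum fun i _ =>
    DifferentiableAt.fun_sum fun j _ => (dI i j).fun_mul (dW' j i)]
  have hinv := wirt_inv (ε := ε) (ξ := ξ) hU hp hG h0
  have e2 : ∀ i j, wirt ε ξ (fun y => (G y)⁻¹ i j) p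
      = -((G p)⁻¹ * (Matrix.of fun i j => wirt ε ξ (fun y => G y i j) p) * (G p)⁻¹) i j := by
    intro i j
    rw [← Matrix.neg_apply, ← hinv]
    rfl
  simp only [Matrix.trace, Matrix.diag]
  rw [← Finset.sum_sub_distrib]
  refine Finset.sum_congr rfl fun i _ => ?_
  rw [wirt_sum fun j _ => (dI i j).fun_mul (dW' j i)]
  conv_rhs => rw [Matrix.mul_apply, ← Finset.sum_sub_distrib]
  refine Finset.sum_congr rfl fun j _ => ?_
  rw [wirt_mul (dI i j) (dW' j i), e2, Matrix.of_apply]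
  ring

end LogDet

section Bochner

variable {n : ℕ} {Φ : Loc n → ℝ} {U : Set (Loc n)} {p : Loc n}

/-- The second order identity behind the evolution equation: the Levi form of the logarithm of the
fiber volume, evaluated on the horizontal lift, is `-□ c + |A|²`. -/
theorem levi_log_det_horizontalLift (hU : IsOpen U) (hΦ : ContDiffOn ℝ ∞ Φ U) (hp : p ∈ U)
    (hpos : ∀ q ∈ U, (fiberMetric Φ q).PosDef) :
    levi (fun q => Real.log (fiberMetric Φ q).det.re) p (horizontalLift Φ p) (horizontalLift Φ p)
      = -box Φ (geodesicCurvature Φ) p + kodairaSpencerNormSq Φ p := by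
  have hdet : ∀ q ∈ U, (fiberMetric Φ q).det ≠ 0 := fun q hq => (hpos q hq).det_pos.ne'
  set v : Loc n := horizontalLift Φ p with hv
  set a : Fin n → ℂ := liftCoeff Φ p with ha
  have hva : v = (1, a) := rfl
  set g := fiberMetric Φ p with hg
  have hgu : IsUnit g.det := (hdet p hp).isUnit
  have hherm : g.conjTranspose = g := fiberMetric_isHermitian hU hΦ hp
  have hgs := fun i j => fiberMetric_contDiffOn hU hΦ i j
  set h : Fin n → Loc n → ℂ := fun γ q => liftCoeff Φ q γ - a γ with hh
  have h0 : ∀ γ, h γ p = 0 := fun γ => sub_self _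
  have hsm : ∀ γ, ContDiffOn ℝ ∞ (h γ) U := fun γ =>
    (liftCoeff_contDiffOn hU hΦ hdet γ).sub contDiffOn_const
  have hΦc := contDiffOn_ofReal hΦ
  -- derivatives of the deviation from the horizontal lift
  set B : Matrix (Fin n) (Fin n) ℂ := Matrix.of fun α γ => wirt (-Complex.I) (eFib α) (h γ) p with hB
  set Dg : Matrix (Fin n) (Fin n) ℂ :=
    Matrix.of fun i j => wirt (-Complex.I) v (fun y => fiberMetric Φ y i j) p with hDg
  set Dg' : Matrix (Fin n) (Fin n) ℂ :=
    Matrix.of fun i j => wirt Complex.I v (fun y => fiberMetric Φ y i j) p with hDg'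
  have hBg : B * g = -Dg := by
    ext α δ
    have e1 : ∀ q ∈ U, ∑ γ, h γ q * fiberMetric Φ q γ δ = -levi Φ q v (eFib δ) := by
      intro q hq
      rw [hva, levi_eFib_of_base_one (hdet q hq), neg_neg]
    have e2 := wirt_congr_on (ε := -Complex.I) (ξ := eFib α) hU hp e1
    rw [wirt_sum fun γ _ => ((hsm γ).differentiableAt_of_isOpen hU hp).fun_mul
      ((hgs γ δ).differentiableAt_of_isOpen hU hp), wirt_neg] at e2
    rw [Matrix.mul_apply, Matrix.neg_apply]
    have e3 : wirt (-Complex.I) (eFib α) (fun q => levi Φ q v (eFib δ)) p = Dg α δ := by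
      simp only [hDg, Matrix.of_apply, fiberMetric, levi_eq_wirt]
      exact wirt_comm hU (wirt_contDiffOn hU hΦc) hp _ _ _ _
    rw [← e3, ← e2]
    refine Finset.sum_congr rfl fun γ _ => ?_
    rw [wirt_mul ((hsm γ).differentiableAt_of_isOpen hU hp)
      ((hgs γ δ).differentiableAt_of_isOpen hU hp), h0, zero_mul, add_zero]
    rfl
  have hDgstar : Dg' = Dg.conjTranspose := by
    ext i j
    simp only [hDg', hDg, Matrix.conjTranspose_apply, Matrix.of_apply]
    have := wirt_star (ε := Complex.I) (ξ := v) (f := fun y => fiberMetric Φ y j i) (x := p)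
    rw [show star Complex.I = -Complex.I by simp] at this
    rw [← this]
    exact wirt_congr_on hU hp fun q hq => ((fiberMetric_isHermitian hU hΦ hq).apply i j).symm
  have hDB' : Dg' = -(g * B.conjTranspose) := by
    rw [hDgstar, ← neg_neg Dg, ← hBg, Matrix.conjTranspose_neg, Matrix.conjTranspose_mul, hherm]
  have hDB : Dg = -(B * g) := by rw [hBg, neg_neg]
  have htr : (g⁻¹ * Dg * g⁻¹ * Dg').trace = (g⁻¹ * B * g * B.conjTranspose).trace := by
    rw [hDB, hDB']
    simp only [Matrix.mul_neg, Matrix.neg_mul, neg_neg, Matrix.mul_assoc]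
    rw [← Matrix.mul_assoc g⁻¹ g, Matrix.nonsing_inv_mul _ hgu, Matrix.one_mul]
  -- second derivatives of the geodesic curvature along the fiber
  have hc : ∀ α β : Fin n,
      wirt (-Complex.I) (eFib α) (wirt Complex.I (eFib β) (geodesicCurvature Φ)) p
        = wirt (-Complex.I) v (wirt Complex.I v (fun y => fiberMetric Φ y α β)) p
          - ∑ γ, ∑ δ, g γ δ * (wirt Complex.I (eFib β) (h γ) p * star (wirt Complex.I (eFib α) (h δ) p)
            + B α γ * star (B β δ)) := by
    intro α β
    have hstar := fun δ => contDiffOn_star (hsm δ)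
    have ht := fun γ δ => ((hgs γ δ).mul (hsm γ)).mul (hstar δ)
    have hts := fun γ => ContDiffOn.sum (s := Finset.univ) fun δ _ => ht γ δ
    have htss := ContDiffOn.sum (s := Finset.univ) fun γ _ => hts γ
    have hL := levi_contDiffOn hU hΦ v v
    have hin : ∀ q ∈ U, wirt Complex.I (eFib β) (geodesicCurvature Φ) q
        = wirt Complex.I (eFib β) (fun q => levi Φ q v v) q
          - ∑ γ, ∑ δ, wirt Complex.I (eFib β)
            (fun q => fiberMetric Φ q γ δ * h γ q * star (h δ q)) q := by
      intro q hq
      rw [wirt_congr_on (g := fun q => levi Φ q v v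
        - ∑ γ, ∑ δ, fiberMetric Φ q γ δ * h γ q * star (h δ q)) hU hq
        fun y hy => geodesicCurvature_eq hU hΦ hy (hdet y hy) a]
      rw [wirt_sub (hL.differentiableAt_of_isOpen hU hq) (htss.differentiableAt_of_isOpen hU hq),
        wirt_sum fun γ _ => (hts γ).differentiableAt_of_isOpen hU hq]
      congr 1
      refine Finset.sum_congr rfl fun γ _ => ?_
      exact wirt_sum fun δ _ => (ht γ δ).differentiableAt_of_isOpen hU hq
    have ht' := fun γ δ => wirt_contDiffOn (ε := Complex.I) (ξ := eFib β) hU (ht γ δ)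
    have hts' := fun γ => ContDiffOn.sum (s := Finset.univ) fun δ _ => ht' γ δ
    have htss' := ContDiffOn.sum (s := Finset.univ) fun γ _ => hts' γ
    rw [wirt_congr_on hU hp hin, wirt_sub ((wirt_contDiffOn hU hL).differentiableAt_of_isOpen hU hp)
      (htss'.differentiableAt_of_isOpen hU hp),
      wirt_sum fun γ _ => (hts' γ).differentiableAt_of_isOpen hU hp]
    congr 1
    · simp only [fiberMetric, levi_eq_wirt]
      have c1 : ∀ q ∈ U, wirt Complex.I (eFib β) (fun q => wirt (-Complex.I) v
          (wirt Complex.I v (fun y => (Φ y : ℂ))) q) q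
          = wirt (-Complex.I) v (wirt Complex.I v (wirt Complex.I (eFib β) (fun y => (Φ y : ℂ)))) q := by
        intro q hq
        rw [wirt_comm hU (wirt_contDiffOn hU hΦc) hq]
        exact wirt_congr_on hU hq fun y hy => wirt_comm hU hΦc hy _ _ _ _
      have hb := wirt_contDiffOn (ε := Complex.I) (ξ := eFib β) hU hΦc
      rw [wirt_congr_on hU hp c1, wirt_comm hU (wirt_contDiffOn hU hb) hp]
      exact wirt_congr_on hU hp fun y hy => wirt_comm hU hb hy _ _ _ _
    · refine Finset.sum_congr rfl fun γ _ => ?_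
      rw [wirt_sum fun δ _ => (ht' γ δ).differentiableAt_of_isOpen hU hp]
      refine Finset.sum_congr rfl fun δ _ => ?_
      rw [wirt_wirt_mul_of_eq_zero hU hp (hgs γ δ) (hsm γ) (hstar δ) (h0 γ) (by rw [h0, star_zero]),
        wirt_star, wirt_star]
      simp [hB, hg]
  have hKS : ∀ α β, kodairaSpencer Φ p α β = wirt Complex.I (eFib β) (h α) p := by
    intro α β
    rw [kodairaSpencer, dWbar_eq_wirt]
    simp only [hh]
    rw [wirt_sub ((liftCoeff_contDiffOn hU hΦ hdet α).differentiableAt_of_isOpen hU hp)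
      (differentiableAt_const _), wirt_const, sub_zero]
  rw [levi_eq_wirt, wirt_wirt_log_det hU hp hgs fun q hq => (hpos q hq).det_pos]
  rw [← hg, ← hDg, ← hDg', htr, box, neg_neg]
  simp only [dW_eq_wirt, dWbar_eq_wirt, hc, kodairaSpencerNormSq, hKS]
  rw [← hg]
  have e1 : (g⁻¹ * B * g * B.conjTranspose).trace
      = ∑ α, ∑ β, g⁻¹ β α * ∑ γ, ∑ δ, g γ δ * (B α γ * star (B β δ)) := by
    rw [Finset.sum_comm]
    simp only [Matrix.trace, Matrix.diag]
    refine Finset.sum_congr rfl fun β _ => ?_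
    rw [Matrix.mul_assoc, Matrix.mul_assoc, Matrix.mul_apply]
    refine Finset.sum_congr rfl fun α _ => ?_
    rw [Matrix.mul_apply]
    congr 1
    refine Finset.sum_congr rfl fun γ _ => ?_
    rw [Matrix.mul_apply, Finset.mul_sum]
    refine Finset.sum_congr rfl fun δ _ => ?_
    rw [Matrix.conjTranspose_apply]; ring
  have e2 : ∑ α, ∑ β, ∑ γ, ∑ δ, wirt Complex.I (eFib β) (h α) p *
        star (wirt Complex.I (eFib δ) (h γ) p) * g α γ * g⁻¹ β δ
      = ∑ α, ∑ β, g⁻¹ β α * ∑ γ, ∑ δ, g γ δ *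
          (wirt Complex.I (eFib β) (h γ) p * star (wirt Complex.I (eFib α) (h δ) p)) := by
    simp only [Finset.mul_sum]
    have r : ∀ T : Fin n → Fin n → Fin n → Fin n → ℂ,
        ∑ α, ∑ β, ∑ γ, ∑ δ, T α β γ δ = ∑ δ, ∑ β, ∑ α, ∑ γ, T α β γ δ := by
      intro T
      calc _ = ∑ β, ∑ α, ∑ γ, ∑ δ, T α β γ δ := Finset.sum_comm
        _ = ∑ β, ∑ α, ∑ δ, ∑ γ, T α β γ δ :=
          Finset.sum_congr rfl fun _ _ => Finset.sum_congr rfl fun _ _ => Finset.sum_comm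
        _ = ∑ β, ∑ δ, ∑ α, ∑ γ, T α β γ δ :=
          Finset.sum_congr rfl fun _ _ => Finset.sum_comm
        _ = _ := Finset.sum_comm
    rw [r]
    refine Finset.sum_congr rfl fun δ _ => Finset.sum_congr rfl fun β _ =>
      Finset.sum_congr rfl fun α _ => Finset.sum_congr rfl fun γ _ => by ring
  have e3 : ∑ i, ∑ j, g⁻¹ i j * wirt (-Complex.I) v (wirt Complex.I v (fun y => fiberMetric Φ y j i)) p
      = ∑ α, ∑ β, g⁻¹ β α *
        wirt (-Complex.I) v (wirt Complex.I v (fun y => fiberMetric Φ y α β)) p := Finset.sum_comm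
  rw [e1, e2, e3]
  simp only [← Finset.sum_add_distrib, ← Finset.sum_sub_distrib]
  refine Finset.sum_congr rfl fun α _ => Finset.sum_congr rfl fun β _ => ?_
  simp only [mul_add, Finset.sum_add_distrib, mul_sub]
  ring

end Bochner

/-! ### Families depending smoothly on time -/

section Time

variable {V : Type*} [NormedAddCommGroup V] [NormedSpace ℝ V]
  {J : Set ℝ} {U : Set V} {t : ℝ} {x : V}

theorem uniqueDiffOn_of_ordConnected (hJ : J.OrdConnected) (hJ' : J.Nontrivial) :
    UniqueDiffOn ℝ J := by
  refine uniqueDiffOn_convex (Set.OrdConnected.convex (𝕜 := ℝ) hJ) ?_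
  obtain ⟨a, ha, b, hb, hab⟩ := hJ'.exists_lt
  exact ⟨(a + b) / 2, interior_mono (Ioo_subset_Icc_self.trans (hJ.out ha hb))
    (by rw [isOpen_Ioo.interior_eq]; constructor <;> linarith)⟩

theorem subset_closure_interior_prod {V : Type*} [TopologicalSpace V] {U : Set V}
    (hJ : J.OrdConnected) (hJ' : J.Nontrivial) (hU : IsOpen U) :
    J ×ˢ U ⊆ closure (interior (J ×ˢ U)) := by
  have hne : (interior J).Nonempty := by
    obtain ⟨a, ha, b, hb, hab⟩ := hJ'.exists_lt
    exact ⟨(a + b) / 2, interior_mono (Ioo_subset_Icc_self.trans (hJ.out ha hb))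
      (by rw [isOpen_Ioo.interior_eq]; constructor <;> linarith)⟩
  rw [interior_prod_eq, closure_prod_eq,
    (Set.OrdConnected.convex (𝕜 := ℝ) hJ).closure_interior_eq_closure_of_nonempty_interior hne,
    hU.interior_eq]
  exact prod_mono subset_closure subset_closure

variable {E : Type*} [NormedAddCommGroup E] [NormedSpace ℝ E] {F : ℝ × V → E}

theorem fderiv_slice (hU : IsOpen U) (hF : ContDiffOn ℝ ∞ F (J ×ˢ U))
    (ht : t ∈ J) (hx : x ∈ U) (ξ : V) :
    fderiv ℝ (fun y => F (t, y)) x ξ = fderivWithin ℝ F (J ×ˢ U) (t, x) (0, ξ) := by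
  have h1 : HasFDerivWithinAt F (fderivWithin ℝ F (J ×ˢ U) (t, x)) (J ×ˢ U) (t, x) :=
    ((hF (t, x) ⟨ht, hx⟩).differentiableWithinAt (by norm_num)).hasFDerivWithinAt
  have h2 := HasFDerivWithinAt.comp x h1 (hasFDerivAt_prodMk_right (𝕜 := ℝ) t x).hasFDerivWithinAt
    (s := U) (fun y hy => ⟨ht, hy⟩)
  have h3 := (h2.hasFDerivAt (hU.mem_nhds hx)).fderiv
  simp only [Function.comp_def] at h3
  rw [h3]
  simp

theorem hasDerivWithinAt_slice (hF : ContDiffOn ℝ ∞ F (J ×ˢ U)) (ht : t ∈ J) (hx : x ∈ U) :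
    HasDerivWithinAt (fun τ => F (τ, x)) (fderivWithin ℝ F (J ×ˢ U) (t, x) (1, 0)) J t := by
  have h1 : HasFDerivWithinAt F (fderivWithin ℝ F (J ×ˢ U) (t, x)) (J ×ˢ U) (t, x) :=
    ((hF (t, x) ⟨ht, hx⟩).differentiableWithinAt (by norm_num)).hasFDerivWithinAt
  have h2 := HasFDerivWithinAt.comp t h1 (hasFDerivAt_prodMk_left (𝕜 := ℝ) t x).hasFDerivWithinAt
    (s := J) (fun y hy => (⟨hy, hx⟩ : (y, x) ∈ J ×ˢ U))
  have h3 := h2.hasDerivWithinAt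
  simpa [Function.comp_def] using h3

theorem contDiffOn_slice_left (hF : ContDiffOn ℝ ∞ F (J ×ˢ U)) (ht : t ∈ J) :
    ContDiffOn ℝ ∞ (fun y => F (t, y)) U :=
  hF.comp (contDiff_prodMk_right t).contDiffOn fun _ hy => ⟨ht, hy⟩

theorem contDiffOn_slice_right (hF : ContDiffOn ℝ ∞ F (J ×ˢ U)) (hx : x ∈ U) :
    ContDiffOn ℝ ∞ (fun τ => F (τ, x)) J :=
  hF.comp (contDiff_prodMk_left x).contDiffOn fun _ hy => ⟨hy, hx⟩

theorem contDiffOn_fderivWithin_apply (hJ : UniqueDiffOn ℝ J) (hU : IsOpen U)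
    (hF : ContDiffOn ℝ ∞ F (J ×ˢ U)) (v : ℝ × V) :
    ContDiffOn ℝ ∞ (fun q => fderivWithin ℝ F (J ×ˢ U) q v) (J ×ˢ U) :=
  (hF.fderivWithin (hJ.prod hU.uniqueDiffOn) (by norm_num)).clm_apply contDiffOn_const

theorem contDiffOn_derivWithin_slice (hJ : UniqueDiffOn ℝ J) (hU : IsOpen U)
    (hF : ContDiffOn ℝ ∞ F (J ×ˢ U)) :
    ContDiffOn ℝ ∞ (fun q : ℝ × V => derivWithin (fun τ => F (τ, q.2)) J q.1) (J ×ˢ U) :=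
  (contDiffOn_fderivWithin_apply hJ hU hF (1, 0)).congr fun q hq =>
    (hasDerivWithinAt_slice hF hq.1 hq.2).derivWithin (hJ q.1 hq.1)

/-- Time derivatives commute with directional derivatives, also at the end points of the time
interval. -/
theorem hasDerivWithinAt_fderiv_slice (hJ : J.OrdConnected) (hJ' : J.Nontrivial) (hU : IsOpen U)
    (hF : ContDiffOn ℝ ∞ F (J ×ˢ U)) (ht : t ∈ J) (hx : x ∈ U) (ξ : V) :
    HasDerivWithinAt (fun τ => fderiv ℝ (fun y => F (τ, y)) x ξ)
      (fderiv ℝ (fun y => derivWithin (fun τ => F (τ, y)) J t) x ξ) J t := by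
  have hu := uniqueDiffOn_of_ordConnected hJ hJ'
  have hud : UniqueDiffOn ℝ (J ×ˢ U) := hu.prod hU.uniqueDiffOn
  have hD : DifferentiableWithinAt ℝ (fderivWithin ℝ F (J ×ˢ U)) (J ×ˢ U) (t, x) :=
    ((hF.fderivWithin hud (m := ∞) (by norm_num)) (t, x) ⟨ht, hx⟩).differentiableWithinAt
      (by norm_num)
  have e : ∀ v w : ℝ × V, fderivWithin ℝ (fun q => fderivWithin ℝ F (J ×ˢ U) q v) (J ×ˢ U) (t, x) w
      = fderivWithin ℝ (fderivWithin ℝ F (J ×ˢ U)) (J ×ˢ U) (t, x) w v := by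
    intro v w
    rw [fderivWithin_clm_apply (hud _ ⟨ht, hx⟩) hD (differentiableWithinAt_const v)]
    simp
  have hs := ((hF (t, x) ⟨ht, hx⟩).isSymmSndFDerivWithinAt
    (by rw [minSmoothness_of_isRCLikeNormedField]; exact WithTop.coe_le_coe.2 le_top) hud
    (subset_closure_interior_prod hJ hJ' hU ⟨ht, hx⟩) ⟨ht, hx⟩).eq (1, 0) (0, ξ)
  have h1 := hasDerivWithinAt_slice (contDiffOn_fderivWithin_apply hu hU hF (0, ξ)) ht hx
  have h2 := fderiv_slice hU (contDiffOn_derivWithin_slice hu hU hF) ht hx ξ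
  have h3 : fderivWithin ℝ (fun q : ℝ × V => derivWithin (fun τ => F (τ, q.2)) J q.1) (J ×ˢ U) (t, x)
      = fderivWithin ℝ (fun q => fderivWithin ℝ F (J ×ˢ U) q (1, 0)) (J ×ˢ U) (t, x) :=
    fderivWithin_congr (fun q hq => (hasDerivWithinAt_slice hF hq.1 hq.2).derivWithin (hu q.1 hq.1))
      ((hasDerivWithinAt_slice hF ht hx).derivWithin (hu t ht))
  rw [h2, h3, e, ← hs, ← e]
  exact h1.congr (fun τ hτ => fderiv_slice hU hF hτ hx ξ) (fderiv_slice hU hF ht hx ξ)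

variable [Module ℂ V]

theorem contDiffOn_wirt_slice {F : ℝ × V → ℂ} (hJ : UniqueDiffOn ℝ J) (hU : IsOpen U)
    (hF : ContDiffOn ℝ ∞ F (J ×ˢ U)) (ε : ℂ) (ξ : V) :
    ContDiffOn ℝ ∞ (fun q : ℝ × V => wirt ε ξ (fun y => F (q.1, y)) q.2) (J ×ˢ U) := by
  have h := fun v => contDiffOn_fderivWithin_apply hJ hU hF (0, v)
  refine (((h ξ).add (contDiffOn_const.mul (h (Complex.I • ξ)))).div_const 2).congr
    (f := fun q => (fderivWithin ℝ F (J ×ˢ U) q (0, ξ)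
      + ε * fderivWithin ℝ F (J ×ˢ U) q (0, Complex.I • ξ)) / 2) fun q hq => ?_
  simp only [wirt]
  rw [fderiv_slice hU hF hq.1 hq.2, fderiv_slice hU hF hq.1 hq.2]

theorem hasDerivWithinAt_wirt_slice {F : ℝ × V → ℂ} (hJ : J.OrdConnected) (hJ' : J.Nontrivial)
    (hU : IsOpen U) (hF : ContDiffOn ℝ ∞ F (J ×ˢ U)) (ht : t ∈ J) (hx : x ∈ U) (ε : ℂ) (ξ : V) :
    HasDerivWithinAt (fun τ => wirt ε ξ (fun y => F (τ, y)) x)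
      (wirt ε ξ (fun y => derivWithin (fun τ => F (τ, y)) J t) x) J t := by
  have h := fun v => hasDerivWithinAt_fderiv_slice hJ hJ' hU hF ht hx v
  exact ((h ξ).add ((h (Complex.I • ξ)).const_mul ε)).div_const 2

theorem contDiffOn_levi_slice {F : ℝ × V → ℝ} (hJ : UniqueDiffOn ℝ J) (hU : IsOpen U)
    (hF : ContDiffOn ℝ ∞ F (J ×ˢ U)) (ξ η : V) :
    ContDiffOn ℝ ∞ (fun q : ℝ × V => levi (fun y => F (q.1, y)) q.2 ξ η) (J ×ˢ U) := by
  simp only [levi_eq_wirt]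
  exact contDiffOn_wirt_slice (F := fun q : ℝ × V => wirt Complex.I η (fun y => (F (q.1, y) : ℂ)) q.2)
    hJ hU (contDiffOn_wirt_slice (F := fun q => (F q : ℂ)) hJ hU (contDiffOn_ofReal hF) _ _) _ _

theorem hasDerivWithinAt_levi {F : ℝ × V → ℝ} (hJ : J.OrdConnected) (hJ' : J.Nontrivial)
    (hU : IsOpen U) (hF : ContDiffOn ℝ ∞ F (J ×ˢ U)) (ht : t ∈ J) (hx : x ∈ U) (ξ η : V) :
    HasDerivWithinAt (fun τ => levi (fun y => F (τ, y)) x ξ η)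
      (levi (fun y => derivWithin (fun τ => F (τ, y)) J t) x ξ η) J t := by
  have hu := uniqueDiffOn_of_ordConnected hJ hJ'
  have hFc : ContDiffOn ℝ ∞ (fun q => (F q : ℂ)) (J ×ˢ U) := contDiffOn_ofReal hF
  simp only [levi_eq_wirt]
  have h := hasDerivWithinAt_wirt_slice
    (F := fun q : ℝ × V => wirt Complex.I η (fun y => (F (q.1, y) : ℂ)) q.2) hJ hJ' hU
    (contDiffOn_wirt_slice (F := fun q => (F q : ℂ)) hu hU hFc _ _) ht hx (-Complex.I) ξ
  convert h using 1
  refine wirt_congr_on hU hx fun y hy => ?_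
  have h2 := (hasDerivWithinAt_wirt_slice (F := fun q => (F q : ℂ)) hJ hJ' hU hFc ht hy
    Complex.I η).derivWithin (hu t ht)
  rw [h2]
  refine wirt_congr_on hU hy fun z hz => ?_
  have h3 := hasDerivWithinAt_slice hF ht hz
  rw [h3.derivWithin (hu t ht), (HasDerivWithinAt.ofReal_comp h3).derivWithin (hu t ht)]

end Time

/-- The first variation of the geodesic curvature is the Levi form of the variation, evaluated on
the horizontal lift. -/
theorem hasDerivWithinAt_geodesicCurvature {n : ℕ} {J : Set ℝ} {t : ℝ} {U : Set (Loc n)} {p : Loc n}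
    {F : ℝ × Loc n → ℝ} (hJ : J.OrdConnected) (hJ' : J.Nontrivial)
    (hU : IsOpen U) (hF : ContDiffOn ℝ ∞ F (J ×ˢ U)) (ht : t ∈ J) (hp : p ∈ U)
    (hdet : ∀ τ ∈ J, (fiberMetric (fun y => F (τ, y)) p).det ≠ 0) :
    HasDerivWithinAt (fun τ => geodesicCurvature (fun y => F (τ, y)) p)
      (levi (fun y => derivWithin (fun τ => F (τ, y)) J t) p
        (horizontalLift (fun y => F (t, y)) p) (horizontalLift (fun y => F (t, y)) p)) J t := by
  have hu := uniqueDiffOn_of_ordConnected hJ hJ'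
  set v := horizontalLift (fun y => F (t, y)) p with hv
  set a := liftCoeff (fun y => F (t, y)) p with ha
  have hL := fun ξ η => hasDerivWithinAt_levi hJ hJ' hU hF ht hp ξ η
  have hLs : ∀ ξ η, ContDiffOn ℝ ∞ (fun τ => levi (fun y => F (τ, y)) p ξ η) J := fun ξ η =>
    contDiffOn_slice_right (F := fun q : ℝ × Loc n => levi (fun y => F (q.1, y)) q.2 ξ η)
      (contDiffOn_levi_slice hu hU hF ξ η) hp
  have hinv := fun i j => contDiffOn_inv (G := fun τ => fiberMetric (fun y => F (τ, y)) p)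
    (fun i j => hLs _ _) hdet i j
  have hcoef : ∀ γ, ContDiffOn ℝ ∞ (fun τ => liftCoeff (fun y => F (τ, y)) p γ - a γ) J := by
    intro γ
    refine ContDiffOn.sub (ContDiffOn.neg (ContDiffOn.sum fun β _ => ?_)) contDiffOn_const
    exact (hinv β γ).mul (hLs _ _)
  have hcd := fun γ =>
    (((hcoef γ) t ht).differentiableWithinAt (by norm_num)).hasDerivWithinAt
  have hcs := fun γ =>
    (((contDiffOn_star (hcoef γ)) t ht).differentiableWithinAt (by norm_num)).hasDerivWithinAt
  have hprod : ∀ γ δ, HasDerivWithinAt (fun τ => fiberMetric (fun y => F (τ, y)) p γ δ *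
      (liftCoeff (fun y => F (τ, y)) p γ - a γ) * star (liftCoeff (fun y => F (τ, y)) p δ - a δ))
      0 J t := by
    intro γ δ
    have h0 : ∀ γ, liftCoeff (fun y => F (t, y)) p γ - a γ = 0 := fun γ => sub_self _
    have := ((hL (eFib γ) (eFib δ)).fun_mul (hcd γ)).fun_mul (hcs δ)
    rw [h0, h0, star_zero, mul_zero, zero_add, mul_zero, zero_mul] at this
    exact this
  have hsum := HasDerivWithinAt.fun_sum (u := Finset.univ) fun γ (_ : γ ∈ Finset.univ) =>
    HasDerivWithinAt.fun_sum (u := Finset.univ) fun δ (_ : δ ∈ Finset.univ) => hprod γ δ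
  have hfin := (hL v v).fun_sub hsum
  simp only [Finset.sum_const_zero, sub_zero] at hfin
  refine hfin.congr (fun τ hτ => ?_) ?_
  · exact geodesicCurvature_eq hU (contDiffOn_slice_left hF hτ) hp (hdet τ hτ) a
  · exact geodesicCurvature_eq hU (contDiffOn_slice_left hF ht) hp (hdet t ht) a

/-! ### Homogeneous functions and the divergence identity -/

section Piola

variable {V : Type*} [NormedAddCommGroup V] [NormedSpace ℝ V] [Module ℂ V]
  {ι : Type*} [Fintype ι] [DecidableEq ι] {ε : ℂ} {e : ι → V} {p : V} {U : Set V}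
  {G : V → Matrix ι ι ℂ}

/-- Piola's identity where the matrix is invertible: the cofactors are `det G • G⁻¹`, and both factors
have explicit derivatives. -/
theorem sum_wirt_adjugate_of_det_ne_zero (hU : IsOpen U) (hp : p ∈ U)
    (hG : ∀ i j, ContDiffOn ℝ ∞ (fun y => G y i j) U)
    (hsymm : ∀ a i j, wirt ε (e a) (fun y => G y i j) p = wirt ε (e i) (fun y => G y a j) p)
    (hdet : (G p).det ≠ 0) (b : ι) :
    ∑ a, wirt ε (e a) (fun y => (G y).adjugate b a) p = 0 := by
  have hU' : IsOpen (U ∩ {y | (G y).det ≠ 0}) :=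
    (contDiffOn_det hG).continuousOn.isOpen_inter_preimage hU isOpen_compl_singleton
  have hp' : p ∈ U ∩ {y | (G y).det ≠ 0} := ⟨hp, hdet⟩
  have hG' := fun i j => (hG i j).mono (inter_subset_left (t := {y | (G y).det ≠ 0}))
  have h0 : ∀ y ∈ U ∩ {y | (G y).det ≠ 0}, (G y).det ≠ 0 := fun y hy => hy.2
  have dG := fun i j => (hG i j).differentiableAt_of_isOpen hU hp
  have key : ∀ a, wirt ε (e a) (fun y => (G y).adjugate b a) p
      = (G p).det * (∑ i, ∑ j, (G p)⁻¹ i j * wirt ε (e a) (fun y => G y j i) p * (G p)⁻¹ b a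
        - ∑ i, ∑ j, (G p)⁻¹ b j * wirt ε (e a) (fun y => G y j i) p * (G p)⁻¹ i a) := by
    intro a
    have e1 : ∀ y ∈ U ∩ {y | (G y).det ≠ 0},
        (G y).adjugate b a = (G y).det * (G y)⁻¹ b a := by
      intro y hy
      rw [Matrix.inv_def, Ring.inverse_eq_inv', Matrix.smul_apply, smul_eq_mul,
        mul_inv_cancel_left₀ hy.2]
    rw [wirt_congr_on hU' hp' e1, wirt_mul (differentiableAt_det dG)
      ((contDiffOn_inv hG' h0 b a).differentiableAt_of_isOpen hU' hp'), wirt_det dG]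
    have hinv := congrFun (congrFun (wirt_inv (ε := ε) (ξ := e a) hU' hp' hG' h0) b) a
    rw [Matrix.of_apply] at hinv
    rw [hinv, Matrix.neg_apply, Matrix.mul_apply]
    simp only [Matrix.mul_apply, Matrix.of_apply, Finset.sum_mul, Finset.mul_sum, mul_sub]
    rw [sub_eq_add_neg, mul_neg, Finset.mul_sum]
    congr 1
    · refine Finset.sum_congr rfl fun i _ => Finset.sum_congr rfl fun j _ => ?_
      have : (G p).adjugate i j = (G p).det * (G p)⁻¹ i j := by
        rw [Matrix.inv_def, Ring.inverse_eq_inv', Matrix.smul_apply, smul_eq_mul,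
          mul_inv_cancel_left₀ hdet]
      rw [this]; ring
    · simp only [Finset.mul_sum]
  simp only [key, ← Finset.mul_sum, Finset.sum_sub_distrib]
  refine mul_eq_zero_of_right _ (sub_eq_zero.2 ?_)
  have hswap : ∀ T : ι → ι → ι → ℂ, ∑ a, ∑ i, ∑ j, T a i j = ∑ j, ∑ i, ∑ a, T a i j := by
    intro T
    calc _ = ∑ a, ∑ j, ∑ i, T a i j := Finset.sum_congr rfl fun _ _ => Finset.sum_comm
      _ = ∑ j, ∑ a, ∑ i, T a i j := Finset.sum_comm
      _ = _ := Finset.sum_congr rfl fun _ _ => Finset.sum_comm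
  rw [hswap fun a i j => (G p)⁻¹ b j * wirt ε (e a) (fun y => G y j i) p * (G p)⁻¹ i a]
  refine Finset.sum_congr rfl fun a _ => Finset.sum_congr rfl fun i _ =>
    Finset.sum_congr rfl fun j _ => ?_
  rw [hsymm a j i]
  ring

/-- The cofactors of a matrix of second derivatives are divergence free (Piola's identity). -/
theorem sum_wirt_adjugate (hU : IsOpen U) (hp : p ∈ U)
    (hG : ∀ i j, ContDiffOn ℝ ∞ (fun y => G y i j) U)
    (hsymm : ∀ a i j, wirt ε (e a) (fun y => G y i j) p = wirt ε (e i) (fun y => G y a j) p)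
    (b : ι) :
    ∑ a, wirt ε (e a) (fun y => (G y).adjugate b a) p = 0 := by
  -- the cofactors of `G + c • 1` depend polynomially on `c` and have vanishing divergence where this
  -- matrix is invertible, which is the case for a dense set of `c`
  have dG := fun i j => (hG i j).differentiableAt_of_isOpen hU hp
  set T : ι → ι → ι → ℂ := fun a i j => wirt ε (e a) (fun y => G y i j) p with hT
  have hadd : ∀ (c : ℂ) (a i j : ι),
      wirt ε (e a) (fun y => (G y + c • (1 : Matrix ι ι ℂ)) i j) p = T a i j := by
    intro c a i j
    simp only [Matrix.add_apply]
    rw [wirt_add (dG i j) (differentiableAt_const _), wirt_const, add_zero]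
  have dG' : ∀ (c : ℂ) (i j : ι),
      DifferentiableAt ℝ (fun y => (G y + c • (1 : Matrix ι ι ℂ)) i j) p := fun c i j =>
    (dG i j).add (differentiableAt_const _)
  set P : ℂ → ℂ := fun c => ∑ a, ∑ i, ∑ j,
    ((G p + c • (1 : Matrix ι ι ℂ)).updateRow a (Pi.single b 1)).adjugate i j *
      (if j = a then 0 else T a j i) with hP
  have hPc : Continuous P := by
    refine continuous_finsetSum _ fun a _ => continuous_finsetSum _ fun i _ =>
      continuous_finsetSum _ fun j _ => Continuous.mul ?_ continuous_const
    have h1 : Continuous fun c : ℂ =>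
        ((G p + c • (1 : Matrix ι ι ℂ)).updateRow a (Pi.single b 1)) := by
      exact (continuous_const.add (continuous_id.smul continuous_const)).matrix_updateRow _
        continuous_const
    exact h1.matrix_adjugate.matrix_elem i j
  have hPe : ∀ c, ∑ a, wirt ε (e a) (fun y => (G y + c • (1 : Matrix ι ι ℂ)).adjugate b a) p
      = P c := by
    intro c
    refine Finset.sum_congr rfl fun a _ => ?_
    have h1 : ∀ i j, (fun y => (G y + c • (1 : Matrix ι ι ℂ)).updateRow a (Pi.single b 1) i j)
        = if i = a then fun _ => (Pi.single b 1 : ι → ℂ) j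
          else fun y => (G y + c • (1 : Matrix ι ι ℂ)) i j := by
      intro i j
      funext y
      rw [Matrix.updateRow_apply]
      split_ifs <;> rfl
    simp only [Matrix.adjugate_apply (_ + _)]
    rw [wirt_det fun i j => by
      rw [h1]
      split_ifs
      · exact differentiableAt_const _
      · exact dG' c i j]
    refine Finset.sum_congr rfl fun i _ => Finset.sum_congr rfl fun j _ => ?_
    congr 1
    rw [h1]
    split_ifs
    · exact wirt_const _
    · exact hadd c a j i
  have hfin : {c : ℂ | (G p + c • (1 : Matrix ι ι ℂ)).det = 0}.Finite := by
    have hne : (-G p).charpoly ≠ 0 := (Matrix.charpoly_monic _).ne_zero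
    refine ((-G p).charpoly.rootSet_finite ℂ).subset fun c hc => ?_
    rw [Polynomial.mem_rootSet]
    refine ⟨hne, ?_⟩
    rw [Polynomial.coe_aeval_eq_eval, Matrix.eval_charpoly]
    rw [mem_ofPred_eq] at hc
    rw [← hc]
    congr 1
    rw [sub_neg_eq_add, add_comm, Matrix.smul_one_eq_diagonal]
    rfl
  have hd : Dense {c : ℂ | (G p + c • (1 : Matrix ι ι ℂ)).det ≠ 0} :=
    hfin.countable.dense_compl ℂ
  have hz : P = fun _ => 0 := by
    refine hPc.ext_on hd continuous_const fun c hc => ?_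
    rw [← hPe]
    refine sum_wirt_adjugate_of_det_ne_zero (G := fun y => G y + c • (1 : Matrix ι ι ℂ)) hU hp
      (fun i j => (hG i j).add contDiffOn_const) (fun a i j => ?_) hc b
    rw [hadd, hadd]
    exact hsymm a i j
  have := hPe 0
  rw [hz] at this
  simpa using this

end Piola

section Homogeneous

variable {n : ℕ}

theorem fderiv_comp_affine {V V' E : Type*} [NormedAddCommGroup V] [NormedSpace ℝ V]
    [NormedAddCommGroup V'] [NormedSpace ℝ V'] [NormedAddCommGroup E] [NormedSpace ℝ E]
    {f : V' → E} {A : V → V'} {L : V →L[ℝ] V'} {x : V} (hA : HasFDerivAt A L x)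
    (hf : DifferentiableAt ℝ f (A x)) (ξ : V) :
    fderiv ℝ (fun y => f (A y)) x ξ = fderiv ℝ f (A x) (L ξ) := by
  have := (HasFDerivAt.comp x hf.hasFDerivAt hA).fderiv
  simp only [Function.comp_def] at this
  rw [this]
  rfl

/-- The Wirtinger derivatives are natural under maps with complex linear derivative. -/
theorem wirt_comp_affine {V V' : Type*} [NormedAddCommGroup V] [NormedSpace ℝ V] [Module ℂ V]
    [NormedAddCommGroup V'] [NormedSpace ℝ V'] [Module ℂ V']
    {f : V' → ℂ} {A : V → V'} {L : V →L[ℝ] V'} {x : V} (hA : HasFDerivAt A L x)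
    (hL : ∀ ξ, L (Complex.I • ξ) = Complex.I • L ξ)
    (hf : DifferentiableAt ℝ f (A x)) (ε : ℂ) (ξ : V) :
    wirt ε ξ (fun y => f (A y)) x = wirt ε (L ξ) f (A x) := by
  simp only [wirt, fderiv_comp_affine hA hf, hL]

theorem levi_comp_affine {V V' : Type*} [NormedAddCommGroup V] [NormedSpace ℝ V] [Module ℂ V]
    [NormedAddCommGroup V'] [NormedSpace ℝ V'] [Module ℂ V'] {U : Set V} {U' : Set V'}
    (hU : IsOpen U) (hU' : IsOpen U') {f : V' → ℝ} {A : V → V'} {L : V →L[ℝ] V'} {x : V}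
    (hx : x ∈ U) (hA : ∀ y, HasFDerivAt A L y) (hAU : MapsTo A U U')
    (hL : ∀ ξ, L (Complex.I • ξ) = Complex.I • L ξ) (hf : ContDiffOn ℝ ∞ f U') (ξ η : V) :
    levi (fun y => f (A y)) x ξ η = levi f (A x) (L ξ) (L η) := by
  have hfc := contDiffOn_ofReal hf
  rw [levi_eq_wirt, levi_eq_wirt]
  rw [wirt_congr_on (g := fun y => wirt Complex.I (L η) (fun z => (f z : ℂ)) (A y)) hU hx
    fun y hy => wirt_comp_affine (f := fun z => (f z : ℂ)) (hA y) hL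
      (hfc.differentiableAt_of_isOpen hU' (hAU hy)) _ _]
  exact wirt_comp_affine (hA x) hL
    ((wirt_contDiffOn hU' hfc).differentiableAt_of_isOpen hU' (hAU hx)) _ _

/-- Multiplication by a complex number as a real linear map. -/
def smulCLM (a : ℂ) : Loc n →L[ℝ] Loc n :=
  (a • ContinuousLinearMap.id ℂ (Loc n)).restrictScalars ℝ

theorem isOpen_ne_zero : IsOpen ({0}ᶜ : Set (Loc n)) := isOpen_compl_singleton

/-- A function `N` on `ℂ^{n+1}` which is smooth away from the origin and satisfies
`N (a W) = |a|² N W`: the squared norm function of a hermitian metric on `𝒪(-1)`, or a difference of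
such. -/
structure IsHom (N : Loc n → ℝ) : Prop where
  smooth : ContDiffOn ℝ ∞ N {0}ᶜ
  hom : ∀ (a : ℂ) (W : Loc n), N (a • W) = ‖a‖ ^ 2 * N W

variable {N M : Loc n → ℝ} {W : Loc n}

theorem IsHom.lin (hN : IsHom N) (hM : IsHom M) (a b : ℝ) :
    IsHom fun W => a * N W + b * M W :=
  ⟨(contDiffOn_const.mul hN.smooth).add (contDiffOn_const.mul hM.smooth), fun c W => by
    rw [hN.hom, hM.hom]; ring⟩

theorem dWbar_comp_smul {f : Loc n → ℂ} {a : ℂ} (hf : DifferentiableAt ℝ f (a • W)) (ξ : Loc n) :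
    dWbar ξ (fun y => f (a • y)) W = star a * dWbar ξ f (a • W) := by
  rw [← dWbar_smul, dWbar_eq_wirt, dWbar_eq_wirt]
  exact wirt_comp_affine (A := fun y => a • y) (L := smulCLM a) (smulCLM a).hasFDerivAt
    (fun ξ => smul_comm a Complex.I ξ) hf _ _

theorem dW_comp_smul {f : Loc n → ℂ} {a : ℂ} (hf : DifferentiableAt ℝ f (a • W)) (ξ : Loc n) :
    dW ξ (fun y => f (a • y)) W = a * dW ξ f (a • W) := by
  rw [← dW_smul, dW_eq_wirt, dW_eq_wirt]
  exact wirt_comp_affine (A := fun y => a • y) (L := smulCLM a) (smulCLM a).hasFDerivAt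
    (fun ξ => smul_comm a Complex.I ξ) hf _ _

/-- Euler's identity in the complex direction `μ`. -/
theorem fderiv_smul_self {f : Loc n → ℂ} (hf : DifferentiableAt ℝ f W) {ψ : ℂ → ℂ} {ψ' : ℂ} (μ : ℂ)
    (hψ : HasDerivAt (fun t : ℝ => ψ (1 + t * μ)) ψ' 0)
    (hom : ∀ a : ℂ, a ≠ 0 → f (a • W) = ψ a * f W) :
    fderiv ℝ f W (μ • W) = ψ' * f W := by
  have hc : HasDerivAt (fun t : ℝ => W + t • (μ • W)) (μ • W) 0 := by
    simpa using ((hasDerivAt_id (0:ℝ)).smul_const (μ • W)).const_add W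
  have h1 : HasDerivAt (fun t : ℝ => f (W + t • (μ • W))) (fderiv ℝ f W (μ • W)) 0 := by
    have hf' : HasFDerivAt f (fderiv ℝ f W) (W + (0:ℝ) • (μ • W)) := by
      simpa using hf.hasFDerivAt
    exact hf'.comp_hasDerivAt 0 hc
  have h2 : HasDerivAt (fun t : ℝ => ψ (1 + t * μ) * f W) (ψ' * f W) 0 := hψ.mul_const _
  refine h1.unique (h2.congr_of_eventuallyEq ?_)
  have hcont : ContinuousAt (fun t : ℝ => (1:ℂ) + t * μ) 0 := by fun_prop
  filter_upwards [hcont.eventually_ne (show (1:ℂ) + (0:ℝ) * μ ≠ 0 by simp)] with t ht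
  rw [← hom _ ht, add_smul, one_smul, mul_smul]
  congr 2

theorem IsHom.dWbar_hom (hN : IsHom N) (hW : W ≠ 0) {a : ℂ} (ha : a ≠ 0) (ξ : Loc n) :
    dWbar ξ (fun y => (N y : ℂ)) (a • W) = a * dWbar ξ (fun y => (N y : ℂ)) W := by
  have hc := contDiffOn_ofReal hN.smooth
  have h1 := dWbar_comp_smul (W := W) (hc.differentiableAt_of_isOpen isOpen_ne_zero
    (show a • W ∈ ({0}ᶜ : Set (Loc n)) from smul_ne_zero ha hW)) ξ
  have h2 : dWbar ξ (fun y => (N (a • y) : ℂ)) W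
      = ((‖a‖ ^ 2 : ℝ) : ℂ) * dWbar ξ (fun y => (N y : ℂ)) W := by
    simp only [hN.hom, Complex.ofReal_mul, dWbar_eq_wirt]
    exact wirt_const_mul _ (hc.differentiableAt_of_isOpen isOpen_ne_zero hW)
  rw [h2] at h1
  have h3 : ((‖a‖ ^ 2 : ℝ) : ℂ) = star a * a := by
    rw [Complex.ofReal_pow, ← Complex.conj_mul']; rfl
  rw [h3, mul_assoc] at h1
  exact (mul_left_cancel₀ (star_ne_zero.2 ha) h1).symm

theorem IsHom.levi_hom (hN : IsHom N) (hW : W ≠ 0) {a : ℂ} (ha : a ≠ 0) (ξ η : Loc n) :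
    levi N (a • W) ξ η = levi N W ξ η := by
  have hc := wirt_contDiffOn (ε := Complex.I) (ξ := η) isOpen_ne_zero (contDiffOn_ofReal hN.smooth)
  rw [← dWbar_eq_wirt] at hc
  have h1 := dW_comp_smul (W := W) (hc.differentiableAt_of_isOpen isOpen_ne_zero
    (show a • W ∈ ({0}ᶜ : Set (Loc n)) from smul_ne_zero ha hW)) ξ
  rw [dW_eq_wirt, wirt_congr_on (g := fun y => a * dWbar η (fun y => (N y : ℂ)) y) isOpen_ne_zero hW
    fun y hy => hN.dWbar_hom hy ha η, wirt_const_mul _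
    (hc.differentiableAt_of_isOpen isOpen_ne_zero hW)] at h1
  have := mul_left_cancel₀ ha h1
  rw [levi, levi, dW_eq_wirt]
  exact this.symm

theorem IsHom.dWbar_self (hN : IsHom N) (hW : W ≠ 0) :
    dWbar W (fun y => (N y : ℂ)) W = N W := by
  have hc := contDiffOn_ofReal hN.smooth
  have hd := hc.differentiableAt_of_isOpen isOpen_ne_zero hW
  have hom : ∀ a : ℂ, a ≠ 0 → ((N (a • W) : ℝ) : ℂ) = (((‖a‖ ^ 2 : ℝ)) : ℂ) * N W := by
    intro a _
    rw [hN.hom]; push_cast; ring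
  have hder : ∀ μ : ℂ, HasDerivAt (fun t : ℝ => ((‖(1:ℂ) + t * μ‖ ^ 2 : ℝ) : ℂ))
      ((2 * μ.re : ℝ) : ℂ) 0 := by
    intro μ
    refine HasDerivAt.ofReal_comp ?_
    have e : (fun t : ℝ => ‖(1:ℂ) + t * μ‖ ^ 2)
        = fun t : ℝ => (1 + t * μ.re) ^ 2 + (t * μ.im) ^ 2 := by
      funext t
      rw [← Complex.normSq_eq_norm_sq, Complex.normSq_apply]
      simp
      ring
    rw [e]
    have h1 := (((hasDerivAt_id (0:ℝ)).mul_const μ.re).const_add 1).pow 2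
    have h2 := ((hasDerivAt_id (0:ℝ)).mul_const μ.im).pow 2
    refine (h1.add h2).congr_deriv ?_
    simp
  have h1 := fderiv_smul_self hd (ψ := fun a => ((‖a‖ ^ 2 : ℝ) : ℂ)) 1 (hder 1) hom
  have h2 := fderiv_smul_self hd (ψ := fun a => ((‖a‖ ^ 2 : ℝ) : ℂ)) Complex.I (hder _) hom
  rw [one_smul] at h1
  rw [dWbar, h1, h2]
  simp

theorem IsHom.levi_self_left (hN : IsHom N) (hW : W ≠ 0) (η : Loc n) :
    levi N W W η = dWbar η (fun y => (N y : ℂ)) W := by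
  have hc := wirt_contDiffOn (ε := Complex.I) (ξ := η) isOpen_ne_zero (contDiffOn_ofReal hN.smooth)
  rw [← dWbar_eq_wirt] at hc
  have hd := hc.differentiableAt_of_isOpen isOpen_ne_zero hW
  have hder : ∀ μ : ℂ, HasDerivAt (fun t : ℝ => (1:ℂ) + t * μ) μ 0 := by
    intro μ
    simpa using ((hasDerivAt_id (0:ℝ)).ofReal_comp.mul_const μ).const_add 1
  have h1 := fderiv_smul_self hd (ψ := fun a => a) 1 (hder 1) fun a ha => hN.dWbar_hom hW ha η
  have h2 := fderiv_smul_self hd (ψ := fun a => a) Complex.I (hder _)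
    fun a ha => hN.dWbar_hom hW ha η
  rw [one_smul] at h1
  rw [levi, dW, h1, h2, ← mul_assoc, Complex.I_mul_I]
  ring

theorem dW_ofReal_star {f : Loc n → ℝ} (ξ : Loc n) :
    star (dWbar ξ (fun y => (f y : ℂ)) W) = dW ξ (fun y => (f y : ℂ)) W := by
  have h2 := wirt_star (ε := -Complex.I) (ξ := ξ) (f := fun y => (f y : ℂ)) (x := W)
  rw [show star (-Complex.I) = Complex.I by simp] at h2
  rw [dW_eq_wirt, dWbar_eq_wirt, ← h2]
  congr 1
  funext y
  exact Complex.conj_ofReal _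

theorem IsHom.levi_self_right (hN : IsHom N) (hW : W ≠ 0) (ξ : Loc n) :
    levi N W ξ W = dW ξ (fun y => (N y : ℂ)) W := by
  rw [← levi_star isOpen_ne_zero hW hN.smooth, hN.levi_self_left hW, dW_ofReal_star]

/-- The coordinate directions of `ℂ^{n+1}`. -/
def dir : Unit ⊕ Fin n → Loc n := Sum.elim (fun _ => eBase) eFib

/-- The components of a vector of `ℂ^{n+1}`. -/
def comps (W : Loc n) : Unit ⊕ Fin n → ℂ := Sum.elim (fun _ => W.1) W.2

theorem sum_comps (W : Loc n) : W = ∑ i, comps W i • dir i := by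
  rw [Fintype.sum_sum_type]
  simp only [comps, dir, Sum.elim_inl, Sum.elim_inr, Finset.univ_unique, Finset.sum_singleton]
  have := horizontal_eq_sum W.2
  have e : W.1 • (eBase : Loc n) = W - (1, W.2) + eBase := by
    apply Prod.ext <;> simp [eBase]
  rw [e, this]
  abel

/-- The full matrix of second derivatives `N_{a b̄}`. -/
def fullMetric (N : Loc n → ℝ) (W : Loc n) : Matrix (Unit ⊕ Fin n) (Unit ⊕ Fin n) ℂ :=
  Matrix.of fun i j => levi N W (dir i) (dir j)

theorem IsHom.fullMetric_mulVec (hN : IsHom N) (hW : W ≠ 0) :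
    (fullMetric N W).mulVec (star (comps W)) = fun i => dW (dir i) (fun y => (N y : ℂ)) W := by
  funext i
  rw [← hN.levi_self_right hW]
  conv_rhs => arg 4; rw [sum_comps W]
  rw [levi_sum_right isOpen_ne_zero hW hN.smooth]
  simp only [Matrix.mulVec, dotProduct]
  refine Finset.sum_congr rfl fun j _ => ?_
  rw [levi_smul_right isOpen_ne_zero hW hN.smooth, mul_comm]
  rfl

theorem IsHom.fullMetric_contDiffOn (hN : IsHom N) (i j : Unit ⊕ Fin n) :
    ContDiffOn ℝ ∞ (fun W => fullMetric N W i j) {0}ᶜ :=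
  levi_contDiffOn isOpen_ne_zero hN.smooth _ _

/-- The vector field whose divergence is the variation of `F(N) det N_{a b̄}` in the direction
`M`. -/
def variationField (F : ℝ → ℝ) (N M : Loc n → ℝ) (a : Unit ⊕ Fin n) (W : Loc n) : ℂ :=
  (F (N W) : ℂ) * ∑ b, (fullMetric N W).adjugate b a * dWbar (dir b) (fun y => (M y : ℂ)) W

theorem variationField_contDiffOn {F : ℝ → ℝ} (hF : ContDiff ℝ ∞ F) (hN : IsHom N) (hM : IsHom M)
    (a : Unit ⊕ Fin n) : ContDiffOn ℝ ∞ (variationField F N M a) {0}ᶜ := by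
  refine (contDiffOn_ofReal (hF.comp_contDiffOn hN.smooth)).mul (ContDiffOn.sum fun b _ => ?_)
  refine (contDiffOn_adjugate hN.fullMetric_contDiffOn b a).mul ?_
  rw [dWbar_eq_wirt]
  exact wirt_contDiffOn isOpen_ne_zero (contDiffOn_ofReal hM.smooth)

/-- The variation of `F(N) det N_{a b̄}` is a divergence: by Piola's identity the derivative falls
on `F(N)` or on `∂̄M`, and by Euler's identities the first contribution is `F'(N) M det N_{a b̄}`. -/
theorem divergence_variationField {F : ℝ → ℝ} (hF : ContDiff ℝ ∞ F) (hN : IsHom N) (hM : IsHom M)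
    (hW : W ≠ 0) :
    ∑ a, dW (dir a) (variationField F N M a) W
      = ((deriv F (N W) : ℝ) : ℂ) * M W * (fullMetric N W).det
        + F (N W) * ∑ i, ∑ j, (fullMetric N W).adjugate i j * fullMetric M W j i := by
  have hO : IsOpen ({0}ᶜ : Set (Loc n)) := isOpen_ne_zero
  have hNc := contDiffOn_ofReal hN.smooth
  have hMc := contDiffOn_ofReal hM.smooth
  have dF : DifferentiableAt ℝ (fun y => (F (N y) : ℂ)) W :=
    (contDiffOn_ofReal (hF.comp_contDiffOn hN.smooth)).differentiableAt_of_isOpen hO hW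
  have dA := fun b a =>
    (contDiffOn_adjugate hN.fullMetric_contDiffOn b a).differentiableAt_of_isOpen hO hW
  have dM : ∀ b : Unit ⊕ Fin n, DifferentiableAt ℝ (wirt Complex.I (dir b) fun y => (M y : ℂ)) W :=
    fun b => (wirt_contDiffOn hO hMc).differentiableAt_of_isOpen hO hW
  have hFd : ∀ a, wirt (-Complex.I) (dir a) (fun y => (F (N y) : ℂ)) W
      = deriv F (N W) * dW (dir a) (fun y => (N y : ℂ)) W := by
    intro a
    have hd : HasFDerivAt (fun y => F (N y)) (deriv F (N W) • fderiv ℝ N W) W :=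
      ((hF.differentiable (by norm_num)) (N W)).hasDerivAt.comp_hasFDerivAt W
        (hN.smooth.differentiableAt_of_isOpen hO hW).hasFDerivAt
    have hd1 := (Complex.ofRealCLM.hasFDerivAt.comp W hd).fderiv
    have hd2 := (Complex.ofRealCLM.hasFDerivAt.comp W
      (hN.smooth.differentiableAt_of_isOpen hO hW).hasFDerivAt).fderiv
    simp only [Function.comp_def, Complex.ofRealCLM_apply] at hd1 hd2
    rw [dW_eq_wirt, wirt, wirt, hd1, hd2]
    simp
    ring
  have hP : ∀ b, ∑ a, wirt (-Complex.I) (dir a) (fun y => (fullMetric N y).adjugate b a) W = 0 :=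
    sum_wirt_adjugate hO hW hN.fullMetric_contDiffOn fun a i j => by
      simp only [fullMetric, Matrix.of_apply, levi_eq_wirt]
      exact wirt_comm hO (wirt_contDiffOn hO hNc) hW _ _ _ _
  have hE : ∀ b, ∑ a, (fullMetric N W).adjugate b a * dW (dir a) (fun y => (N y : ℂ)) W
      = (fullMetric N W).det * star (comps W b) := by
    intro b
    have h1 := congrArg ((fullMetric N W).adjugate.mulVec) (hN.fullMetric_mulVec hW)
    rw [Matrix.mulVec_mulVec, Matrix.adjugate_mul, Matrix.smul_mulVec, Matrix.one_mulVec] at h1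
    exact (congrFun h1 b).symm
  have hE2 : ∑ b, star (comps W b) * dWbar (dir b) (fun y => (M y : ℂ)) W = M W := by
    rw [← hM.dWbar_self hW]
    conv_rhs => arg 1; rw [sum_comps W]
    rw [dWbar_eq_wirt, wirt_sum_dir]
    refine Finset.sum_congr rfl fun b _ => ?_
    rw [← dWbar_eq_wirt, dWbar_smul, dWbar_eq_wirt]
  have e1 : ∀ a, dW (dir a) (variationField F N M a) W
      = deriv F (N W) * ∑ b, (fullMetric N W).adjugate b a * dW (dir a) (fun y => (N y : ℂ)) W
          * dWbar (dir b) (fun y => (M y : ℂ)) W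
        + F (N W) * ∑ b, (wirt (-Complex.I) (dir a) (fun y => (fullMetric N y).adjugate b a) W
          * dWbar (dir b) (fun y => (M y : ℂ)) W
        + (fullMetric N W).adjugate b a * fullMetric M W a b) := by
    intro a
    have h : variationField F N M a = fun y => (F (N y) : ℂ) *
        ∑ b, (fullMetric N y).adjugate b a * wirt Complex.I (dir b) (fun y => (M y : ℂ)) y := by
      funext y
      simp only [variationField, dWbar_eq_wirt]
    rw [h, dW_eq_wirt, wirt_mul dF (DifferentiableAt.fun_sum fun b _ => (dA b a).fun_mul (dM b)), hFd,
      wirt_sum fun b _ => (dA b a).fun_mul (dM b)]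
    congr 1
    · rw [Finset.mul_sum, Finset.mul_sum]
      refine Finset.sum_congr rfl fun b _ => ?_
      rw [dWbar_eq_wirt, dW_eq_wirt]
      ring
    · congr 1
      refine Finset.sum_congr rfl fun b _ => ?_
      rw [wirt_mul (dA b a) (dM b), dWbar_eq_wirt]
      simp only [fullMetric, Matrix.of_apply, levi_eq_wirt]
  simp only [e1, Finset.sum_add_distrib, ← Finset.mul_sum]
  have s1 : ∑ a, ∑ b, (fullMetric N W).adjugate b a * dW (dir a) (fun y => (N y : ℂ)) W
          * dWbar (dir b) (fun y => (M y : ℂ)) W = (fullMetric N W).det * M W := by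
    rw [Finset.sum_comm]
    simp only [← Finset.sum_mul, hE]
    rw [← hE2, Finset.mul_sum]
    exact Finset.sum_congr rfl fun b _ => mul_assoc _ _ _
  have s2 : ∑ a, ∑ b, wirt (-Complex.I) (dir a) (fun y => (fullMetric N y).adjugate b a) W
          * dWbar (dir b) (fun y => (M y : ℂ)) W = 0 := by
    rw [Finset.sum_comm]
    simp only [← Finset.sum_mul, hP, zero_mul, Finset.sum_const_zero]
  rw [s1, s2, zero_add, Finset.sum_comm (f := fun a b => (fullMetric N W).adjugate b a *
    fullMetric M W a b)]
  ring

end Homogeneous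

/-! ### Invariance of the Monge-Ampère energy -/

section Energy

variable {n : ℕ}

instance : (volume : Measure (Loc n)).IsAddHaarMeasure :=
  Measure.prod.instIsAddHaarMeasure (volume : Measure ℂ) (volume : Measure (Fin n → ℂ))

theorem integral_fderiv_of_hasCompactSupport {X : Loc n → ℂ} (hX : ContDiff ℝ 1 X)
    (hc : HasCompactSupport X) (ξ : Loc n) :
    Integrable (fun W => fderiv ℝ X W ξ) ∧ ∫ W, fderiv ℝ X W ξ = 0 := by
  have hint : Integrable (fun W => fderiv ℝ X W ξ) :=
    ((hX.continuous_fderiv (by norm_num)).clm_apply continuous_const).integrable_of_hasCompactSupport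
      (HasCompactSupport.fderiv_apply (𝕜 := ℝ) hc ξ)
  refine ⟨hint, ?_⟩
  have h := integral_bilinear_hasFDerivAt_right_eq_neg_left_of_integrable
    (μ := (volume : Measure (Loc n)))
    (f := fun _ : Loc n => (1 : ℂ)) (f' := fun _ => 0) (g := X) (g' := fderiv ℝ X) (v := ξ)
    (B := ContinuousLinearMap.mul ℝ ℂ) (by simp) (by simpa using hint)
    (by simpa using hX.continuous.integrable_of_hasCompactSupport hc)
    (fun x _ => hasFDerivAt_const _ _)
    (fun x _ => (hX.differentiable (by norm_num) x).hasFDerivAt)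
  simpa using h

theorem integral_dW_of_hasCompactSupport {X : Loc n → ℂ} (hX : ContDiff ℝ 1 X)
    (hc : HasCompactSupport X) (ξ : Loc n) :
    Integrable (dW ξ X) ∧ ∫ W, dW ξ X W = 0 := by
  have h1 := integral_fderiv_of_hasCompactSupport hX hc ξ
  have h2 := integral_fderiv_of_hasCompactSupport hX hc (Complex.I • ξ)
  refine ⟨(h1.1.sub (h2.1.const_mul Complex.I)).div_const 2, ?_⟩
  simp only [dW]
  rw [integral_div, integral_sub h1.1 (h2.1.const_mul _), integral_const_mul, h1.2, h2.2]
  simp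

/-- A smooth bump function on the real line with support `[1, 2]`; composed with a squared norm
function `N` it is compactly supported away from the origin of `ℂ^{n+1}`. -/
def cutoff : ContDiffBump (3 / 2 : ℝ) := ⟨1 / 4, 1 / 2, by norm_num, by norm_num⟩

theorem cutoff_contDiff : ContDiff ℝ ∞ cutoff := cutoff.contDiff

theorem cutoff_eq_zero {x : ℝ} (hx : x ∉ Icc (1:ℝ) 2) : cutoff x = 0 ∧ deriv cutoff x = 0 := by
  have ht : tsupport cutoff = Icc (1:ℝ) 2 := by
    rw [cutoff.tsupport_eq, Real.closedBall_eq_Icc]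
    norm_num [cutoff]
  rw [← ht] at hx
  constructor
  · exact image_eq_zero_of_notMem_tsupport hx
  · by_contra h
    exact hx (support_deriv_subset h)

variable {N N₀ N₁ : Loc n → ℝ}

theorem IsHom.map_zero (hN : IsHom N) : N 0 = 0 := by
  simpa using hN.hom 0 0

theorem IsHom.eq_norm_sq_mul (hN : IsHom N) {W : Loc n} (hW : W ≠ 0) :
    ∃ W' ∈ Metric.sphere (0 : Loc n) 1, N W = ‖W‖ ^ 2 * N W' := by
  have hn : ‖W‖ ≠ 0 := norm_ne_zero_iff.2 hW
  refine ⟨((‖W‖⁻¹ : ℝ) : ℂ) • W, ?_, ?_⟩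
  · rw [mem_sphere_zero_iff_norm, norm_smul, Complex.norm_real, norm_inv, norm_norm,
      inv_mul_cancel₀ hn]
  · rw [hN.hom, Complex.norm_real, norm_inv, norm_norm]
    field_simp

theorem IsHom.exists_bounds (hN : IsHom N) (hpos : ∀ W ≠ 0, 0 < N W) :
    ∃ c > 0, ∃ C > 0, ∀ W, c * ‖W‖ ^ 2 ≤ N W ∧ N W ≤ C * ‖W‖ ^ 2 := by
  have hs : IsCompact (Metric.sphere (0 : Loc n) 1) := isCompact_sphere _ _
  have hne : (Metric.sphere (0 : Loc n) 1).Nonempty := NormedSpace.sphere_nonempty.2 zero_le_one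
  have h0 : ∀ W ∈ Metric.sphere (0 : Loc n) 1, W ≠ 0 := fun W hW h => by
    rw [h, mem_sphere_zero_iff_norm, norm_zero] at hW
    exact zero_ne_one hW
  have hc : ContinuousOn N (Metric.sphere (0 : Loc n) 1) :=
    hN.smooth.continuousOn.mono fun W hW => h0 W hW
  obtain ⟨W₁, hW₁, hmin⟩ := hs.exists_isMinOn hne hc
  obtain ⟨W₂, hW₂, hmax⟩ := hs.exists_isMaxOn hne hc
  refine ⟨N W₁, hpos _ (h0 _ hW₁), N W₂, hpos _ (h0 _ hW₂), fun W => ?_⟩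
  by_cases hW : W = 0
  · simp [hW, hN.map_zero]
  · obtain ⟨W', hW', e⟩ := hN.eq_norm_sq_mul hW
    rw [e, mul_comm _ (N W')]
    exact ⟨mul_le_mul_of_nonneg_right (hmin hW') (sq_nonneg _),
      mul_le_mul_of_nonneg_right (hmax hW') (sq_nonneg _)⟩

theorem fullMetric_lin (h₀ : IsHom N₀) (h₁ : IsHom N₁) (a b : ℝ) {W : Loc n} (hW : W ≠ 0) :
    fullMetric (fun W => a * N₀ W + b * N₁ W) W
      = (a : ℂ) • fullMetric N₀ W + (b : ℂ) • fullMetric N₁ W := by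
  ext i j
  simp only [fullMetric, Matrix.of_apply, Matrix.add_apply, Matrix.smul_apply, smul_eq_mul]
  rw [levi_add isOpen_ne_zero hW (contDiffOn_const.mul h₀.smooth) (contDiffOn_const.mul h₁.smooth),
    levi_const_mul isOpen_ne_zero hW h₀.smooth, levi_const_mul isOpen_ne_zero hW h₁.smooth]

/-- The density `χ(N) det N_{a b̄}`. -/
def energyDensity (N : Loc n → ℝ) (W : Loc n) : ℂ := (cutoff (N W) : ℂ) * (fullMetric N W).det

/-- The variation of the energy density at `N` in the direction `M`. -/
def energyVariation (N M : Loc n → ℝ) (W : Loc n) : ℂ :=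
  ((deriv cutoff (N W) : ℝ) : ℂ) * M W * (fullMetric N W).det
    + cutoff (N W) * ∑ i, ∑ j, (fullMetric N W).adjugate i j * fullMetric M W j i

theorem isCompact_annulus (c C : ℝ) :
    IsCompact {W : Loc n | c ≤ ‖W‖ ^ 2 ∧ ‖W‖ ^ 2 ≤ C} := by
  refine Metric.isCompact_of_isClosed_isBounded ?_ ?_
  · exact (isClosed_le continuous_const (continuous_norm.pow 2)).inter
      (isClosed_le (continuous_norm.pow 2) continuous_const)
  · refine (Metric.isBounded_closedBall (x := (0 : Loc n)) (r := √C)).subset fun W hW => ?_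
    rw [mem_closedBall_zero_iff]
    exact Real.le_sqrt_of_sq_le hW.2

/-- The variation of the energy vanishes, being the integral of the divergence of a compactly supported
field. -/
theorem integral_energyVariation {M : Loc n → ℝ} (hN : IsHom N) (hM : IsHom M)
    (hpos : ∀ W ≠ 0, 0 < N W) : ∫ W, energyVariation N M W = 0 := by
  obtain ⟨c, hc, C, hC, hb⟩ := hN.exists_bounds hpos
  set A : Set (Loc n) := {W | 1 / C ≤ ‖W‖ ^ 2 ∧ ‖W‖ ^ 2 ≤ 2 / c} with hA
  have hAc : IsCompact A := isCompact_annulus _ _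
  have h0A : (0 : Loc n) ∈ Aᶜ := by
    intro h
    have h1 := h.1
    rw [norm_zero, zero_pow two_ne_zero] at h1
    exact absurd h1 (not_le.2 (by positivity))
  have hXz : ∀ a, ∀ W ∈ Aᶜ, variationField cutoff N M a W = 0 := by
    intro a W hW
    have : N W ∉ Icc (1:ℝ) 2 := by
      intro h
      refine hW ⟨?_, ?_⟩
      · rw [div_le_iff₀ hC, mul_comm]; exact h.1.trans (hb W).2
      · rw [le_div_iff₀ hc, mul_comm]; exact (hb W).1.trans h.2
    rw [variationField, (cutoff_eq_zero this).1]
    simp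
  have hX : ∀ a, ContDiff ℝ 1 (variationField cutoff N M a) := by
    intro a
    rw [contDiff_iff_contDiffAt]
    intro W
    by_cases hW : W = 0
    · rw [hW]
      refine (contDiffAt_const (c := (0:ℂ))).congr_of_eventuallyEq ?_
      exact Filter.eventuallyEq_of_mem (hAc.isClosed.isOpen_compl.mem_nhds h0A) (hXz a)
    · exact ((variationField_contDiffOn cutoff_contDiff hN hM a).contDiffAt
        (isOpen_ne_zero.mem_nhds hW)).of_le (by norm_num)
  have hXc : ∀ a, HasCompactSupport (variationField cutoff N M a) := fun a =>
    HasCompactSupport.intro hAc (hXz a)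
  have hI := fun a => integral_dW_of_hasCompactSupport (hX a) (hXc a) (dir a)
  have hae : ∀ᵐ W : Loc n, W ≠ 0 := compl_mem_ae_iff.2 (measure_singleton 0)
  rw [integral_congr_ae (f := energyVariation N M)
    (g := fun W => ∑ a, dW (dir a) (variationField cutoff N M a) W)
    (hae.mono fun W hW => (divergence_variationField cutoff_contDiff hN hM hW).symm),
    integral_finsetSum _ fun a _ => (hI a).1]
  exact Finset.sum_eq_zero fun a _ => (hI a).2

theorem hasDerivAt_energyDensity (h₀ : IsHom N₀) (h₁ : IsHom N₁) {W : Loc n} (hW : W ≠ 0) (τ : ℝ) :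
    HasDerivAt (fun τ => energyDensity (fun W => (1 - τ) * N₀ W + τ * N₁ W) W)
      (energyVariation (fun W => (1 - τ) * N₀ W + τ * N₁ W)
        (fun W => (-1) * N₀ W + 1 * N₁ W) W) τ := by
  have hH : ∀ σ : ℝ, fullMetric (fun W => (1 - σ) * N₀ W + σ * N₁ W) W
      = ((1 - σ : ℝ) : ℂ) • fullMetric N₀ W + (σ : ℂ) • fullMetric N₁ W := fun σ =>
    fullMetric_lin h₀ h₁ _ _ hW
  have hent : ∀ i j, HasDerivAt
      (fun σ : ℝ => fullMetric (fun W => (1 - σ) * N₀ W + σ * N₁ W) W i j)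
      (fullMetric (fun W => (-1) * N₀ W + 1 * N₁ W) W i j) τ := by
    intro i j
    simp only [hH, fullMetric_lin h₀ h₁ _ _ hW, Matrix.add_apply, Matrix.smul_apply, smul_eq_mul]
    have h1 := (((hasDerivAt_id τ).const_sub 1).ofReal_comp).mul_const (fullMetric N₀ W i j)
    have h2 := ((hasDerivAt_id τ).ofReal_comp).mul_const (fullMetric N₁ W i j)
    exact h1.add h2
  have hdet : HasDerivAt (fun σ : ℝ => (fullMetric (fun W => (1 - σ) * N₀ W + σ * N₁ W) W).det)
      (∑ i, ∑ j, (fullMetric (fun W => (1 - τ) * N₀ W + τ * N₁ W) W).adjugate i j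
        * fullMetric (fun W => (-1) * N₀ W + 1 * N₁ W) W j i) τ := by
    have h1 := (differentiableAt_det (G := fun σ : ℝ =>
      fullMetric (fun W => (1 - σ) * N₀ W + σ * N₁ W) W)
      fun i j => (hent i j).differentiableAt).hasDerivAt
    refine h1.congr_deriv ?_
    rw [← fderiv_apply_one_eq_deriv, fderiv_det fun i j => (hent i j).differentiableAt]
    simp only [fderiv_apply_one_eq_deriv]
    exact Finset.sum_congr rfl fun i _ => Finset.sum_congr rfl fun j _ => by rw [(hent j i).deriv]
  have hn : HasDerivAt (fun σ : ℝ => (1 - σ) * N₀ W + σ * N₁ W) ((-1) * N₀ W + 1 * N₁ W) τ :=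
    (((hasDerivAt_id τ).const_sub 1).mul_const _).add ((hasDerivAt_id τ).mul_const _)
  have hc : HasDerivAt (fun σ : ℝ => ((cutoff ((1 - σ) * N₀ W + σ * N₁ W) : ℝ) : ℂ))
      ((deriv cutoff ((1 - τ) * N₀ W + τ * N₁ W) * ((-1) * N₀ W + 1 * N₁ W) : ℝ) : ℂ) τ :=
    (HasDerivAt.comp τ ((cutoff_contDiff.differentiable (by norm_num)) _).hasDerivAt hn).ofReal_comp
  refine (hc.fun_mul hdet).congr_deriv ?_
  simp only [energyVariation]
  push_cast
  ring

theorem exists_compact_energy_support (h₀ : IsHom N₀) (h₁ : IsHom N₁) (hp₀ : ∀ W ≠ 0, 0 < N₀ W)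
    (hp₁ : ∀ W ≠ 0, 0 < N₁ W) :
    ∃ A : Set (Loc n), IsCompact A ∧ 0 ∉ A ∧ ∀ τ ∈ Icc (0:ℝ) 1, ∀ W ∉ A,
      (1 - τ) * N₀ W + τ * N₁ W ∉ Icc (1:ℝ) 2 := by
  obtain ⟨c₀, hc₀, C₀, hC₀, hb₀⟩ := h₀.exists_bounds hp₀
  obtain ⟨c₁, hc₁, C₁, hC₁, hb₁⟩ := h₁.exists_bounds hp₁
  refine ⟨{W | 1 / (C₀ + C₁) ≤ ‖W‖ ^ 2 ∧ ‖W‖ ^ 2 ≤ 2 / min c₀ c₁}, isCompact_annulus _ _, ?_, ?_⟩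
  · intro h
    have h1 := h.1
    rw [norm_zero, zero_pow two_ne_zero] at h1
    exact absurd h1 (not_le.2 (by positivity))
  · intro τ hτ W hW h
    have hm : 0 < min c₀ c₁ := lt_min hc₀ hc₁
    have hw := sq_nonneg ‖W‖
    have hτ' : 0 ≤ 1 - τ := by linarith [hτ.2]
    refine hW ⟨?_, ?_⟩
    · rw [div_le_iff₀ (by positivity)]
      have e1 := mul_le_mul_of_nonneg_left (hb₀ W).2 hτ'
      have e2 := mul_le_mul_of_nonneg_left (hb₁ W).2 hτ.1
      have e3 : (1 - τ) * (C₀ * ‖W‖ ^ 2) ≤ C₀ * ‖W‖ ^ 2 :=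
        mul_le_of_le_one_left (by positivity) (by linarith [hτ.1])
      have e4 : τ * (C₁ * ‖W‖ ^ 2) ≤ C₁ * ‖W‖ ^ 2 := mul_le_of_le_one_left (by positivity) hτ.2
      linarith [h.1]
    · rw [le_div_iff₀ hm]
      have e0 := mul_le_mul_of_nonneg_right (min_le_left c₀ c₁) hw
      have e0' := mul_le_mul_of_nonneg_right (min_le_right c₀ c₁) hw
      have e1 := mul_le_mul_of_nonneg_left (e0.trans (hb₀ W).1) hτ'
      have e2 := mul_le_mul_of_nonneg_left (e0'.trans (hb₁ W).1) hτ.1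
      linarith [h.2]

theorem integrable_energyDensity (hN : IsHom N) (hp : ∀ W ≠ 0, 0 < N W) :
    Integrable (energyDensity N) := by
  obtain ⟨A, hA, h0, hz⟩ := exists_compact_energy_support hN hN hp hp
  have hsupp : ∀ W ∉ A, energyDensity N W = 0 := by
    intro W hW
    have := hz 0 (by simp) W hW
    simp only [sub_zero, one_mul, zero_mul, add_zero] at this
    rw [energyDensity, (cutoff_eq_zero this).1]
    simp
  refine (integrableOn_iff_integrable_of_support_subset (s := A) fun W hW => ?_).1 ?_
  · by_contra h
    exact hW (hsupp W h)
  · refine ContinuousOn.integrableOn_compact hA (ContDiffOn.continuousOn (𝕜 := ℝ) (n := ∞) ?_)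
    refine ContDiffOn.mono ?_ (show A ⊆ {0}ᶜ from fun W hW h => h0 (h ▸ hW))
    exact (contDiffOn_ofReal (cutoff_contDiff.comp_contDiffOn hN.smooth)).mul
      (contDiffOn_det hN.fullMetric_contDiffOn)

theorem continuousOn_energyVariation (h₀ : IsHom N₀) (h₁ : IsHom N₁) :
    ContinuousOn (fun q : Loc n × ℝ => energyVariation (fun W => (1 - q.2) * N₀ W + q.2 * N₁ W)
      (fun W => (-1) * N₀ W + 1 * N₁ W) q.1) ({0}ᶜ ×ˢ univ) := by
  refine ContDiffOn.continuousOn (𝕜 := ℝ) (n := ∞) ?_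
  have hfst : ∀ {E : Type} [NormedAddCommGroup E] [NormedSpace ℝ E] {f : Loc n → E},
      ContDiffOn ℝ ∞ f {0}ᶜ → ContDiffOn ℝ ∞ (fun q : Loc n × ℝ => f q.1) ({0}ᶜ ×ˢ univ) :=
    fun hf => hf.comp contDiff_fst.contDiffOn fun q hq => hq.1
  have hsnd : ContDiffOn ℝ ∞ (fun q : Loc n × ℝ => q.2) ({0}ᶜ ×ˢ univ) := contDiff_snd.contDiffOn
  have hN : ContDiffOn ℝ ∞ (fun q : Loc n × ℝ => (1 - q.2) * N₀ q.1 + q.2 * N₁ q.1) ({0}ᶜ ×ˢ univ) :=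
    ((contDiffOn_const.sub hsnd).mul (hfst h₀.smooth)).add (hsnd.mul (hfst h₁.smooth))
  have hM := hfst ((h₀.lin h₁ (-1) 1).smooth)
  have hHM := fun i j => hfst ((h₀.lin h₁ (-1) 1).fullMetric_contDiffOn i j)
  have hH : ∀ i j, ContDiffOn ℝ ∞ (fun q : Loc n × ℝ =>
      fullMetric (fun W => (1 - q.2) * N₀ W + q.2 * N₁ W) q.1 i j) ({0}ᶜ ×ˢ univ) := by
    intro i j
    refine ContDiffOn.congr (f := fun q : Loc n × ℝ => ((1 - q.2 : ℝ) : ℂ) * fullMetric N₀ q.1 i j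
      + ((q.2 : ℝ) : ℂ) * fullMetric N₁ q.1 i j) ?_ fun q hq => ?_
    · exact ((contDiffOn_ofReal (contDiffOn_const.sub hsnd)).mul
        (hfst (h₀.fullMetric_contDiffOn i j))).add
        ((contDiffOn_ofReal hsnd).mul (hfst (h₁.fullMetric_contDiffOn i j)))
    · rw [fullMetric_lin h₀ h₁ _ _ hq.1]
      rfl
  have hd : ContDiff ℝ ∞ (deriv cutoff) := (contDiff_infty_iff_deriv.1 cutoff_contDiff).2
  refine ((((contDiffOn_ofReal (hd.comp_contDiffOn hN)).mul (contDiffOn_ofReal hM)).mul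
    (contDiffOn_det hH)).add ((contDiffOn_ofReal (cutoff_contDiff.comp_contDiffOn hN)).mul ?_))
  exact ContDiffOn.sum fun i _ => ContDiffOn.sum fun j _ =>
    (contDiffOn_adjugate hH i j).mul (hHM j i)

/-- The energy is the same for all metrics: it is constant along the segment joining two of them. -/
theorem integral_energyDensity_eq (h₀ : IsHom N₀) (h₁ : IsHom N₁) (hp₀ : ∀ W ≠ 0, 0 < N₀ W)
    (hp₁ : ∀ W ≠ 0, 0 < N₁ W) :
    ∫ W, energyDensity N₀ W = ∫ W, energyDensity N₁ W := by
  obtain ⟨A, hA, h0, hz⟩ := exists_compact_energy_support h₀ h₁ hp₀ hp₁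
  set g : Loc n → ℝ → ℂ := fun W τ => energyVariation (fun W => (1 - τ) * N₀ W + τ * N₁ W)
      (fun W => (-1) * N₀ W + 1 * N₁ W) W with hg
  have hcont := continuousOn_energyVariation h₀ h₁
  have hgz : ∀ τ ∈ Icc (0:ℝ) 1, ∀ W ∉ A, g W τ = 0 := by
    intro τ hτ W hW
    have := cutoff_eq_zero (hz τ hτ W hW)
    simp only [hg, energyVariation, this.1, this.2]
    simp
  have hint : Integrable (Function.uncurry g)
      ((volume : Measure (Loc n)).prod (volume.restrict (Ioc (0:ℝ) 1))) := by
    have h1 : IntegrableOn (Function.uncurry g) (A ×ˢ Icc (0:ℝ) 1)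
        ((volume : Measure (Loc n)).prod volume) :=
      ContinuousOn.integrableOn_compact (hA.prod isCompact_Icc)
        (hcont.mono (prod_mono (fun W hW h => h0 (h ▸ hW)) (subset_univ _)))
    have h2 : IntegrableOn (Function.uncurry g) (univ ×ˢ Ioc (0:ℝ) 1)
        ((volume : Measure (Loc n)).prod volume) :=
      h1.of_forall_sdiff_eq_zero (MeasurableSet.univ.prod measurableSet_Ioc) fun q hq =>
        hgz q.2 (Ioc_subset_Icc_self hq.1.2) q.1
          fun h => hq.2 ⟨h, Ioc_subset_Icc_self hq.1.2⟩
    rw [IntegrableOn, ← Measure.prod_restrict, Measure.restrict_univ] at h2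
    exact h2
  have hftc : ∀ W ≠ 0, energyDensity N₁ W - energyDensity N₀ W = ∫ τ in Ioc (0:ℝ) 1, g W τ := by
    intro W hW
    have hc : Continuous (g W) := by
      rw [← continuousOn_univ]
      exact hcont.comp (f := fun τ : ℝ => (W, τ)) (by fun_prop) fun τ _ => ⟨hW, mem_univ _⟩
    have := intervalIntegral.integral_eq_sub_of_hasDerivAt (a := 0) (b := 1)
      (fun τ _ => hasDerivAt_energyDensity h₀ h₁ hW τ) (hc.intervalIntegrable _ _)
    rw [intervalIntegral.integral_of_le zero_le_one] at this
    rw [this]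
    simp
  have hae : ∀ᵐ W : Loc n, W ≠ 0 := compl_mem_ae_iff.2 (measure_singleton 0)
  have hswap := integral_integral_swap hint
  have hzero : ∫ τ in Ioc (0:ℝ) 1, ∫ W, g W τ = 0 := by
    rw [setIntegral_congr_fun (g := fun _ => (0:ℂ)) measurableSet_Ioc fun τ hτ => ?_]
    · simp
    · have hτ' : 0 < τ := hτ.1
      have hτ'' : 0 ≤ 1 - τ := by linarith [hτ.2]
      refine integral_energyVariation (h₀.lin h₁ _ _) (h₀.lin h₁ _ _) fun W hW => ?_
      exact add_pos_of_nonneg_of_pos (mul_nonneg hτ'' (hp₀ W hW).le) (mul_pos hτ' (hp₁ W hW))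
  rw [hzero, ← integral_congr_ae (hae.mono hftc), integral_sub (integrable_energyDensity h₁ hp₁)
    (integrable_energyDensity h₀ hp₀)] at hswap
  exact (sub_eq_zero.1 hswap).symm

end Energy

/-! ### The volume of the fibers -/

section Volume

variable {n : ℕ} {N N₀ N₁ : Loc n → ℝ}

theorem levi_log {V : Type*} [NormedAddCommGroup V] [NormedSpace ℝ V] [Module ℂ V]
    {U : Set V} {f : V → ℝ} {x : V} (hU : IsOpen U) (hf : ContDiffOn ℝ ∞ f U)
    (hpos : ∀ y ∈ U, 0 < f y) (hx : x ∈ U) (ξ η : V) :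
    levi (fun y => Real.log (f y)) x ξ η = levi f x ξ η * (f x : ℂ)⁻¹
      - dW ξ (fun y => (f y : ℂ)) x * dWbar η (fun y => (f y : ℂ)) x * ((f x : ℂ)⁻¹ * (f x : ℂ)⁻¹) := by
  have hfc := contDiffOn_ofReal hf
  have h0 : ∀ y ∈ U, (f y : ℂ) ≠ 0 := fun y hy => Complex.ofReal_ne_zero.2 (hpos y hy).ne'
  have e1 : ∀ y ∈ U, wirt Complex.I η (fun y => ((Real.log (f y) : ℝ) : ℂ)) y
      = (f y : ℂ)⁻¹ * wirt Complex.I η (fun y => (f y : ℂ)) y := by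
    intro y hy
    rw [wirt_congr_on (g := fun y => Complex.log (f y : ℂ)) hU hy fun z hz => by
      rw [Complex.ofReal_log (hpos z hz).le]]
    exact wirt_comp_hasDerivAt (f := fun y => (f y : ℂ)) (Complex.hasDerivAt_log
      (Complex.ofReal_mem_slitPlane.2 (hpos y hy))) (hfc.differentiableAt_of_isOpen hU hy)
  rw [levi_eq_wirt, wirt_congr_on hU hx e1, wirt_mul
    (f := fun y => (f y : ℂ)⁻¹) ((hfc.inv h0).differentiableAt_of_isOpen hU hx)
    ((wirt_contDiffOn hU hfc).differentiableAt_of_isOpen hU hx),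
    wirt_comp_hasDerivAt (f := fun y => (f y : ℂ)) (hasDerivAt_inv (h0 x hx))
      (hfc.differentiableAt_of_isOpen hU hx), levi_eq_wirt, dW_eq_wirt, dWbar_eq_wirt]
  rw [pow_two, mul_inv]
  ring

/-- The local weight `log N(1, z)` of the metric with squared norm function `N`. -/
def affineLog (N : Loc n → ℝ) (p : Loc n) : ℝ := Real.log (N (1, p.2))

theorem levi_affine {f : Loc n → ℝ} (hf : ContDiffOn ℝ ∞ f {0}ᶜ) (p : Loc n) (α β : Fin n) :
    levi (fun q : Loc n => f (1, q.2)) p (eFib α) (eFib β)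
      = levi f (1, p.2) (eFib α) (eFib β) := by
  set L : Loc n →L[ℝ] Loc n :=
    (0 : Loc n →L[ℝ] ℂ).prod (ContinuousLinearMap.snd ℝ ℂ (Fin n → ℂ)) with hL
  have hA : ∀ y : Loc n, HasFDerivAt (fun q : Loc n => ((1, q.2) : Loc n)) L y := fun y =>
    (hasFDerivAt_const (1:ℂ) y).prodMk (ContinuousLinearMap.snd ℝ ℂ (Fin n → ℂ)).hasFDerivAt
  have he : ∀ α, L (eFib α) = eFib α := fun α => rfl
  have := levi_comp_affine (A := fun q : Loc n => ((1, q.2) : Loc n)) (L := L) isOpen_univ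
    isOpen_ne_zero (mem_univ p) hA
    (fun y _ h => one_ne_zero (congrArg Prod.fst (show ((1, y.2) : Loc n) = 0 from h)))
    (fun ξ => by simp [hL, Prod.smul_mk]) hf (eFib α) (eFib β)
  rw [he, he] at this
  exact this

theorem one_ne (z : Fin n → ℂ) : ((1, z) : Loc n) ≠ 0 := fun h =>
  one_ne_zero (congrArg Prod.fst h)

/-- In affine coordinates the determinant of the full matrix of second derivatives is that of the
fiber metric of the weight `log N`: by Euler's identities this is an elimination step and a Schur
complement. -/
theorem det_fullMetric (hN : IsHom N) (hp : ∀ W ≠ 0, 0 < N W) (p : Loc n) :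
    (fullMetric N (1, p.2)).det
      = (N (1, p.2) : ℂ) ^ (n + 1) * (fiberMetric (affineLog N) p).det := by
  set W : Loc n := (1, p.2) with hWdef
  have hW : W ≠ 0 := one_ne p.2
  set ν : ℂ := (N W : ℂ) with hν
  have hν0 : ν ≠ 0 := Complex.ofReal_ne_zero.2 (hp W hW).ne'
  set P : Matrix (Unit ⊕ Fin n) (Unit ⊕ Fin n) ℂ :=
    Matrix.fromBlocks 1 (Matrix.of fun _ α => p.2 α) 0 1 with hP
  set B : Matrix Unit (Fin n) ℂ := Matrix.of fun _ β => dWbar (eFib β) (fun y => (N y : ℂ)) W with hB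
  set C : Matrix (Fin n) Unit ℂ := Matrix.of fun α _ => dW (eFib α) (fun y => (N y : ℂ)) W with hC
  set D : Matrix (Fin n) (Fin n) ℂ := Matrix.of fun α β => levi N W (eFib α) (eFib β) with hD
  set ξ : Unit ⊕ Fin n → Loc n := Sum.elim (fun _ => W) eFib with hξ
  have hξP : ∀ i, ξ i = ∑ k, P i k • dir k := by
    rintro (i | α)
    · simp only [hξ, Sum.elim_inl]
      conv_lhs => rw [sum_comps W]
      rw [Fintype.sum_sum_type, Fintype.sum_sum_type]
      simp [comps, hP, hWdef]
    · rw [Fintype.sum_sum_type]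
      simp [hP, hξ, dir, Matrix.one_apply]
  have hPH : P * fullMetric N W * P.conjTranspose
      = Matrix.of fun i j => levi N W (ξ i) (ξ j) := by
    ext i j
    rw [Matrix.of_apply, hξP i, hξP j, levi_sum_right isOpen_ne_zero hW hN.smooth, Matrix.mul_apply]
    refine Finset.sum_congr rfl fun l _ => ?_
    rw [levi_smul_right isOpen_ne_zero hW hN.smooth, levi_sum_left, Matrix.mul_apply,
      Matrix.conjTranspose_apply, mul_comm]
    congr 1
    exact Finset.sum_congr rfl fun k _ => by rw [levi_smul_left]; rfl
  have hblock : (Matrix.of fun i j => levi N W (ξ i) (ξ j))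
      = Matrix.fromBlocks (Matrix.of fun _ _ => ν) B C D := by
    ext i j
    rcases i with i | α <;> rcases j with j | β
    · simp only [Matrix.of_apply, Matrix.fromBlocks_apply₁₁, hξ, Sum.elim_inl]
      rw [hN.levi_self_left hW, hN.dWbar_self hW]
    · simp only [Matrix.of_apply, Matrix.fromBlocks_apply₁₂, hξ, Sum.elim_inl, Sum.elim_inr, hB]
      rw [hN.levi_self_left hW]
    · simp only [Matrix.of_apply, Matrix.fromBlocks_apply₂₁, hξ, Sum.elim_inl, Sum.elim_inr, hC]
      rw [hN.levi_self_right hW]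
    · rfl
  have hfac : Matrix.fromBlocks (Matrix.of fun _ _ => ν) B C D
      = Matrix.fromBlocks (Matrix.of fun (_ _ : Unit) => ν) 0 0 1
        * Matrix.fromBlocks 1 (ν⁻¹ • B) C D := by
    rw [Matrix.fromBlocks_multiply]
    have h1 : (Matrix.of fun (_ _ : Unit) => ν) = ν • (1 : Matrix Unit Unit ℂ) := by
      ext i j; simp
    simp [h1, smul_smul, hν0]
  have hdetP : P.det = 1 := by
    rw [hP, Matrix.det_fromBlocks_zero₂₁, Matrix.det_one, Matrix.det_one, one_mul]
  have hSchur : D - C * (ν⁻¹ • B) = ν • fiberMetric (affineLog N) p := by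
    ext α β
    have h1 : fiberMetric (affineLog N) p α β = levi (fun y => Real.log (N y)) W (eFib α) (eFib β) :=
      levi_affine (hN.smooth.log fun y hy => (hp y hy).ne') p α β
    rw [Matrix.smul_apply, h1, levi_log isOpen_ne_zero hN.smooth hp hW]
    simp only [Matrix.sub_apply, Matrix.mul_apply, Matrix.smul_apply, Finset.univ_unique,
      Finset.sum_singleton, hB, hC, hD, Matrix.of_apply, smul_eq_mul]
    rw [← hν]
    field_simp
  have h := congrArg Matrix.det hPH
  rw [Matrix.det_mul, Matrix.det_mul, Matrix.det_conjTranspose, hdetP, star_one, one_mul, mul_one,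
    hblock, hfac, Matrix.det_mul, Matrix.det_fromBlocks_zero₂₁, Matrix.det_fromBlocks_one₁₁, hSchur,
    Matrix.det_smul, Matrix.det_one, Fintype.card_fin, mul_one,
    Matrix.det_unique (Matrix.of fun (_ _ : Unit) => ν), Matrix.of_apply] at h
  rw [h, pow_succ]
  ring

/-- The energy density in the polar coordinates `W = a • (1, z)`. -/
theorem energyDensity_smul (hN : IsHom N) (hp : ∀ W ≠ 0, 0 < N W) {a : ℂ} (ha : a ≠ 0)
    (z : Fin n → ℂ) :
    energyDensity N (a, a • z) = ((cutoff (‖a‖ ^ 2 * N (1, z)) * N (1, z) ^ (n + 1) : ℝ) : ℂ)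
      * (fiberMetric (affineLog N) (0, z)).det := by
  have e : ((a, a • z) : Loc n) = a • ((1, z) : Loc n) := by
    rw [Prod.smul_mk, smul_eq_mul, mul_one]
  have hH : fullMetric N (a • ((1, z) : Loc n)) = fullMetric N (1, z) := by
    ext i j
    exact hN.levi_hom (one_ne z) ha _ _
  rw [e, energyDensity, hN.hom, hH, det_fullMetric hN hp (0, z)]
  push_cast
  ring

/-- The density of the fiber volume in affine coordinates. -/
def volDensity (N : Loc n → ℝ) (z : Fin n → ℂ) : ℝ := (fiberMetric (affineLog N) (0, z)).det.re

theorem lintegral_comp_complex_smul {a : ℂ} (ha : a ≠ 0) (h : (Fin n → ℂ) → ENNReal) :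
    ∫⁻ y, h y = ENNReal.ofReal (‖a‖ ^ (2 * n)) * ∫⁻ z, h (a • z) := by
  set f : (Fin n → ℂ) →ₗ[ℂ] (Fin n → ℂ) := a • LinearMap.id with hf
  have hdet : LinearMap.det (f.restrictScalars ℝ) = ‖a‖ ^ (2 * n) := by
    have h1 : LinearMap.det (f.restrictScalars ℝ) = Algebra.norm ℝ (LinearMap.det f) :=
      LinearMap.det_restrictScalars
    rw [h1, hf, LinearMap.det_smul, LinearMap.det_id, mul_one, map_pow,
      Algebra.norm_complex_eq, pow_mul]
    simp [Complex.normSq_eq_norm_sq]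
  have hpos : 0 < ‖a‖ ^ (2 * n) := pow_pos (norm_pos_iff.2 ha) _
  have hmap := Measure.map_linearMap_addHaar_eq_smul_addHaar (volume : Measure (Fin n → ℂ))
    (f := f.restrictScalars ℝ) (by rw [hdet]; exact hpos.ne')
  have hemb : MeasurableEmbedding (fun z : Fin n → ℂ => a • z) :=
    (Homeomorph.smulOfNeZero a ha).measurableEmbedding
  have h2 := hemb.lintegral_map h (μ := volume)
  have h3 : (⇑(f.restrictScalars ℝ) : (Fin n → ℂ) → (Fin n → ℂ)) = fun z => a • z := rfl
  rw [h3, hdet] at hmap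
  rw [← h2, hmap, lintegral_smul_measure, smul_eq_mul, ← mul_assoc, ← ENNReal.ofReal_mul hpos.le,
    abs_of_pos (inv_pos.2 hpos), mul_inv_cancel₀ hpos.ne', ENNReal.ofReal_one, one_mul]

/-- The integral over a complex ray `ℂ • (1, z)` in the energy, normalized to `N (1, z) = 1`. -/
def radialMass (n : ℕ) : ENNReal :=
  ∫⁻ a : ℂ, ENNReal.ofReal (‖a‖ ^ (2 * n) * cutoff (‖a‖ ^ 2))

theorem radial_continuous (n : ℕ) :
    Continuous fun a : ℂ => ‖a‖ ^ (2 * n) * cutoff (‖a‖ ^ 2) :=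
  (continuous_norm.pow _).mul (cutoff_contDiff.continuous.comp (continuous_norm.pow 2))

theorem radialMass_ne_top (n : ℕ) : radialMass n ≠ ⊤ := by
  have hc : HasCompactSupport fun a : ℂ => ‖a‖ ^ (2 * n) * cutoff (‖a‖ ^ 2) := by
    refine HasCompactSupport.intro (isCompact_closedBall (0:ℂ) 2) fun a ha => ?_
    rw [mem_closedBall_zero_iff, not_le] at ha
    rw [(cutoff_eq_zero fun h => ?_).1, mul_zero]
    nlinarith [h.2]
  have hi := (radial_continuous n).integrable_of_hasCompactSupport (μ := volume) hc
  exact hi.lintegral_lt_top.ne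

theorem radialMass_ne_zero (n : ℕ) : radialMass n ≠ 0 := by
  have hm : Continuous fun a : ℂ => ENNReal.ofReal (‖a‖ ^ (2 * n) * cutoff (‖a‖ ^ 2)) :=
    ENNReal.continuous_ofReal.comp (radial_continuous n)
  refine ((lintegral_pos_iff_support hm.measurable).2 ?_).ne'
  refine hm.isOpen_support.measure_pos _ ⟨((√(3 / 2) : ℝ) : ℂ), ?_⟩
  have h1 : ‖((√(3 / 2) : ℝ) : ℂ)‖ = √(3 / 2) := by
    rw [Complex.norm_real, Real.norm_of_nonneg (Real.sqrt_nonneg _)]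
  have h2 : cutoff (3 / 2) = 1 := cutoff.one_of_mem_closedBall (Metric.mem_closedBall_self (by
    norm_num [cutoff]))
  rw [Function.mem_support, h1, Real.sq_sqrt (by norm_num), h2, mul_one]
  exact (ENNReal.ofReal_pos.2 (by positivity)).ne'

/-- The integral over a complex ray does not depend on the scale `ρ = N (1, z)`: the factor `ρ ^ (n + 1)`
of `det_fullMetric` compensates the substitution. -/
theorem lintegral_radial {ρ : ℝ} (hρ : 0 < ρ) :
    ∫⁻ a : ℂ, ENNReal.ofReal (‖a‖ ^ (2 * n) * (cutoff (‖a‖ ^ 2 * ρ) * ρ ^ (n + 1)))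
      = radialMass n := by
  have hr : √ρ ≠ 0 := (Real.sqrt_pos.2 hρ).ne'
  have hsq : √ρ ^ 2 = ρ := Real.sq_sqrt hρ.le
  have hmap := Measure.map_addHaar_smul (volume : Measure ℂ) hr
  have hemb : MeasurableEmbedding (fun z : ℂ => √ρ • z) :=
    (Homeomorph.smulOfNeZero (√ρ) hr).measurableEmbedding
  have h2 := hemb.lintegral_map (fun a : ℂ => ENNReal.ofReal (‖a‖ ^ (2 * n) * cutoff (‖a‖ ^ 2)))
    (μ := volume)
  rw [hmap, lintegral_smul_measure, smul_eq_mul, Complex.finrank_real_complex, hsq,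
    abs_of_pos (inv_pos.2 hρ)] at h2
  have e : ∀ a : ℂ, ENNReal.ofReal (‖a‖ ^ (2 * n) * (cutoff (‖a‖ ^ 2 * ρ) * ρ ^ (n + 1)))
      = ENNReal.ofReal ρ *
        ENNReal.ofReal (‖√ρ • a‖ ^ (2 * n) * cutoff (‖√ρ • a‖ ^ 2)) := by
    intro a
    rw [← ENNReal.ofReal_mul hρ.le, norm_smul, Real.norm_of_nonneg (Real.sqrt_nonneg _), mul_pow,
      mul_pow, pow_mul √ρ, hsq]
    congr 1
    rw [mul_comm ρ (‖a‖ ^ 2), pow_succ]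
    ring
  simp only [e]
  rw [lintegral_const_mul' _ _ ENNReal.ofReal_ne_top, ← h2, ← mul_assoc, ← ENNReal.ofReal_mul hρ.le,
    mul_inv_cancel₀ hρ.ne', ENNReal.ofReal_one, one_mul]
  rfl

theorem affine_contDiff (hN : IsHom N) : ContDiff ℝ ∞ (fun p : Loc n => N (1, p.2)) := by
  rw [← contDiffOn_univ]
  exact hN.smooth.comp (f := fun p : Loc n => ((1, p.2) : Loc n))
    (contDiff_const.prodMk contDiff_snd).contDiffOn fun p _ => one_ne p.2

theorem affineLog_contDiffOn (hN : IsHom N) (hp : ∀ W ≠ 0, 0 < N W) :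
    ContDiffOn ℝ ∞ (affineLog N) univ :=
  ((affine_contDiff hN).log fun p => (hp _ (one_ne p.2)).ne').contDiffOn

theorem volDensity_continuous (hN : IsHom N) (hp : ∀ W ≠ 0, 0 < N W) :
    Continuous (volDensity N) := by
  have h := (contDiffOn_det (G := fiberMetric (affineLog N)) fun i j =>
    fiberMetric_contDiffOn isOpen_univ (affineLog_contDiffOn hN hp) i j).continuousOn
  rw [continuousOn_univ] at h
  exact Complex.continuous_re.comp (h.comp (by fun_prop : Continuous fun z : Fin n → ℂ => ((0:ℂ), z)))

theorem volDensity_pos (hd : ∀ z, (fiberMetric (affineLog N) (0, z)).PosDef) (z : Fin n → ℂ) :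
    0 < volDensity N z ∧ (fiberMetric (affineLog N) (0, z)).det = (volDensity N z : ℂ) := by
  have := Complex.pos_iff.1 (hd z).det_pos
  exact ⟨this.1, Complex.ext rfl (by simp [← this.2])⟩

/-- Integration over the rays relates the energy to the volume of the fiber. -/
theorem lintegral_volDensity (hN : IsHom N) (hp : ∀ W ≠ 0, 0 < N W)
    (hd : ∀ z, (fiberMetric (affineLog N) (0, z)).PosDef) :
    ENNReal.ofReal (∫ W, energyDensity N W).re
      = (∫⁻ z, ENNReal.ofReal (volDensity N z)) * radialMass n := by
  have hi := integrable_energyDensity hN hp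
  have key : ∀ (a : ℂ), a ≠ 0 → ∀ z, (energyDensity N (a, a • z)).re
      = cutoff (‖a‖ ^ 2 * N (1, z)) * N (1, z) ^ (n + 1) * volDensity N z := by
    intro a ha z
    rw [energyDensity_smul hN hp ha, Complex.re_ofReal_mul]
    rfl
  have key0 : ∀ (a : ℂ), a ≠ 0 → ∀ y, 0 ≤ (energyDensity N (a, y)).re := by
    intro a ha y
    have := key a ha (a⁻¹ • y)
    rw [smul_inv_smul₀ ha] at this
    rw [this]
    exact mul_nonneg (mul_nonneg cutoff.nonneg (pow_nonneg (hp _ (one_ne _)).le _))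
      (volDensity_pos hd _).1.le
  have hae : ∀ᵐ a : ℂ, a ≠ 0 := compl_mem_ae_iff.2 (measure_singleton 0)
  have hnn : 0 ≤ᵐ[volume] fun W : Loc n => (energyDensity N W).re := by
    have : ∀ᵐ W : Loc n, W.1 ≠ 0 := by
      rw [Measure.volume_eq_prod]
      exact Measure.quasiMeasurePreserving_fst.ae hae
    filter_upwards [this] with W hW
    exact key0 W.1 hW W.2
  have h1 : (∫ W, energyDensity N W).re = ∫ W, (energyDensity N W).re :=
    (integral_re hi).symm
  have hre : Integrable fun W => (energyDensity N W).re := hi.re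
  rw [h1, ofReal_integral_eq_lintegral_ofReal hre hnn, Measure.volume_eq_prod,
    lintegral_prod _ (by
      rw [← Measure.volume_eq_prod]
      exact hre.aemeasurable.ennreal_ofReal)]
  have hcont : Continuous fun q : ℂ × (Fin n → ℂ) => ENNReal.ofReal (‖q.1‖ ^ (2 * n) *
      (cutoff (‖q.1‖ ^ 2 * N (1, q.2)) * N (1, q.2) ^ (n + 1)) * volDensity N q.2) := by
    have hc1 : Continuous fun q : ℂ × (Fin n → ℂ) => N (1, q.2) := (affine_contDiff hN).continuous
    refine ENNReal.continuous_ofReal.comp (((continuous_fst.norm.pow _).mul ?_).mul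
      ((volDensity_continuous hN hp).comp continuous_snd))
    exact (cutoff_contDiff.continuous.comp ((continuous_fst.norm.pow 2).mul hc1)).mul (hc1.pow _)
  have h2 : ∀ᵐ a : ℂ, ∫⁻ y, ENNReal.ofReal (energyDensity N (a, y)).re
      = ∫⁻ z, ENNReal.ofReal (‖a‖ ^ (2 * n) *
      (cutoff (‖a‖ ^ 2 * N (1, z)) * N (1, z) ^ (n + 1)) * volDensity N z) := by
    filter_upwards [hae] with a ha
    rw [lintegral_comp_complex_smul ha, ← lintegral_const_mul' _ _ ENNReal.ofReal_ne_top]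
    refine lintegral_congr fun z => ?_
    rw [key a ha, ← ENNReal.ofReal_mul (by positivity)]
    congr 1
    ring
  rw [lintegral_congr_ae h2, lintegral_lintegral_swap (f := fun a z => ENNReal.ofReal (‖a‖ ^ (2 * n) *
      (cutoff (‖a‖ ^ 2 * N (1, z)) * N (1, z) ^ (n + 1)) * volDensity N z)) hcont.aemeasurable,
    ← lintegral_mul_const' _ _ (radialMass_ne_top n)]
  refine lintegral_congr fun z => ?_
  rw [← lintegral_radial (n := n) (hp _ (one_ne z)), ← lintegral_const_mul' _ _ ENNReal.ofReal_ne_top]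
  refine lintegral_congr fun a => ?_
  rw [← ENNReal.ofReal_mul (volDensity_pos hd z).1.le, mul_comm]

theorem integrable_volDensity (hN : IsHom N) (hp : ∀ W ≠ 0, 0 < N W)
    (hd : ∀ z, (fiberMetric (affineLog N) (0, z)).PosDef) : Integrable (volDensity N) := by
  have h := lintegral_volDensity hN hp hd
  refine (lintegral_ofReal_ne_top_iff_integrable
    (volDensity_continuous hN hp).aestronglyMeasurable
    (Eventually.of_forall fun z => (volDensity_pos hd z).1.le)).1 fun htop => ?_
  rw [htop, ENNReal.top_mul (radialMass_ne_zero n)] at h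
  exact ENNReal.ofReal_ne_top h

theorem integral_volDensity_pos (hN : IsHom N) (hp : ∀ W ≠ 0, 0 < N W)
    (hd : ∀ z, (fiberMetric (affineLog N) (0, z)).PosDef) : 0 < ∫ z, volDensity N z := by
  rw [integral_pos_iff_support_of_nonneg (fun z => (volDensity_pos hd z).1.le)
    (integrable_volDensity hN hp hd)]
  have : Function.support (volDensity N) = univ := by
    ext z
    simp [(volDensity_pos hd z).1.ne']
  rw [this]
  exact isOpen_univ.measure_pos _ univ_nonempty

/-- The volume of the fiber does not depend on the metric. -/
theorem integral_volDensity_eq (h₀ : IsHom N₀) (h₁ : IsHom N₁) (hp₀ : ∀ W ≠ 0, 0 < N₀ W)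
    (hp₁ : ∀ W ≠ 0, 0 < N₁ W) (hd₀ : ∀ z, (fiberMetric (affineLog N₀) (0, z)).PosDef)
    (hd₁ : ∀ z, (fiberMetric (affineLog N₁) (0, z)).PosDef) :
    ∫ z, volDensity N₀ z = ∫ z, volDensity N₁ z := by
  have e₀ := lintegral_volDensity h₀ hp₀ hd₀
  have e₁ := lintegral_volDensity h₁ hp₁ hd₁
  rw [integral_energyDensity_eq h₀ h₁ hp₀ hp₁, e₁] at e₀
  have h := (ENNReal.mul_left_inj (radialMass_ne_zero n) (radialMass_ne_top n)).1 e₀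
  rw [integral_eq_lintegral_of_nonneg_ae (Eventually.of_forall fun z => (volDensity_pos hd₀ z).1.le)
      (volDensity_continuous h₀ hp₀).aestronglyMeasurable,
    integral_eq_lintegral_of_nonneg_ae (Eventually.of_forall fun z => (volDensity_pos hd₁ z).1.le)
      (volDensity_continuous h₁ hp₁).aestronglyMeasurable, h]

end Volume

/-! ### Rescaling a weight -/

section Scaling

variable {n : ℕ} {Φ : Loc n → ℝ} {U : Set (Loc n)} {p : Loc n} {c : ℝ}

theorem fiberMetric_const_mul (hU : IsOpen U) (hΦ : ContDiffOn ℝ ∞ Φ U) (hp : p ∈ U) (c : ℝ) :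
    fiberMetric (fun q => c * Φ q) p = (c : ℂ) • fiberMetric Φ p := by
  ext α β
  exact levi_const_mul hU hp hΦ c _ _

theorem inv_fiberMetric_const_mul (hU : IsOpen U) (hΦ : ContDiffOn ℝ ∞ Φ U) (hp : p ∈ U)
    (hc : c ≠ 0) (hdet : (fiberMetric Φ p).det ≠ 0) :
    (fiberMetric (fun q => c * Φ q) p)⁻¹ = (c : ℂ)⁻¹ • (fiberMetric Φ p)⁻¹ := by
  have hc' : (c : ℂ) ≠ 0 := Complex.ofReal_ne_zero.2 hc
  rw [fiberMetric_const_mul hU hΦ hp]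
  refine Matrix.inv_eq_right_inv ?_
  rw [Matrix.smul_mul, Matrix.mul_smul, smul_smul, mul_inv_cancel₀ hc', one_smul,
    Matrix.mul_nonsing_inv _ hdet.isUnit]

theorem liftCoeff_const_mul (hU : IsOpen U) (hΦ : ContDiffOn ℝ ∞ Φ U) (hp : p ∈ U)
    (hc : c ≠ 0) (hdet : (fiberMetric Φ p).det ≠ 0) :
    liftCoeff (fun q => c * Φ q) p = liftCoeff Φ p := by
  have hc' : (c : ℂ) ≠ 0 := Complex.ofReal_ne_zero.2 hc
  funext α
  simp only [liftCoeff, inv_fiberMetric_const_mul hU hΦ hp hc hdet, Matrix.smul_apply, smul_eq_mul,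
    levi_const_mul hU hp hΦ]
  congr 1
  refine Finset.sum_congr rfl fun β _ => ?_
  field_simp

theorem geodesicCurvature_const_mul (hU : IsOpen U) (hΦ : ContDiffOn ℝ ∞ Φ U) (hp : p ∈ U)
    (hc : c ≠ 0) (hdet : (fiberMetric Φ p).det ≠ 0) :
    geodesicCurvature (fun q => c * Φ q) p = c * geodesicCurvature Φ p := by
  have h : horizontalLift (fun q => c * Φ q) p = horizontalLift Φ p := by
    rw [horizontalLift, liftCoeff_const_mul hU hΦ hp hc hdet]; rfl
  rw [geodesicCurvature, h, levi_const_mul hU hp hΦ]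
  rfl

theorem kodairaSpencerNormSq_const_mul (hU : IsOpen U) (hΦ : ContDiffOn ℝ ∞ Φ U) (hp : p ∈ U)
    (hc : c ≠ 0) (hdet : ∀ q ∈ U, (fiberMetric Φ q).det ≠ 0) :
    kodairaSpencerNormSq (fun q => c * Φ q) p = kodairaSpencerNormSq Φ p := by
  have hc' : (c : ℂ) ≠ 0 := Complex.ofReal_ne_zero.2 hc
  have hA : ∀ α β, kodairaSpencer (fun q => c * Φ q) p α β = kodairaSpencer Φ p α β := by
    intro α β
    rw [kodairaSpencer, kodairaSpencer, dWbar_eq_wirt]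
    refine wirt_congr_on hU hp fun q hq => ?_
    rw [liftCoeff_const_mul hU hΦ hq hc (hdet q hq)]
  simp only [kodairaSpencerNormSq, hA, inv_fiberMetric_const_mul hU hΦ hp hc (hdet p hp)]
  simp only [fiberMetric_const_mul hU hΦ hp, Matrix.smul_apply, smul_eq_mul]
  refine Finset.sum_congr rfl fun α _ => Finset.sum_congr rfl fun β _ =>
    Finset.sum_congr rfl fun γ _ => Finset.sum_congr rfl fun δ _ => ?_
  field_simp

theorem box_geodesicCurvature_const_mul (hU : IsOpen U) (hΦ : ContDiffOn ℝ ∞ Φ U) (hp : p ∈ U)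
    (hc : c ≠ 0) (hdet : ∀ q ∈ U, (fiberMetric Φ q).det ≠ 0) :
    box (fun q => c * Φ q) (geodesicCurvature (fun q => c * Φ q)) p
      = box Φ (geodesicCurvature Φ) p := by
  have hc' : (c : ℂ) ≠ 0 := Complex.ofReal_ne_zero.2 hc
  have hg := geodesicCurvature_contDiffOn hU hΦ hdet
  simp only [box, inv_fiberMetric_const_mul hU hΦ hp hc (hdet p hp), Matrix.smul_apply, smul_eq_mul,
    dW_eq_wirt, dWbar_eq_wirt]
  congr 1
  refine Finset.sum_congr rfl fun α _ => Finset.sum_congr rfl fun β _ => ?_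
  have e1 : ∀ q ∈ U, wirt Complex.I (eFib β) (geodesicCurvature (fun q => c * Φ q)) q
      = c * wirt Complex.I (eFib β) (geodesicCurvature Φ) q := by
    intro q hq
    rw [wirt_congr_on hU hq fun y hy => geodesicCurvature_const_mul hU hΦ hy hc (hdet y hy)]
    exact wirt_const_mul _ (hg.differentiableAt_of_isOpen hU hq)
  rw [wirt_congr_on hU hp e1, wirt_const_mul _
    ((wirt_contDiffOn hU hg).differentiableAt_of_isOpen hU hp)]
  field_simp

end Scaling

/-! ### Homogeneous weights -/

section Weight

variable {n : ℕ} {w : Loc n → ℝ}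

/-- A smooth weight of a metric on `𝒪(n+1)` over `ℙⁿ`, in homogeneous coordinates. -/
structure IsWeight (w : Loc n → ℝ) : Prop where
  smooth : ContDiffOn ℝ ∞ w {0}ᶜ
  hom : ∀ (a : ℂ) (W : Loc n), a ≠ 0 → W ≠ 0 → w (a • W) = w W + (n + 1) * Real.log (‖a‖ ^ 2)

open Classical in
/-- The squared norm function on `𝒪(-1)` of the `(n+1)`-st root of the metric with weight `w`; its
value at the origin is `0`, whatever the value of `w` there. -/
def rootNorm (w : Loc n → ℝ) (W : Loc n) : ℝ := if W = 0 then 0 else Real.exp (w W / (n + 1))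

theorem rootNorm_of_ne {W : Loc n} (hW : W ≠ 0) : rootNorm w W = Real.exp (w W / (n + 1)) :=
  if_neg hW

theorem rootNorm_pos (W : Loc n) (hW : W ≠ 0) : 0 < rootNorm w W := by
  rw [rootNorm_of_ne hW]; exact Real.exp_pos _

theorem IsWeight.isHom (hw : IsWeight w) : IsHom (rootNorm w) where
  smooth := (Real.contDiff_exp.comp_contDiffOn (hw.smooth.div_const _)).congr fun _ hW =>
    rootNorm_of_ne hW
  hom a W := by
    by_cases ha : a = 0
    · simp [ha, rootNorm]
    by_cases hW : W = 0
    · simp [hW, rootNorm]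
    have hn : (n : ℝ) + 1 ≠ 0 := by positivity
    rw [rootNorm_of_ne hW, rootNorm_of_ne (smul_ne_zero ha hW), hw.hom a W ha hW, add_div,
      mul_div_cancel_left₀ _ hn, Real.exp_add, Real.exp_log (by positivity), mul_comm]

theorem affineLog_rootNorm (p : Loc n) : affineLog (rootNorm w) p = (n + 1 : ℝ)⁻¹ * w (1, p.2) := by
  rw [affineLog, rootNorm_of_ne (one_ne _), Real.log_exp, div_eq_inv_mul]

theorem IsWeight.affine_contDiffOn (hw : IsWeight w) :
    ContDiffOn ℝ ∞ (fun p : Loc n => w (1, p.2)) univ :=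
  hw.smooth.comp (f := fun p : Loc n => ((1, p.2) : Loc n))
    (contDiff_const.prodMk contDiff_snd).contDiffOn fun p _ => one_ne p.2

theorem fiberMetric_affineLog_rootNorm (hw : IsWeight w) (p : Loc n) :
    fiberMetric (affineLog (rootNorm w)) p
      = (((n + 1 : ℝ)⁻¹ : ℝ) : ℂ) • fiberMetric (fun q => w (1, q.2)) p := by
  rw [← fiberMetric_const_mul isOpen_univ hw.affine_contDiffOn (mem_univ p)]
  congr 1
  funext q
  exact affineLog_rootNorm q

/-- All positive smooth metrics on `𝒪(n+1)` have the same fiber volume. -/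
theorem exists_volume (n : ℕ) : ∃ v : ℝ, 0 < v ∧ ∀ w : Loc n → ℝ, IsWeight w →
    (∀ z, (fiberMetric (fun q => w (1, q.2)) (0, z)).PosDef) →
      ∫ z, (fiberMetric (fun q => w (1, q.2)) (0, z)).det.re = v := by
  have hr : (0:ℝ) < (n + 1 : ℝ)⁻¹ := by positivity
  have hpos : ∀ w : Loc n → ℝ, IsWeight w →
      (∀ z, (fiberMetric (fun q => w (1, q.2)) (0, z)).PosDef) →
      ∀ z, (fiberMetric (affineLog (rootNorm w)) (0, z)).PosDef := by
    intro w hw hd z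
    rw [fiberMetric_affineLog_rootNorm hw]
    exact (hd z).smul (Complex.zero_lt_real.2 hr)
  have hvol : ∀ w : Loc n → ℝ, IsWeight w →
      ∫ z, (fiberMetric (fun q => w (1, q.2)) (0, z)).det.re
        = (n + 1 : ℝ) ^ n * ∫ z, volDensity (rootNorm w) z := by
    intro w hw
    rw [← integral_const_mul]
    refine integral_congr_ae (Eventually.of_forall fun z => ?_)
    simp only [volDensity]
    rw [fiberMetric_affineLog_rootNorm hw, Matrix.det_smul, Fintype.card_fin, ← Complex.ofReal_pow,
      Complex.re_ofReal_mul, ← mul_assoc, ← mul_pow, mul_inv_cancel₀ (by positivity), one_pow, one_mul]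
  by_cases h : ∃ w : Loc n → ℝ, IsWeight w ∧
      ∀ z, (fiberMetric (fun q => w (1, q.2)) (0, z)).PosDef
  · obtain ⟨w₀, hw₀, hd₀⟩ := h
    refine ⟨∫ z, (fiberMetric (fun q => w₀ (1, q.2)) (0, z)).det.re, ?_, fun w hw hd => ?_⟩
    · rw [hvol w₀ hw₀]
      exact mul_pos (by positivity)
        (integral_volDensity_pos hw₀.isHom rootNorm_pos (hpos w₀ hw₀ hd₀))
    · rw [hvol w hw, hvol w₀ hw₀, integral_volDensity_eq hw.isHom hw₀.isHom rootNorm_pos rootNorm_pos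
        (hpos w hw hd) (hpos w₀ hw₀ hd₀)]
  · exact ⟨1, one_pos, fun w hw hd => absurd ⟨w, hw, hd⟩ h⟩

/-- The density `e^{-w}` decays like `|z|^{-2(n+1)}` in the affine chart. -/
theorem IsWeight.integrable_exp_neg (hw : IsWeight w) :
    Integrable fun z : Fin n → ℂ => Real.exp (-w (1, z)) := by
  obtain ⟨c, hc, _, _, hb⟩ := hw.isHom.exists_bounds rootNorm_pos
  have hcont : Continuous fun z : Fin n → ℂ => Real.exp (-w (1, z)) := by
    have h := hw.affine_contDiffOn.continuousOn
    rw [continuousOn_univ] at h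
    exact Real.continuous_exp.comp
      (h.comp (by fun_prop : Continuous fun z : Fin n → ℂ => ((0:ℂ), z))).neg
  have hfin : (Module.finrank ℝ (Fin n → ℂ) : ℝ) < (2 * (n + 1) : ℕ) := by
    rw [Module.finrank_pi_fintype]
    simp [Complex.finrank_real_complex]
    linarith
  refine ((integrable_one_add_norm (μ := (volume : Measure (Fin n → ℂ))) hfin).const_mul
    (((c / 4) ^ (n + 1))⁻¹)).mono' hcont.aestronglyMeasurable (Eventually.of_forall fun z => ?_)
  rw [Real.norm_of_nonneg (Real.exp_pos _).le, Real.rpow_neg (by positivity), Real.rpow_natCast,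
    ← mul_inv, pow_mul, ← mul_pow, Real.exp_neg]
  refine inv_anti₀ (by positivity) ?_
  have h1 : Real.exp (w (1, z)) = rootNorm w (1, z) ^ (n + 1) := by
    rw [rootNorm_of_ne (one_ne z), ← Real.exp_nat_mul]
    congr 1
    push_cast
    field_simp
  rw [h1]
  refine pow_le_pow_left₀ (by positivity) (le_trans ?_ (hb (1, z)).1) _
  have h2 : 1 + ‖z‖ ≤ 2 * ‖((1, z) : Loc n)‖ := by
    have ha : ‖(1:ℂ)‖ ≤ ‖((1, z) : Loc n)‖ := norm_fst_le ((1, z) : Loc n)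
    have hb : ‖z‖ ≤ ‖((1, z) : Loc n)‖ := norm_snd_le ((1, z) : Loc n)
    rw [norm_one] at ha
    linarith
  have h3 : (1 + ‖z‖) ^ 2 ≤ (2 * ‖((1, z) : Loc n)‖) ^ 2 := pow_le_pow_left₀ (by positivity) h2 2
  nlinarith

end Weight

/-! ### Metrics on the bundle in homogeneous and affine coordinates -/

section FrameChart

variable {n : ℕ} {S : Type*} [TopologicalSpace S] [ChartedSpace ℂ S]
  {E : S → Type*} [TopologicalSpace (Bundle.TotalSpace (Fin (n + 1) → ℂ) E)]
  [∀ s, TopologicalSpace (E s)] [FiberBundle (Fin (n + 1) → ℂ) E]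

theorem FrameChart.isOpen_domain (C : FrameChart n E) : IsOpen C.domain :=
  C.coord.symm.isOpen_inter_preimage C.triv.open_baseSet

/-- The affine chart over the coordinate domain of a frame chart. -/
def FrameChart.affine (C : FrameChart n E) : Set (Loc n) := C.domain ×ˢ univ

theorem FrameChart.isOpen_affine (C : FrameChart n E) : IsOpen C.affine :=
  C.isOpen_domain.prod isOpen_univ

end FrameChart

section BundleFacts

variable {n : ℕ} {S : Type*} [TopologicalSpace S] [ChartedSpace ℂ S]
  {E : S → Type*} [TopologicalSpace (Bundle.TotalSpace (Fin (n + 1) → ℂ) E)]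
  [∀ s, AddCommGroup (E s)] [∀ s, Module ℂ (E s)] [∀ s, TopologicalSpace (E s)]
  [FiberBundle (Fin (n + 1) → ℂ) E] [VectorBundle ℂ (Fin (n + 1) → ℂ) E]

theorem FrameChart.coframe_smul (C : FrameChart n E) (s : S) (a : ℂ) (W : Fin (n + 1) → ℂ) :
    C.coframe s (a • W) = a • C.coframe s W := by
  simp only [FrameChart.coframe, Pi.smul_apply, smul_eq_mul, mul_smul]
  rw [← Finset.smul_sum, LinearMap.smul_comp]

theorem FrameChart.coframe_ne_zero (C : FrameChart n E) {s : S} (hs : s ∈ C.triv.baseSet)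
    {W : Fin (n + 1) → ℂ} (hW : W ≠ 0) : C.coframe s W ≠ 0 := by
  have := C.triv_mem
  obtain ⟨i, hi⟩ := Function.ne_iff.1 hW
  intro h
  have h1 := LinearMap.congr_fun h (C.triv.symmₗ ℂ s (Pi.single i 1))
  rw [FrameChart.coframe, LinearMap.comp_apply, C.triv.linearMapAt_symmₗ hs] at h1
  refine hi ?_
  simpa [Pi.single_apply] using h1

/-- The coordinates of `ℂ^{n+1}` with the `i`-th one in the first place. -/
def homCoord (i : Fin (n + 1)) (W : Loc n) : Fin (n + 1) → ℂ := i.insertNth W.1 W.2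

theorem homCoord_contDiff (i : Fin (n + 1)) : ContDiff ℝ ∞ (homCoord i : Loc n → _) := by
  refine contDiff_pi.2 fun j => ?_
  refine Fin.succAboveCases i ?_ (fun k => ?_) j
  · simp only [homCoord, Fin.insertNth_apply_same]
    exact contDiff_fst
  · simp only [homCoord, Fin.insertNth_apply_succAbove]
    exact (contDiff_apply ℝ ℂ k).comp contDiff_snd

theorem homCoord_smul (i : Fin (n + 1)) (a : ℂ) (W : Loc n) :
    homCoord i (a • W) = a • homCoord i W := by
  funext j
  refine Fin.succAboveCases i ?_ (fun k => ?_) j <;> simp [homCoord]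

theorem homCoord_ne_zero (i : Fin (n + 1)) {W : Loc n} (hW : W ≠ 0) : homCoord i W ≠ 0 := by
  intro h
  refine hW (Prod.ext ?_ (funext fun k => ?_))
  · simpa [homCoord] using congrFun h i
  · simpa [homCoord] using congrFun h (i.succAbove k)

/-- The weight of the metric on a single fiber, in homogeneous coordinates. -/
def MetricO.fiberWeight {k : ℕ} (h : MetricO n E k) (C : FrameChart n E) (i : Fin (n + 1)) (s : ℂ)
    (W : Loc n) : ℝ :=
  C.pull h.weight (s, homCoord i W)

theorem MetricO.pull_smul {k : ℕ} (h : MetricO n E k) (C : FrameChart n E) {s : ℂ}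
    (hs : s ∈ C.domain) {a : ℂ} (ha : a ≠ 0) {W : Fin (n + 1) → ℂ} (hW : W ≠ 0) :
    C.pull h.weight (s, a • W) = C.pull h.weight (s, W) + k * Real.log (‖a‖ ^ 2) := by
  rw [FrameChart.pull, FrameChart.pull, C.coframe_smul,
    h.weight_smul _ _ _ ha (C.coframe_ne_zero hs.2 hW)]

theorem MetricO.isWeight (h : MetricO n E (n + 1)) (C : FrameChart n E) (i : Fin (n + 1)) {s : ℂ}
    (hs : s ∈ C.domain) : IsWeight (h.fiberWeight C i s) where
  smooth := by
    refine (h.smooth C).comp (f := fun W : Loc n => ((s, homCoord i W) : ℂ × (Fin (n + 1) → ℂ)))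
      (contDiff_const.prodMk (homCoord_contDiff i)).contDiffOn fun W hW => ⟨hs, ?_⟩
    exact homCoord_ne_zero i hW
  hom a W ha hW := by
    rw [MetricO.fiberWeight, homCoord_smul, h.pull_smul C hs ha (homCoord_ne_zero i hW)]
    push_cast
    rfl

theorem MetricO.loc_contDiffOn {k : ℕ} (h : MetricO n E k) (C : FrameChart n E) (i : Fin (n + 1)) :
    ContDiffOn ℝ ∞ (h.loc C i) C.affine := by
  refine (h.smooth C).comp
    (f := fun p : Loc n => ((p.1, homCoord i (1, p.2)) : ℂ × (Fin (n + 1) → ℂ)))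
    (contDiff_fst.prodMk ((homCoord_contDiff i).comp
      (contDiff_const.prodMk contDiff_snd))).contDiffOn fun p hp => ⟨hp.1, ?_⟩
  exact homCoord_ne_zero i (one_ne p.2)

theorem levi_fiber {U : Set ℂ} (hU : IsOpen U) {f : Loc n → ℝ} (hf : ContDiffOn ℝ ∞ f (U ×ˢ univ))
    {p : Loc n} (hp : p.1 ∈ U) (α β : Fin n) :
    levi (fun q : Loc n => f (p.1, q.2)) (0, p.2) (eFib α) (eFib β)
      = levi f p (eFib α) (eFib β) := by
  set L : Loc n →L[ℝ] Loc n :=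
    (0 : Loc n →L[ℝ] ℂ).prod (ContinuousLinearMap.snd ℝ ℂ (Fin n → ℂ)) with hL
  have hA : ∀ y : Loc n, HasFDerivAt (fun q : Loc n => ((p.1, q.2) : Loc n)) L y := fun y =>
    (hasFDerivAt_const p.1 y).prodMk (ContinuousLinearMap.snd ℝ ℂ (Fin n → ℂ)).hasFDerivAt
  exact levi_comp_affine (A := fun q : Loc n => ((p.1, q.2) : Loc n)) (L := L) isOpen_univ
    (hU.prod isOpen_univ) (mem_univ ((0, p.2) : Loc n)) hA
    (fun y _ => (⟨hp, mem_univ _⟩ : ((p.1, y.2) : Loc n) ∈ U ×ˢ univ))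
    (fun ξ => by simp [hL, Prod.smul_mk]) hf (eFib α) (eFib β)

theorem MetricO.fiberMetric_eq {k : ℕ} (h : MetricO n E k) (C : FrameChart n E) (i : Fin (n + 1))
    {p : Loc n} (hp : p.1 ∈ C.domain) :
    fiberMetric (h.loc C i) p
      = fiberMetric (fun q => h.fiberWeight C i p.1 (1, q.2)) (0, p.2) := by
  ext α β
  exact (levi_fiber C.isOpen_domain (h.loc_contDiffOn C i) hp α β).symm

theorem MetricO.root_loc (h : MetricO n E (n + 1)) (C : FrameChart n E) (i : Fin (n + 1)) :
    h.root.loc C i = fun p => (n + 1 : ℝ)⁻¹ * h.loc C i p := by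
  funext p
  rw [← div_eq_inv_mul]
  rfl

theorem MetricO.integrable_exp (h : MetricO n E (n + 1)) (C : FrameChart n E) (i : Fin (n + 1))
    {s : ℂ} (hs : s ∈ C.domain) : Integrable fun z : Fin n → ℂ => Real.exp (-h.loc C i (s, z)) :=
  (h.isWeight C i hs).integrable_exp_neg

theorem sectionNormSq_eq (Φ : Loc n → ℝ) (u : ℂ → ℂ) (s : ℂ) :
    sectionNormSq Φ u s = ‖u s‖ ^ 2 * sectionNormSq Φ 1 s := by
  simp only [sectionNormSq, sectionDensity, Pi.one_apply, norm_one, one_pow, one_mul]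
  rw [integral_const_mul]

theorem sectionNormSq_one (Φ : Loc n → ℝ) (s : ℂ) :
    sectionNormSq Φ 1 s = 2 ^ n * ∫ z : Fin n → ℂ, Real.exp (-Φ (s, z)) := by
  simp only [sectionNormSq, sectionDensity, Pi.one_apply, norm_one, one_pow, one_mul]
  rw [integral_const_mul]

theorem MetricO.sectionNormSq_pos (h : MetricO n E (n + 1)) (C : FrameChart n E) (i : Fin (n + 1))
    {s : ℂ} (hs : s ∈ C.domain) : 0 < sectionNormSq (h.loc C i) 1 s := by
  rw [sectionNormSq_one]
  refine mul_pos (by positivity) ?_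
  exact integral_exp_pos (h.integrable_exp C i hs)

/-- The common value of `∫ det g` over the fibers for all metrics on `𝒪(n+1)` that are positive along
the fibers; the volume of the fibers is `n! 2 ^ n` times this number. -/
def fiberVolume (n : ℕ) : ℝ := (exists_volume n).choose

theorem fiberVolume_pos (n : ℕ) : 0 < fiberVolume n := (exists_volume n).choose_spec.1

theorem MetricO.integral_det (h : MetricO n E (n + 1)) (hpos : h.FiberPos) (C : FrameChart n E)
    (i : Fin (n + 1)) {s : ℂ} (hs : s ∈ C.domain) :
    ∫ z : Fin n → ℂ, (fiberMetric (h.loc C i) (s, z)).det.re = fiberVolume n := by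
  rw [fiberVolume, ← (exists_volume n).choose_spec.2 (h.fiberWeight C i s)
    (h.isWeight C i hs) fun z => by
    rw [← h.fiberMetric_eq C i (p := (s, z)) hs]
    exact hpos C i (s, z) hs]
  refine integral_congr_ae (Eventually.of_forall fun z => ?_)
  simp only
  rw [h.fiberMetric_eq C i (p := (s, z)) hs]

/-- The ratio of the two probability densities in the flow equation. -/
theorem MetricO.density_ratio (h : MetricO n E (n + 1)) (hpos : h.FiberPos) (C : FrameChart n E)
    (i : Fin (n + 1)) {p : Loc n} (hp : p.1 ∈ C.domain) :
    maDensity (h.loc C i) p / muDensity (h.loc C i) p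
      = (fiberMetric (h.loc C i) p).det.re * Real.exp (h.loc C i p)
        * sectionNormSq (h.loc C i) 1 p.1 / (fiberVolume n * 2 ^ n) := by
  have h1 : (n.factorial : ℝ) ≠ 0 := Nat.cast_ne_zero.2 n.factorial_ne_zero
  have h2 := (fiberVolume_pos n).ne'
  have h3 := (h.sectionNormSq_pos C i hp).ne'
  have h4 := (Real.exp_pos (h.loc C i p)).ne'
  have hI : ∫ z : Fin n → ℂ, formDensity (h.loc C i) (p.1, z)
      = (n.factorial : ℝ) * 2 ^ n * fiberVolume n := by
    simp only [formDensity]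
    rw [integral_const_mul, h.integral_det hpos C i hp]
  rw [maDensity, muDensity, hI, formDensity, sectionDensity, Real.exp_neg]
  simp only [Pi.one_apply, norm_one, one_pow, one_mul]
  field_simp

theorem det_re_pos {g : Matrix (Fin n) (Fin n) ℂ} (hg : g.PosDef) :
    0 < g.det.re ∧ g.det = (g.det.re : ℂ) := by
  have := Complex.pos_iff.1 hg.det_pos
  exact ⟨this.1, Complex.ext rfl (by simp [← this.2])⟩

theorem MetricO.log_density_ratio (h : MetricO n E (n + 1)) (hpos : h.FiberPos)
    (C : FrameChart n E) (i : Fin (n + 1)) {p : Loc n} (hp : p.1 ∈ C.domain) :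
    Real.log (maDensity (h.loc C i) p / muDensity (h.loc C i) p)
      = Real.log (fiberMetric (h.loc C i) p).det.re + h.loc C i p
        + Real.log (sectionNormSq (h.loc C i) 1 p.1) - Real.log (fiberVolume n * 2 ^ n) := by
  have h1 := (det_re_pos (hpos C i p hp)).1.ne'
  have h2 := fiberVolume_pos n
  have h3 := (h.sectionNormSq_pos C i hp).ne'
  have h4 := (Real.exp_pos (h.loc C i p)).ne'
  rw [h.density_ratio hpos C i hp, Real.log_div (by positivity) (by positivity),
    Real.log_mul (by positivity) h3, Real.log_mul h1 h4, Real.log_exp]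

end BundleFacts

/-! ### The norm of a holomorphic section -/

section SectionNorm

theorem holomorphic_wirt {f : ℂ → ℂ} {x : ℂ} (hf : DifferentiableAt ℂ f x) :
    wirt Complex.I 1 f x = 0 ∧ wirt (-Complex.I) 1 f x = deriv f x := by
  have h := (hf.hasFDerivAt.restrictScalars ℝ).fderiv
  simp only [wirt, h]
  constructor
  · simp [← mul_assoc]
  · simp [← mul_assoc]

/-- The logarithm of the modulus of a nowhere vanishing holomorphic function is pluriharmonic. -/
theorem levi_log_norm_sq {u : ℂ → ℂ} {U : Set ℂ} (hU : IsOpen U) (hu : DifferentiableOn ℂ u U)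
    (h0 : ∀ y ∈ U, u y ≠ 0) {s : ℂ} (hs : s ∈ U) :
    ContDiffOn ℝ ∞ (fun y => Real.log (‖u y‖ ^ 2)) U ∧
      levi (fun y => Real.log (‖u y‖ ^ 2)) s 1 1 = 0 := by
  have hsm : ContDiffOn ℝ ∞ u U := (hu.contDiffOn hU).restrict_scalars ℝ
  have hn : ContDiffOn ℝ ∞ (fun y => ‖u y‖ ^ 2) U := hsm.norm_sq ℝ
  have hpos : ∀ y ∈ U, 0 < ‖u y‖ ^ 2 := fun y hy => pow_pos (norm_pos_iff.2 (h0 y hy)) 2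
  refine ⟨hn.log fun y hy => (hpos y hy).ne', ?_⟩
  have hd : DifferentiableOn ℂ (deriv u) U := hu.deriv hU
  have e1 : ∀ y ∈ U, wirt Complex.I 1 (fun y => ((Real.log (‖u y‖ ^ 2) : ℝ) : ℂ)) y
      = star (deriv u y / u y) := by
    intro y hy
    have hnc : ∀ z, ((‖u z‖ ^ 2 : ℝ) : ℂ) = u z * star (u z) := by
      intro z
      rw [Complex.ofReal_pow, ← Complex.mul_conj']; rfl
    rw [wirt_congr_on (g := fun y => Complex.log ((‖u y‖ ^ 2 : ℝ) : ℂ)) hU hy fun z hz => by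
      rw [Complex.ofReal_log (hpos z hz).le]]
    have hdu := hsm.differentiableAt_of_isOpen hU hy
    have hds := (contDiffOn_star hsm).differentiableAt_of_isOpen hU hy
    rw [wirt_comp_hasDerivAt (f := fun y => ((‖u y‖ ^ 2 : ℝ) : ℂ)) (Complex.hasDerivAt_log
      (Complex.ofReal_mem_slitPlane.2 (hpos y hy)))
      ((contDiffOn_ofReal hn).differentiableAt_of_isOpen hU hy)]
    simp only [hnc]
    have hw := holomorphic_wirt (hu.differentiableAt (hU.mem_nhds hy))
    rw [wirt_mul hdu hds, hw.1, wirt_star, show star Complex.I = -Complex.I by simp, hw.2, zero_mul,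
      zero_add, star_div₀]
    have h1 := h0 y hy
    have h2 : star (u y) ≠ 0 := star_ne_zero.2 h1
    field_simp
  rw [levi_eq_wirt, wirt_congr_on hU hs e1, wirt_star, show star (-Complex.I) = Complex.I by simp,
    (holomorphic_wirt (f := fun y => deriv u y / u y)
      ((hd.div hu h0).differentiableAt (hU.mem_nhds hs))).1, star_zero]

/-- Neither the choice of the holomorphic frame nor a constant factor affects the curvature. -/
theorem ddbarLog_sectionNormSq {n : ℕ} {Φ : Loc n → ℝ} {U : Set ℂ} (hU : IsOpen U) {s : ℂ}
    (hs : s ∈ U) (hpos : ∀ σ ∈ U, 0 < sectionNormSq Φ 1 σ)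
    (hsm : ContDiffOn ℝ ∞ (fun σ => Real.log (sectionNormSq Φ 1 σ)) U)
    {u : ℂ → ℂ} (hu : AnalyticAt ℂ u s) (h0 : u s ≠ 0) {κ : ℝ} (hκ : 0 < κ) :
    ddbarLog (fun σ => κ * sectionNormSq Φ u σ) s = ddbarLog (sectionNormSq Φ 1) s := by
  obtain ⟨U', hU's, hU'o, hsU'⟩ := eventually_nhds_iff.1
    (hu.eventually_analyticAt.and (hu.continuousAt.eventually_ne h0))
  have hO : IsOpen (U ∩ U') := hU.inter hU'o
  have hm : s ∈ U ∩ U' := ⟨hs, hsU'⟩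
  have hl := levi_log_norm_sq (u := u) hO (fun y hy =>
    (hU's y hy.2).1.differentiableAt.differentiableWithinAt) (fun y hy => (hU's y hy.2).2) hm
  have hsm' := hsm.mono (inter_subset_left (t := U'))
  rw [ddbarLog, ddbarLog, levi_congr (Ψ := fun y => Real.log κ + (Real.log (‖u y‖ ^ 2)
    + Real.log (sectionNormSq Φ 1 y))) hO hm fun y hy => ?_]
  · rw [levi_add hO hm contDiffOn_const (hl.1.add hsm'), levi_add hO hm hl.1 hsm', hl.2, levi_const,
      zero_add, zero_add]
  · have h1 : 0 < ‖u y‖ ^ 2 := pow_pos (norm_pos_iff.2 (hU's y hy.2).2) 2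
    have h2 := hpos y hy.1
    rw [sectionNormSq_eq, Real.log_mul hκ.ne' (by positivity), Real.log_mul h1.ne' h2.ne']

end SectionNorm

/-! ### The evolution equation -/

section Evolution

variable {n : ℕ} {S : Type*} [TopologicalSpace S] [ChartedSpace ℂ S]
  {E : S → Type*} [TopologicalSpace (Bundle.TotalSpace (Fin (n + 1) → ℂ) E)]
  [∀ s, AddCommGroup (E s)] [∀ s, Module ℂ (E s)] [∀ s, TopologicalSpace (E s)]
  [FiberBundle (Fin (n + 1) → ℂ) E] [VectorBundle ℂ (Fin (n + 1) → ℂ) E]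

/-- If the right hand side of the flow equation is a smooth function `ψ`, then so is
`log ‖u‖²` as a function on the base, and `ψ` has the Levi form of the evolution equation in the
horizontal direction. -/
theorem MetricO.levi_flow (h : MetricO n E (n + 1)) (hpos : h.FiberPos) (C : FrameChart n E)
    (i : Fin (n + 1)) {ψ : Loc n → ℝ} (hψ : ContDiffOn ℝ ∞ ψ C.affine) {K : ℝ}
    (hψe : ∀ q ∈ C.affine, ψ q = Real.log (fiberMetric (h.loc C i) q).det.re + h.loc C i q
      + Real.log (sectionNormSq (h.loc C i) 1 q.1) - K) {p : Loc n} (hp : p.1 ∈ C.domain) :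
    ContDiffOn ℝ ∞ (fun σ => Real.log (sectionNormSq (h.loc C i) 1 σ)) C.domain ∧
    levi ψ p (horizontalLift (h.loc C i) p) (horizontalLift (h.loc C i) p)
      = -box (h.loc C i) (geodesicCurvature (h.loc C i)) p + geodesicCurvature (h.loc C i) p
        + kodairaSpencerNormSq (h.loc C i) p
        + ddbarLog (sectionNormSq (h.loc C i) 1) p.1 := by
  have hU := C.isOpen_affine
  have hpU : p ∈ C.affine := ⟨hp, mem_univ _⟩
  have hΦ := h.loc_contDiffOn C i
  have hP : ∀ q ∈ C.affine, (fiberMetric (h.loc C i) q).PosDef := fun q hq => hpos C i q hq.1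
  have hlogdet : ContDiffOn ℝ ∞ (fun q => Real.log (fiberMetric (h.loc C i) q).det.re) C.affine := by
    have hd := contDiffOn_det fun i' j' => fiberMetric_contDiffOn hU hΦ i' j'
    exact (Complex.reCLM.contDiff.comp_contDiffOn hd).log fun q hq => (det_re_pos (hP q hq)).1.ne'
  have hI : ContDiffOn ℝ ∞ (fun σ => Real.log (sectionNormSq (h.loc C i) 1 σ)) C.domain := by
    have h1 : ContDiffOn ℝ ∞ (fun q => ψ q - Real.log (fiberMetric (h.loc C i) q).det.re
        - h.loc C i q + K) C.affine := ((hψ.sub hlogdet).sub hΦ).add contDiffOn_const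
    have h2 := h1.comp (s := C.domain) (f := fun σ : ℂ => ((σ, p.2) : Loc n))
      (contDiff_prodMk_left p.2).contDiffOn fun σ hσ => ⟨hσ, mem_univ _⟩
    refine h2.congr fun σ hσ => ?_
    simp only [Function.comp_apply]
    rw [hψe (σ, p.2) ⟨hσ, mem_univ _⟩]
    ring
  refine ⟨hI, ?_⟩
  have hIU : ContDiffOn ℝ ∞ (fun q : Loc n => Real.log (sectionNormSq (h.loc C i) 1 q.1)) C.affine :=
    hI.comp contDiff_fst.contDiffOn fun q hq => hq.1
  set v := horizontalLift (h.loc C i) p with hv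
  have hbase : levi (fun q : Loc n => Real.log (sectionNormSq (h.loc C i) 1 q.1)) p v v
      = ddbarLog (sectionNormSq (h.loc C i) 1) p.1 :=
    levi_comp_affine (A := fun q : Loc n => q.1) (L := ContinuousLinearMap.fst ℝ ℂ (Fin n → ℂ))
      hU C.isOpen_domain hpU (fun y => (ContinuousLinearMap.fst ℝ ℂ (Fin n → ℂ)).hasFDerivAt)
      (fun q hq => hq.1) (fun ξ => rfl) hI v v
  have e : ∀ q ∈ C.affine, ψ q = Real.log (fiberMetric (h.loc C i) q).det.re + (h.loc C i q
      + (Real.log (sectionNormSq (h.loc C i) 1 q.1) + (-K))) := by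
    intro q hq
    rw [hψe q hq]; ring
  rw [levi_congr hU hpU e, levi_add hU hpU hlogdet (hΦ.add (hIU.add contDiffOn_const)),
    levi_add hU hpU hΦ (hIU.add contDiffOn_const), levi_add hU hpU hIU contDiffOn_const, levi_const,
    hbase, levi_log_det_horizontalLift hU hΦ hpU hP]
  have : levi (h.loc C i) p v v = geodesicCurvature (h.loc C i) p := rfl
  rw [this]
  ring

variable {J : Set ℝ} {φ : ℝ → MetricO n E (n + 1)}

theorem IsFlow.loc_contDiffOn (hφ : IsFlow J φ) (C : FrameChart n E) (i : Fin (n + 1)) :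
    ContDiffOn ℝ ∞ (fun q : ℝ × Loc n => (φ q.1).loc C i q.2) (J ×ˢ C.affine) := by
  refine (hφ.smooth C).comp
    (f := fun q : ℝ × Loc n => ((q.1, q.2.1, homCoord i (1, q.2.2)) : ℝ × ℂ × (Fin (n + 1) → ℂ)))
    (ContDiff.contDiffOn ?_) fun q hq => ⟨hq.1, hq.2.1, homCoord_ne_zero i (one_ne q.2.2)⟩
  exact contDiff_fst.prodMk ((contDiff_fst.comp contDiff_snd).prodMk ((homCoord_contDiff i).comp
    (contDiff_const.prodMk (contDiff_snd.comp contDiff_snd))))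

theorem IsFlow.evolution (hJ : J.OrdConnected) (hJ' : J.Nontrivial) (hφ : IsFlow J φ) {t : ℝ}
    (ht : t ∈ J) (C : FrameChart n E) (i : Fin (n + 1)) {p : Loc n} (hp : p.1 ∈ C.domain)
    {u : ℂ → ℂ} (hu : AnalyticAt ℂ u p.1) (hu0 : u p.1 ≠ 0) :
    HasDerivWithinAt (fun τ => geodesicCurvature ((φ τ).loc C i) p)
      (-box ((φ t).loc C i) (geodesicCurvature ((φ t).loc C i)) p
        + geodesicCurvature ((φ t).loc C i) p + kodairaSpencerNormSq ((φ t).loc C i) p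
        + ddbarLog (sectionNormSq ((φ t).loc C i) u) p.1) J t := by
  have hU := C.isOpen_affine
  have hud := uniqueDiffOn_of_ordConnected hJ hJ'
  have hF := hφ.loc_contDiffOn C i
  have hpU : p ∈ C.affine := ⟨hp, mem_univ _⟩
  have hder := hasDerivWithinAt_geodesicCurvature hJ hJ' hU hF ht hpU
    fun τ hτ => ((hφ.pos τ hτ) C i p hp).det_pos.ne'
  have hψ : ContDiffOn ℝ ∞ (fun y => derivWithin (fun τ => (φ τ).loc C i y) J t) C.affine :=
    contDiffOn_slice_left (contDiffOn_derivWithin_slice hud hU hF) ht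
  have hψe : ∀ q ∈ C.affine, derivWithin (fun τ => (φ τ).loc C i q) J t
      = Real.log (fiberMetric ((φ t).loc C i) q).det.re + (φ t).loc C i q
      + Real.log (sectionNormSq ((φ t).loc C i) 1 q.1) - Real.log (fiberVolume n * 2 ^ n) := by
    intro q hq
    rw [(hφ.flow t ht C i q hq.1).derivWithin (hud t ht)]
    exact (φ t).log_density_ratio (hφ.pos t ht) C i hq.1
  have hcore := (φ t).levi_flow (hφ.pos t ht) C i hψ hψe hp
  have hd := ddbarLog_sectionNormSq (Φ := (φ t).loc C i) C.isOpen_domain hp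
    (fun σ hσ => (φ t).sectionNormSq_pos C i hσ) hcore.1 hu hu0 one_pos
  simp only [one_mul] at hd
  refine hder.congr_deriv ?_
  rw [hd]
  exact hcore.2

/-- The quantities of the evolution equation for the root of the metric. -/
theorem MetricO.root_terms (h : MetricO n E (n + 1)) (hpos : h.FiberPos) (C : FrameChart n E)
    (i : Fin (n + 1)) {p : Loc n} (hp : p.1 ∈ C.domain) :
    box (h.root.loc C i) (geodesicCurvature (h.root.loc C i)) p
        = box (h.loc C i) (geodesicCurvature (h.loc C i)) p ∧
      ((n + 1 : ℕ) : ℂ) * geodesicCurvature (h.root.loc C i) p = geodesicCurvature (h.loc C i) p ∧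
      kodairaSpencerNormSq (h.root.loc C i) p = kodairaSpencerNormSq (h.loc C i) p := by
  have hU := C.isOpen_affine
  have hΦ := h.loc_contDiffOn C i
  have hpU : p ∈ C.affine := ⟨hp, mem_univ _⟩
  have hc : ((n + 1 : ℝ)⁻¹) ≠ 0 := by positivity
  have hdet : ∀ q ∈ C.affine, (fiberMetric (h.loc C i) q).det ≠ 0 := fun q hq =>
    (hpos C i q hq.1).det_pos.ne'
  rw [h.root_loc C i]
  refine ⟨box_geodesicCurvature_const_mul hU hΦ hpU hc hdet, ?_,
    kodairaSpencerNormSq_const_mul hU hΦ hpU hc hdet⟩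
  rw [geodesicCurvature_const_mul hU hΦ hpU hc (hdet p hpU), ← mul_assoc]
  have : ((n + 1 : ℕ) : ℂ) * (((n + 1 : ℝ)⁻¹ : ℝ) : ℂ) = 1 := by
    have hn : ((n : ℂ) + 1) ≠ 0 := by exact_mod_cast n.succ_ne_zero
    push_cast
    exact mul_inv_cancel₀ hn
  rw [this, one_mul]

end Evolution

/-! ### The limit of the flow -/

section Limit

/-- If a function converges at infinity and the exponential of its derivative converges as well,
then the latter has the limit `1`. -/
theorem eq_one_of_tendsto_of_deriv {f X : ℝ → ℝ} {L x a : ℝ} (hf : Tendsto f atTop (𝓝 L))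
    (hX : Tendsto X atTop (𝓝 x)) (hpos : ∀ t > a, 0 < X t)
    (hd : ∀ t > a, HasDerivAt f (Real.log (X t)) t) : x = 1 := by
  have hex : ∀ t : ℝ, ∃ ξ : ℝ, t ≤ ξ ∧ (a < t → X ξ = Real.exp (f (t + 1) - f t)) := by
    intro t
    by_cases ht : a < t
    · obtain ⟨ξ, hξ, e⟩ := exists_hasDerivAt_eq_slope f (fun t => Real.log (X t)) (lt_add_one t)
        (fun s hs => (hd s (lt_of_lt_of_le ht hs.1)).continuousAt.continuousWithinAt)
        fun s hs => hd s (ht.trans hs.1)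
      refine ⟨ξ, hξ.1.le, fun _ => ?_⟩
      rw [add_sub_cancel_left, div_one] at e
      rw [← e, Real.exp_log (hpos ξ (ht.trans hξ.1))]
    · exact ⟨t, le_rfl, fun h => absurd h ht⟩
  choose ξ hξ e using hex
  have h1 : Tendsto (fun t => X (ξ t)) atTop (𝓝 x) := hX.comp (tendsto_atTop_mono hξ tendsto_id)
  have h2 : Tendsto (fun t => Real.exp (f (t + 1) - f t)) atTop (𝓝 1) := by
    have h3 := (hf.comp (tendsto_atTop_add_const_right _ (1:ℝ) tendsto_id)).sub hf
    rw [sub_self] at h3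
    have h4 := (Real.continuous_exp.tendsto 0).comp h3
    rw [Real.exp_zero] at h4
    exact h4
  refine tendsto_nhds_unique h1 (h2.congr' ?_)
  filter_upwards [eventually_gt_atTop a] with t ht
  exact (e t ht).symm

theorem Ioi_subset_of_not_bddAbove {J : Set ℝ} (hJ : J.OrdConnected) (hJ'' : ¬ BddAbove J) {a : ℝ}
    (ha : a ∈ J) : Ici a ⊆ J := by
  intro x hx
  obtain ⟨b, hb, hxb⟩ := not_bddAbove_iff.1 hJ'' x
  exact hJ.out ha hb ⟨hx, hxb.le⟩

/-- The Levi form of a function in terms of its second derivative. -/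
def leviOf {V : Type*} [NormedAddCommGroup V] [NormedSpace ℝ V] [Module ℂ V]
    (T : ContinuousMultilinearMap ℝ (fun _ : Fin 2 => V) ℝ) (ξ η : V) : ℂ :=
  ((T ![ξ, η] : ℂ) + Complex.I * T ![ξ, Complex.I • η]
    - Complex.I * (T ![Complex.I • ξ, η] + Complex.I * T ![Complex.I • ξ, Complex.I • η])) / 4

theorem levi_eq_leviOf {V : Type*} [NormedAddCommGroup V] [NormedSpace ℝ V] [Module ℂ V]
    {f : V → ℝ} {U : Set V} (hU : IsOpen U) (hf : ContDiffOn ℝ ∞ f U) {x : V} (hx : x ∈ U)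
    (ξ η : V) : levi f x ξ η = leviOf (iteratedFDeriv ℝ 2 f x) ξ η := by
  have hD : ContDiffOn ℝ ∞ (fderiv ℝ f) U := hf.fderiv_of_isOpen hU (by norm_num)
  have hDx := hD.differentiableAt_of_isOpen hU hx
  have hof : ∀ {g : V → ℝ} {y : V} (_ : DifferentiableAt ℝ g y) (v : V),
      fderiv ℝ (fun z => (g z : ℂ)) y v = ((fderiv ℝ g y v : ℝ) : ℂ) := by
    intro g y hg v
    have := (Complex.ofRealCLM.hasFDerivAt.comp y hg.hasFDerivAt).fderiv
    simp only [Function.comp_def, Complex.ofRealCLM_apply] at this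
    rw [this]
    rfl
  have hap : ∀ v, DifferentiableAt ℝ (fun y => fderiv ℝ f y v) x := fun v =>
    hDx.clm_apply (differentiableAt_const v)
  have h2 : ∀ v w, fderiv ℝ (fun y => fderiv ℝ f y v) x w = iteratedFDeriv ℝ 2 f x ![w, v] := by
    intro v w
    rw [iteratedFDeriv_two_apply, fderiv_clm_apply hDx (differentiableAt_const v)]
    simp
  have e1 : ∀ y ∈ U, dWbar η (fun z => (f z : ℂ)) y
      = (((fderiv ℝ f y η : ℝ) : ℂ) + Complex.I * ((fderiv ℝ f y (Complex.I • η) : ℝ) : ℂ)) / 2 := by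
    intro y hy
    have := hf.differentiableAt_of_isOpen hU hy
    rw [dWbar, hof this, hof this]
  have e2 : HasFDerivAt (dWbar η (fun z => (f z : ℂ)))
      ((2:ℂ)⁻¹ • (fderiv ℝ (fun y => ((fderiv ℝ f y η : ℝ) : ℂ)) x
        + Complex.I • fderiv ℝ (fun y => ((fderiv ℝ f y (Complex.I • η) : ℝ) : ℂ)) x)) x := by
    have hc : ∀ v, DifferentiableAt ℝ (fun y => ((fderiv ℝ f y v : ℝ) : ℂ)) x := fun v =>
      (Complex.ofRealCLM.hasFDerivAt.comp x (hap v).hasFDerivAt).differentiableAt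
    have := ((hc η).hasFDerivAt.add ((hc (Complex.I • η)).hasFDerivAt.const_mul Complex.I)).const_mul
      (2:ℂ)⁻¹
    refine this.congr_of_eventuallyEq (Filter.eventuallyEq_of_mem (hU.mem_nhds hx) fun y hy => ?_)
    rw [e1 y hy]
    simp only [Pi.add_apply]
    ring
  rw [levi, dW, e2.fderiv]
  simp only [FunLike.coe_smul, FunLike.coe_add, Pi.smul_apply, Pi.add_apply, smul_eq_mul,
    hof (hap _), h2, leviOf]
  ring

theorem leviOf_continuous {V : Type*} [NormedAddCommGroup V] [NormedSpace ℝ V] [Module ℂ V]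
    (ξ η : V) : Continuous fun T : ContinuousMultilinearMap ℝ (fun _ : Fin 2 => V) ℝ =>
      leviOf T ξ η := by
  have h : ∀ m : Fin 2 → V, Continuous fun T : ContinuousMultilinearMap ℝ (fun _ : Fin 2 => V) ℝ =>
      ((T m : ℝ) : ℂ) := fun m =>
    Complex.continuous_ofReal.comp (ContinuousMultilinearMap.apply ℝ (fun _ : Fin 2 => V) ℝ m).continuous
  simp only [leviOf]
  exact (((h _).add (continuous_const.mul (h _))).sub
    (continuous_const.mul ((h _).add (continuous_const.mul (h _))))).div_const 4

variable {n : ℕ} {S : Type*} [TopologicalSpace S] [ChartedSpace ℂ S]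
  {E : S → Type*} [TopologicalSpace (Bundle.TotalSpace (Fin (n + 1) → ℂ) E)]
  [∀ s, AddCommGroup (E s)] [∀ s, Module ℂ (E s)] [∀ s, TopologicalSpace (E s)]
  [FiberBundle (Fin (n + 1) → ℂ) E] [VectorBundle ℂ (Fin (n + 1) → ℂ) E]
  {J : Set ℝ} {φ : ℝ → MetricO n E (n + 1)} {φlim : MetricO n E (n + 1)}

/-- The fiber metric depends only on the second derivatives along the fiber. -/
theorem MetricO.fiberMetric_eq_leviOf {k : ℕ} (h : MetricO n E k) (C : FrameChart n E)
    (i : Fin (n + 1)) {p : Loc n} (hp : p.1 ∈ C.domain) (α β : Fin n) :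
    fiberMetric (h.loc C i) p α β
      = leviOf (iteratedFDeriv ℝ 2 (fun z : Fin n → ℂ => h.loc C i (p.1, z)) p.2)
        (Pi.single α 1) (Pi.single β 1) := by
  have hA : ∀ y : Fin n → ℂ, HasFDerivAt (fun z : Fin n → ℂ => ((p.1, z) : Loc n))
      (ContinuousLinearMap.inr ℝ ℂ (Fin n → ℂ)) y := fun y => hasFDerivAt_prodMk_right p.1 y
  have hsm : ContDiffOn ℝ ∞ (fun z : Fin n → ℂ => h.loc C i (p.1, z)) univ :=
    (h.loc_contDiffOn C i).comp (f := fun z : Fin n → ℂ => ((p.1, z) : Loc n))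
      (contDiff_prodMk_right p.1).contDiffOn fun z _ => ⟨hp, mem_univ _⟩
  rw [← levi_eq_leviOf isOpen_univ hsm (mem_univ _)]
  exact (levi_comp_affine (A := fun z : Fin n → ℂ => ((p.1, z) : Loc n)) isOpen_univ C.isOpen_affine
    (mem_univ p.2) hA (fun y _ => (⟨hp, mem_univ _⟩ : ((p.1, y) : Loc n) ∈ C.affine))
    (fun ξ => by simp [Prod.smul_mk]) (h.loc_contDiffOn C i) (Pi.single α 1) (Pi.single β 1)).symm

theorem ConvergesOnFibers.tendsto_fiberMetric (hc : ConvergesOnFibers φ φlim) (C : FrameChart n E)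
    (i : Fin (n + 1)) {p : Loc n} (hp : p.1 ∈ C.domain) :
    Tendsto (fun t => fiberMetric ((φ t).loc C i) p) atTop (𝓝 (fiberMetric (φlim.loc C i) p)) := by
  refine tendsto_pi_nhds.2 fun α => tendsto_pi_nhds.2 fun β => ?_
  simp only [MetricO.fiberMetric_eq_leviOf _ C i hp]
  have h := ((hc C i p.1 hp 2).tendstoLocallyUniformlyOn (s := univ)).tendsto_at (mem_univ p.2)
  exact ((leviOf_continuous (V := Fin n → ℂ) _ _).tendsto _).comp h

theorem ConvergesOnFibers.tendstoLocallyUniformly_loc (hc : ConvergesOnFibers φ φlim)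
    (C : FrameChart n E) (i : Fin (n + 1)) {s : ℂ} (hs : s ∈ C.domain) :
    TendstoLocallyUniformly (fun t z => (φ t).loc C i (s, z)) (fun z => φlim.loc C i (s, z))
      atTop := by
  have h := hc C i s hs 0
  rw [Metric.tendstoLocallyUniformly_iff] at h ⊢
  intro ε hε z
  obtain ⟨t, ht, hev⟩ := h ε hε z
  refine ⟨t, ht, hev.mono fun τ hτ y hy => ?_⟩
  have := hτ y hy
  simp only [iteratedFDeriv_zero_eq_comp, Function.comp_apply, LinearIsometryEquiv.dist_map] at this
  exact this

/-- By homogeneity and compactness of the fibers, the weights converge uniformly. -/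
theorem ConvergesOnFibers.eventually_abs_sub_le (hc : ConvergesOnFibers φ φlim)
    (C : FrameChart n E) {s : ℂ} (hs : s ∈ C.domain) :
    ∀ᶠ t in atTop, ∀ W : Fin (n + 1) → ℂ, W ≠ 0 →
      |C.pull φlim.weight (s, W) - C.pull (φ t).weight (s, W)| ≤ 1 := by
  have h1 : ∀ j : Fin (n + 1), ∀ᶠ t in atTop, ∀ z ∈ Metric.closedBall (0 : Fin n → ℂ) 1,
      dist (φlim.loc C j (s, z)) ((φ t).loc C j (s, z)) < 1 := by
    intro j
    have hu := (tendstoLocallyUniformlyOn_iff_tendstoUniformlyOn_of_compact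
      (isCompact_closedBall (0 : Fin n → ℂ) 1)).1
      (hc.tendstoLocallyUniformly_loc C j hs).tendstoLocallyUniformlyOn
    exact Metric.tendstoUniformlyOn_iff.1 hu 1 one_pos
  filter_upwards [eventually_all.2 h1] with t ht W hW
  -- the coordinate of largest modulus puts the point into a polydisc of the corresponding chart
  obtain ⟨j, hj⟩ := Finite.exists_max fun j => ‖W j‖
  have hj0 : W j ≠ 0 := by
    intro h
    refine hW (funext fun k => norm_eq_zero.1 (le_antisymm ?_ (norm_nonneg _)))
    simpa [h] using hj k
  set z : Fin n → ℂ := fun k => (W j)⁻¹ * W (j.succAbove k) with hz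
  have hzb : z ∈ Metric.closedBall (0 : Fin n → ℂ) 1 := by
    rw [mem_closedBall_zero_iff, pi_norm_le_iff_of_nonneg zero_le_one]
    intro k
    rw [hz, norm_mul, norm_inv, inv_mul_le_iff₀ (norm_pos_iff.2 hj0), mul_one]
    exact hj _
  have hWz : W = W j • homCoord j (1, z) := by
    rw [← homCoord_smul]
    funext k
    refine Fin.succAboveCases j ?_ (fun k => ?_) k
    · simp [homCoord]
    · simp [homCoord, hz, mul_inv_cancel_left₀ hj0]
  have hne := homCoord_ne_zero j (one_ne z)
  have h2 := ht j z hzb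
  rw [hWz, φlim.pull_smul C hs hj0 hne, (φ t).pull_smul C hs hj0 hne, add_sub_add_right_eq_sub]
  exact h2.le

theorem ConvergesOnFibers.tendsto_sectionNormSq (hc : ConvergesOnFibers φ φlim)
    (C : FrameChart n E) (i : Fin (n + 1)) {s : ℂ} (hs : s ∈ C.domain) :
    Tendsto (fun t => sectionNormSq ((φ t).loc C i) 1 s) atTop
      (𝓝 (sectionNormSq (φlim.loc C i) 1 s)) := by
  simp only [sectionNormSq_one]
  refine Tendsto.const_mul _ ?_
  have hint := φlim.integrable_exp C i hs
  refine tendsto_integral_filter_of_dominated_convergence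
    (fun z => Real.exp 1 * Real.exp (-φlim.loc C i (s, z))) ?_ ?_ (hint.const_mul _) ?_
  · exact Eventually.of_forall fun t => ((φ t).integrable_exp C i hs).aestronglyMeasurable
  · filter_upwards [hc.eventually_abs_sub_le C hs] with t ht
    refine Eventually.of_forall fun z => ?_
    rw [Real.norm_of_nonneg (Real.exp_pos _).le, ← Real.exp_add]
    refine Real.exp_le_exp.2 ?_
    have h1 := (abs_le.1 (ht (homCoord i (1, z)) (homCoord_ne_zero i (one_ne z)))).2
    have h2 : φlim.loc C i (s, z) - (φ t).loc C i (s, z) ≤ 1 := h1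
    linarith
  · refine Eventually.of_forall fun z => ?_
    have h := ((hc.tendstoLocallyUniformly_loc C i hs).tendstoLocallyUniformlyOn
      (s := univ)).tendsto_at (mem_univ z)
    exact (Real.continuous_exp.tendsto _).comp h.neg

/-- The limit metric solves the stationary equation: otherwise the weights would not converge. -/
theorem IsFlow.limit_stationary (hJ : J.OrdConnected) (hJ' : J.Nontrivial) (hφ : IsFlow J φ)
    (hJ'' : ¬ BddAbove J) (hc : ConvergesOnFibers φ φlim) (C : FrameChart n E) (i : Fin (n + 1))
    {p : Loc n} (hp : p.1 ∈ C.domain) :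
    (fiberMetric (φlim.loc C i) p).det.re * Real.exp (φlim.loc C i p)
        * sectionNormSq (φlim.loc C i) 1 p.1 / (fiberVolume n * 2 ^ n) = 1 := by
  obtain ⟨a, ha⟩ := hJ'.nonempty
  have hsub := Ioi_subset_of_not_bddAbove hJ hJ'' ha
  have hf : Tendsto (fun t => (φ t).loc C i p) atTop (𝓝 (φlim.loc C i p)) :=
    ((hc.tendstoLocallyUniformly_loc C i hp).tendstoLocallyUniformlyOn
      (s := univ)).tendsto_at (mem_univ p.2)
  have hdet : Tendsto (fun t => (fiberMetric ((φ t).loc C i) p).det.re) atTop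
      (𝓝 (fiberMetric (φlim.loc C i) p).det.re) := by
    have hcont : Continuous fun M : Matrix (Fin n) (Fin n) ℂ => M.det.re :=
      Complex.continuous_re.comp (continuous_id.matrix_det)
    exact (hcont.tendsto _).comp (hc.tendsto_fiberMetric C i hp)
  have hX := ((hdet.mul ((Real.continuous_exp.tendsto _).comp hf)).mul
    (hc.tendsto_sectionNormSq C i hp)).div_const (fiberVolume n * 2 ^ n)
  refine eq_one_of_tendsto_of_deriv (a := a) hf hX (fun t ht => ?_) fun t ht => ?_
  · have h1 := (det_re_pos (hφ.pos t (hsub (le_of_lt ht)) C i p hp)).1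
    have h2 := (φ t).sectionNormSq_pos C i hp
    have h3 := fiberVolume_pos n
    exact div_pos (mul_pos (mul_pos h1 (Real.exp_pos _)) h2) (by positivity)
  · have h1 := (hφ.flow t (hsub (le_of_lt ht)) C i p hp).hasDerivAt
      (mem_of_superset (Ici_mem_nhds ht) hsub)
    rw [(φ t).density_ratio (hφ.pos t (hsub (le_of_lt ht))) C i hp] at h1
    exact h1

/-- Positivity along the fibers passes to the limit as semipositivity, and the stationary equation
excludes a vanishing determinant. -/
theorem IsFlow.limit_fiberPos (hJ : J.OrdConnected) (hJ' : J.Nontrivial) (hφ : IsFlow J φ)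
    (hJ'' : ¬ BddAbove J) (hc : ConvergesOnFibers φ φlim) : φlim.FiberPos := by
  intro C i p hp
  obtain ⟨a, ha⟩ := hJ'.nonempty
  have hsub := Ioi_subset_of_not_bddAbove hJ hJ'' ha
  have hlim := hc.tendsto_fiberMetric C i hp
  have hherm := fiberMetric_isHermitian C.isOpen_affine (φlim.loc_contDiffOn C i)
    (⟨hp, mem_univ _⟩ : p ∈ C.affine)
  have hpsd : (fiberMetric (φlim.loc C i) p).PosSemidef := by
    refine Matrix.PosSemidef.of_dotProduct_mulVec_nonneg hherm fun x => ?_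
    have hcont : Continuous fun M : Matrix (Fin n) (Fin n) ℂ => star x ⬝ᵥ M.mulVec x :=
      continuous_const.dotProduct (continuous_id.matrix_mulVec continuous_const)
    refine ge_of_tendsto ((hcont.tendsto _).comp hlim) ?_
    filter_upwards [eventually_ge_atTop a] with t ht
    exact (hφ.pos t (hsub ht) C i p hp).posSemidef.dotProduct_mulVec_nonneg x
  refine hpsd.posDef_iff_isUnit.2 ?_
  rw [Matrix.isUnit_iff_isUnit_det, isUnit_iff_ne_zero]
  intro h0
  have := hφ.limit_stationary hJ hJ' hJ'' hc C i hp
  rw [h0] at this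
  simp at this

/-- The stationary equation for the root of the limit metric. -/
theorem IsFlow.limit_det_root (hJ : J.OrdConnected) (hJ' : J.Nontrivial) (hφ : IsFlow J φ)
    (hJ'' : ¬ BddAbove J) (hc : ConvergesOnFibers φ φlim) (C : FrameChart n E) (i : Fin (n + 1))
    {p : Loc n} (hp : p.1 ∈ C.domain) {u : ℂ → ℂ} (hu0 : u p.1 ≠ 0) :
    (fiberMetric (φlim.root.loc C i) p).det =
      ((‖u p.1‖ ^ 2 * Real.exp (-(φlim.root.loc C i p)) ^ (n + 1) /
        ((n + 1 : ℝ) ^ n / (fiberVolume n * 2 ^ n)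
          * sectionNormSq (φlim.loc C i) u p.1) : ℝ) : ℂ) := by
  have hst := hφ.limit_stationary hJ hJ' hJ'' hc C i hp
  have hI := φlim.sectionNormSq_pos C i hp
  have hV := fiberVolume_pos n
  have hu1 : ‖u p.1‖ ≠ 0 := norm_ne_zero_iff.2 hu0
  have hroot : φlim.root.loc C i p = (n + 1 : ℝ)⁻¹ * φlim.loc C i p :=
    congrFun (φlim.root_loc C i) p
  have hexp : Real.exp (-(φlim.root.loc C i p)) ^ (n + 1) = Real.exp (-φlim.loc C i p) := by
    rw [← Real.exp_nat_mul, hroot]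
    congr 1
    push_cast
    field_simp
  have hdet : (fiberMetric (φlim.root.loc C i) p).det
      = (((n + 1 : ℝ)⁻¹ ^ n * (fiberMetric (φlim.loc C i) p).det.re : ℝ) : ℂ) := by
    have hre := (det_re_pos (hφ.limit_fiberPos hJ hJ' hJ'' hc C i p hp)).2
    rw [φlim.root_loc C i, fiberMetric_const_mul C.isOpen_affine (φlim.loc_contDiffOn C i)
      ⟨hp, mem_univ _⟩, Matrix.det_smul, Fintype.card_fin, hre,
      ← Complex.ofReal_pow, ← Complex.ofReal_mul, Complex.ofReal_re]
  rw [hdet, hexp, sectionNormSq_eq]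
  congr 1
  rw [Real.exp_neg, inv_pow]
  have he := Real.exp_pos (φlim.loc C i p)
  field_simp at hst ⊢
  linear_combination hst

/-- The equation for the geodesic curvature of the limit metric: the evolution equation with
vanishing left hand side. -/
theorem IsFlow.limit_curvature (hJ : J.OrdConnected) (hJ' : J.Nontrivial) (hφ : IsFlow J φ)
    (hJ'' : ¬ BddAbove J) (hc : ConvergesOnFibers φ φlim) (C : FrameChart n E) (i : Fin (n + 1))
    {p : Loc n} (hp : p.1 ∈ C.domain) {u : ℂ → ℂ} (hu : AnalyticAt ℂ u p.1) (hu0 : u p.1 ≠ 0)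
    {κ : ℝ} (hκ : 0 < κ) :
    box (φlim.root.loc C i) (geodesicCurvature (φlim.root.loc C i)) p
        - ((n + 1 : ℕ) : ℂ) * geodesicCurvature (φlim.root.loc C i) p
      = kodairaSpencerNormSq (φlim.root.loc C i) p
        - lineCurvature (fun s => κ * sectionNormSq (φlim.loc C i) u s) p.1 := by
  have hpos := hφ.limit_fiberPos hJ hJ' hJ'' hc
  have hcore := φlim.levi_flow hpos C i (ψ := fun _ => 0) contDiffOn_const
    (K := Real.log (fiberVolume n * 2 ^ n)) (fun q hq => by
      rw [← φlim.log_density_ratio hpos C i hq.1, φlim.density_ratio hpos C i hq.1,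
        hφ.limit_stationary hJ hJ' hJ'' hc C i hq.1, Real.log_one]) hp
  have hd := ddbarLog_sectionNormSq (Φ := φlim.loc C i) C.isOpen_domain hp
    (fun σ hσ => φlim.sectionNormSq_pos C i hσ) hcore.1 hu hu0 hκ
  obtain ⟨e1, e2, e3⟩ := φlim.root_terms hpos C i hp
  have h := hcore.2
  rw [levi_const] at h
  rw [e1, e2, e3, lineCurvature, hd]
  linear_combination h

end Limit

end RelKRF

end

theorem mainTheorem3 (n : ℕ) {S : Type*} [TopologicalSpace S] [ChartedSpace ℂ S]
    [IsManifold 𝓘(ℂ) ω S]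
    (E : S → Type*) [TopologicalSpace (Bundle.TotalSpace (Fin (n + 1) → ℂ) E)]
    [∀ s, AddCommGroup (E s)] [∀ s, Module ℂ (E s)] [∀ s, TopologicalSpace (E s)]
    [FiberBundle (Fin (n + 1) → ℂ) E] [VectorBundle ℂ (Fin (n + 1) → ℂ) E]
    [ContMDiffVectorBundle ω (Fin (n + 1) → ℂ) E 𝓘(ℂ)]
    (J : Set ℝ) (hJ : J.OrdConnected) (hJ' : J.Nontrivial)
    (φ : ℝ → RelKRF.MetricO n E (n + 1)) (hφ : RelKRF.IsFlow J φ) :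
    (∀ t ∈ J, ∀ (C : RelKRF.FrameChart n E) (i : Fin (n + 1)) (p : RelKRF.Loc n),
      p.1 ∈ C.domain → ∀ u : ℂ → ℂ, AnalyticAt ℂ u p.1 → u p.1 ≠ 0 →
        HasDerivWithinAt (fun τ => RelKRF.geodesicCurvature ((φ τ).loc C i) p)
          (-RelKRF.box ((φ t).loc C i) (RelKRF.geodesicCurvature ((φ t).loc C i)) p
            + RelKRF.geodesicCurvature ((φ t).loc C i) p
            + RelKRF.kodairaSpencerNormSq ((φ t).loc C i) p
            + RelKRF.ddbarLog (RelKRF.sectionNormSq ((φ t).loc C i) u) p.1) J t ∧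
        HasDerivWithinAt (fun τ => RelKRF.geodesicCurvature ((φ τ).loc C i) p)
          (-RelKRF.box ((φ t).root.loc C i)
                (RelKRF.geodesicCurvature ((φ t).root.loc C i)) p
            + ((n + 1 : ℕ) : ℂ) * RelKRF.geodesicCurvature ((φ t).root.loc C i) p
            + RelKRF.kodairaSpencerNormSq ((φ t).root.loc C i) p
            + RelKRF.ddbarLog (RelKRF.sectionNormSq ((φ t).loc C i) u) p.1) J t) ∧
    (¬ BddAbove J → ∀ φlim : RelKRF.MetricO n E (n + 1), RelKRF.ConvergesOnFibers φ φlim →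
      φlim.FiberPos ∧
      ∃ κ : ℝ, 0 < κ ∧
        ∀ (C : RelKRF.FrameChart n E) (i : Fin (n + 1)) (p : RelKRF.Loc n),
          p.1 ∈ C.domain → ∀ u : ℂ → ℂ, AnalyticAt ℂ u p.1 → u p.1 ≠ 0 →
            (RelKRF.fiberMetric (φlim.root.loc C i) p).det =
              ((‖u p.1‖ ^ 2 * Real.exp (-(φlim.root.loc C i p)) ^ (n + 1) /
                (κ * RelKRF.sectionNormSq (φlim.loc C i) u p.1) : ℝ) : ℂ) ∧
            RelKRF.box (φlim.root.loc C i)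
                (RelKRF.geodesicCurvature (φlim.root.loc C i)) p
              - ((n + 1 : ℕ) : ℂ) * RelKRF.geodesicCurvature (φlim.root.loc C i) p =
            RelKRF.kodairaSpencerNormSq (φlim.root.loc C i) p
              - RelKRF.lineCurvature
                  (fun s => κ * RelKRF.sectionNormSq (φlim.loc C i) u s) p.1) := by
  refine ⟨fun t ht C i p hp u hu hu0 =>
    ⟨hφ.evolution hJ hJ' ht C i hp hu hu0, ?_⟩, fun hJ'' φlim hc => ?_⟩
  · obtain ⟨e1, e2, e3⟩ := (φ t).root_terms (hφ.pos t ht) C i hp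
    rw [e1, e2, e3]
    exact hφ.evolution hJ hJ' ht C i hp hu hu0
  have hV := RelKRF.fiberVolume_pos n
  refine ⟨hφ.limit_fiberPos hJ hJ' hJ'' hc, (n + 1 : ℝ) ^ n / (RelKRF.fiberVolume n * 2 ^ n),
    by positivity, fun C i p hp u hu hu0 => ⟨?_, ?_⟩⟩
  · exact hφ.limit_det_root hJ hJ' hJ'' hc C i hp hu0
  · exact hφ.limit_curvature hJ hJ' hJ'' hc C i hp hu hu0 (by positivity)
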